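/- **Setting.** All vector spaces are over $\mathbb C$, $n\ge 2$ and $p\ge 1$. An $n$-Lie conformal algebra is a $\mathbb C[\partial]$-module $R$ with a polynomial $\lambda$-bracket $$[a^1{}_{\lambda_1}\cdots{}_{\lambda_{n-1}}a^n]=\sum_{k\in\mathbb N^{n-1}}\tfrac{\lambda_1^{k_1}}{k_1!}\cdots\tfrac{\lambda_{n-1}^{k_{n-1}}}{k_{n-1}!}\;a^1{}_{(k_1)}\cdots{}_{(k_{n-1})}a^n$$ that is conformally sesquilinear ($\partial a^i$ acts as $-\lambda_i$ for $i<n$, and $\partial a^n$ gives $\partial+\sum\lambda_i$), conformally skew-symmetric, and satisfies the conformal Filippov identity $\sum_{i=1}^n(-1)^{n-i}[a^1{}_{\lambda_1}\cdots\widehat{a^i}\cdots a^n{}_{\lambda_n}[a^i{}_{\lambda_i}b^2{}_{\lambda_{n+1}}\cdots b^n]]=[[a^1{}_{\lambda_1}\cdots a^n]_{\lambda_1+\cdots+\lambda_n}b^2{}_{\lambda_{n+1}}\cdots b^n]$. A conformal representation of $R$ is a $\mathbb C[\partial]$-module $M$ with a polynomial action $a^1{}_{\lambda_1}\cdots a^{n-1}{}_{\lambda_{n-1}}v$,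 sesquilinear, skew-symmetric in the $a^i$, and satisfying the two identities obtained from the Filippov identity by letting the last argument be in $M$. Let $R$ be an $n$-Lie conformal algebra and $M$ a conformal representation of it. *Basic complex.* For $q\ge1$, $\widetilde C^q(R,M)$ is the space of linear maps $\gamma_\lambda:(R^{\otimes(n-1)})^{\otimes(q-1)}\otimes R\to M[\lambda]$, with one variable $\lambda$ for each argument $a^i_j$ ($1\le i\le q-1$, $1\le j\le n-1$) and $a^{q-1}_n$, such that replacing an argument by $\partial$ of it multiplies $\gamma_\lambda$ by minus its variable, and such that, for each $i$, $\gamma_\lambda$ is skew-symmetric under simultaneous permutations of the arguments $a^i_\bullet$ and their variables (for $i=q-1$ this includes $a^{q-1}_n$). Write $\gamma_{(m)}$ for the coefficient of $\prod\lambda^{m}/m!$. With $[\,a^i_{1\to n-1},a^j_{1\to n-1}]$ denoting the sum over $l$ of the tuples $a^j$ with $a^j_l$ replaced by $[a^i_1{}_{\lambda^i_1}\cdots a^i_{n-1}{}_{\lambda^i_{n-1}}a^j_l]$ and $\lambda^j_l$ by $\lambda^j_l+\lambda^i_1+\cdots+\lambda^i_{n-1}$, the differential is $$\begin{aligned}(D\gamma)_\lambda(a^1,\dots,a^q,a^q_n)={}&\sum_{i<j}(-1)^i\gamma(\dots,\widehat{a^i},\dots,[a^i,a^j],\dots,a^q_n)+\sum_{i=1}^q(-1)^i\gamma_{\dots,\lambda^q_n+\sum_j\lambda^i_j}(\dots,\widehat{a^i},\dots,[a^i_1{}_{\lambda^i_1}\cdots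 a^i_{n-1}{}_{\lambda^i_{n-1}}a^q_n])\\&+\sum_{i=1}^q(-1)^{i+1}a^i_1{}_{\lambda^i_1}\cdots a^i_{n-1}{}_{\lambda^i_{n-1}}\gamma(\dots,\widehat{a^i},\dots,a^q_n)\\&+\sum_{i=1}^{n-1}(-1)^{n+q-i+1}a^q_1{}_{\lambda^q_1}\cdots\widehat{a^q_i}\cdots a^q_n{}_{\lambda^q_n}\,\gamma(a^1,\dots,a^{q-1},a^q_i).\end{aligned}$$ The operator $\partial$ acts on $\widetilde C^q(R,M)$ as multiplication by $\partial$ plus the sum of all variables. *Annihilation algebras.* Let $\mathscr Lie_pR=R[t_1^{\pm1},\dots,t_p^{\pm1}]/(\partial+\partial_{t_1}+\cdots+\partial_{t_p})R[t_1^{\pm1},\dots,t_p^{\pm1}]$, let $a_m=a_{m_1,\dots,m_p}$ be the class of $a\otimes t_1^{m_1}\cdots t_p^{m_p}$, and let $(\mathscr Lie_pR)_-$ be the span of the $a_m$ with $m\in\mathbb N^p$. It is an $n$-Lie algebra with bracket $$[a^1_{m^1},\dots,a^n_{m^n}]=\sum_{j^1,\dots,j^{n-1}\in\mathbb N^p}\prod_{i,c}\tbinom{m^i_c}{j^i_c}\,\bigl(a^1{}_{(\sum_c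 j^1_c)}\cdots{}_{(\sum_c j^{n-1}_c)}a^n\bigr)_{m^1+\cdots+m^n-j^1-\cdots-j^{n-1}},$$ $M$ is a representation of it by $(a^1_{m^1},\dots,a^{n-1}_{m^{n-1}})v=a^1{}_{(\sum_c m^1_c)}\cdots a^{n-1}{}_{(\sum_c m^{n-1}_c)}v$, and $\partial a_m=(\partial a)_m$. For $q\ge1$ let $C^q((\mathscr Lie_pR)_-,M)$ be the space of all linear maps $(\wedge^{n-1}\mathfrak g)^{\otimes(q-1)}\wedge\mathfrak g\to M$, $\mathfrak g=(\mathscr Lie_pR)_-$, with the usual $n$-Lie algebra differential $D$ (the formula above without $\lambda$'s) and with $(\partial\gamma)(x_1,x_2,\dots)=\partial(\gamma(x_1,x_2,\dots))-\sum_i\gamma(\dots,\partial x_i,\dots)$. Let $C^q_{c}((\mathscr Lie_pR)_-,M)\subseteq C^q((\mathscr Lie_pR)_-,M)$ be the subspace of *local* cochains: for fixed elements of $R$, $\gamma(a_{m},b_{m'},\dots)\neq0$ for only finitely many exponents $m,m',\ldots\in\mathbb N^p$. (The complexes start in degree $q=1$.) **Theorem.** The spaces above, with $D$, are cochain complexes,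 and $C^*_c$ is a subcomplex of $C^*((\mathscr Lie_pR)_-,M)$; $\partial$ acts on $\widetilde C^q(R,M)$ and $C^q((\mathscr Lie_pR)_-,M)$. For every $p\ge1$ there is a well-defined morphism of cochain complexes $\varphi:\widetilde C^*(R,M)\to C^*((\mathscr Lie_pR)_-,M)$ given by $$(\varphi\gamma)\bigl((a^1_1)_{m^1_1},\dots,(a^{q-1}_n)_{m^{q-1}_n}\bigr)=\gamma_{(\sum_c m^1_{1,c},\;\dots,\;\sum_c m^{q-1}_{n,c})}(a^1_1,\dots,a^{q-1}_n).$$ It is a monomorphism, commutes with the $\partial$-actions, and takes values in $C^*_c((\mathscr Lie_pR)_-,M)$. For $p=1$ it is an isomorphism of complexes $\widetilde C^*(R,M)\cong C^*_c((\mathscr Lie_1R)_-,M)$, and hence induces isomorphisms $\widetilde H^q(R,M)\cong H^q_c((\mathscr Lie_1R)_-,M)$ for all $q$. Moreover, if $R=\bigoplus_{i=1}^d\mathbb C[\partial]v^i\oplus\mathrm{Tor}\,R$ with $v^1,\dots,v^d$ independent over $\mathbb C[\partial]$ (for instance, if $R$ is finitely generated over $\mathbb C[\partial]$, for suitable $v^i$),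 then the local cochains are exactly the cochains that are continuous for the topology on $(\mathscr Lie_pR)_-$ in which the subspaces $\mathrm{span}\{v^i_m : m\in\mathbb N^p,\ \sum_c m_c\ge N\}$, $N\ge0$, form a basis of neighbourhoods of $0$, and the discrete topology on $M$. -/

import Mathlib

open Polynomial CategoryTheory

universe u v

set_option linter.unusedSectionVars false

noncomputable section

namespace NLieConf

/-! ### Auxiliary notation -/

/-- `∏ i, (m i choose j i)`, as a complex number. -/
def binom {ι : Type*} [Fintype ι] (m j : ι → ℕ) : ℂ := ∏ i, ((m i).choose (j i) : ℂ)

/-- Lower the `i`-th entry of `k` by one. It is only used with the coefficient `k i`, so that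
the value at `k i = 0` is irrelevant. -/
def lowerAt {ι : Type*} [DecidableEq ι] (k : ι → ℕ) (i : ι) : ι → ℕ :=
  Function.update k i (k i - 1)

/-- Replace the entry in row `i`, column `j`. -/
def setEntry {α : Type*} {k r : ℕ} (x : Fin k → Fin r → α) (i : Fin k) (j : Fin r) (y : α) :
    Fin k → Fin r → α :=
  Function.update x i (Function.update (x i) j y)

/-- Interchange the entries `j` and `j'` of row `i`. -/
def swapEntries {α : Type*} {k r : ℕ} (x : Fin k → Fin r → α) (i : Fin k) (j j' : Fin r) :
    Fin k → Fin r → α :=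
  Function.update x i (x i ∘ Equiv.swap j j')

/-- Append one entry to a tuple. -/
abbrev app {α : Type*} {r : ℕ} (x : Fin r → α) (y : α) : Fin (r + 1) → α :=
  Fin.snoc (α := fun _ => α) x y

/-- Prepend one entry to a tuple. -/
abbrev pre {α : Type*} {r : ℕ} (y : α) (x : Fin r → α) : Fin (r + 1) → α :=
  Fin.cons (α := fun _ => α) y x

/-- The action of `∂` on a `ℂ[∂]`-module, as a `ℂ`-linear map. -/
def del (R : Type*) [AddCommGroup R] [Module ℂ R] [Module ℂ[X] R] [IsScalarTower ℂ ℂ[X] R] :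
    R →ₗ[ℂ] R :=
  Algebra.lsmul ℂ ℂ R (Polynomial.X : ℂ[X])

section Conformal

variable (s : ℕ) (R : Type u) [AddCommGroup R] [Module ℂ R] [Module ℂ[X] R]
  [IsScalarTower ℂ ℂ[X] R]

/-! ### `n`-Lie conformal algebras and conformal representations -/

/-- An `n`-Lie conformal algebra structure, `n = s + 2 ≥ 2`, on the `ℂ[∂]`-module `R`, given by its
`n`-linear products `prod k a = a¹_(k₁) a²_(k₂) ⋯ _(k_{n-1}) aⁿ`, which are the coefficients of the
`λ`-bracket:
`[a¹_{λ₁} ⋯ _{λ_{n-1}} aⁿ] = ∑ k, λ₁^{k₁}/k₁! ⋯ λ_{n-1}^{k_{n-1}}/k_{n-1}! · prod k a`. -/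
structure NLieConformalAlgebra where
  prod : (Fin (s + 1) → ℕ) → MultilinearMap ℂ (fun _ : Fin (s + 2) => R) R
  /-- The bracket is polynomial in `λ`. -/
  polynomial : ∀ a, {k | prod k a ≠ 0}.Finite
  /-- `[a¹ ⋯ (∂aⁱ)_{λᵢ} ⋯ aⁿ] = -λᵢ [a¹ ⋯ aⁿ]` for `i < n`. -/
  del_left : ∀ k a (i : Fin (s + 1)),
    prod k (Function.update a i.castSucc (del R (a i.castSucc))) = -(k i : ℂ) • prod (lowerAt k i) a
  /-- `[a¹ ⋯ ∂aⁿ] = (∂ + λ₁ + ⋯ + λ_{n-1}) [a¹ ⋯ aⁿ]`. -/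
  del_last : ∀ k a,
    prod k (Function.update a (Fin.last _) (del R (a (Fin.last _)))) =
      del R (prod k a) + ∑ i, (k i : ℂ) • prod (lowerAt k i) a
  /-- Simultaneous interchange of `aⁱ, aⁱ⁺¹` and `λᵢ, λᵢ₊₁`, for `i ≤ n - 2`. -/
  skew_left : ∀ k a (i : Fin s),
    prod (k ∘ Equiv.swap i.castSucc i.succ)
      (a ∘ Equiv.swap i.castSucc.castSucc i.succ.castSucc) = -prod k a
  /-- `[a¹_{λ₁} ⋯ aⁿ⁻¹_{λ_{n-1}} aⁿ] = -[a¹_{λ₁} ⋯ aⁿ_{-∂-λ₁-⋯-λ_{n-1}} aⁿ⁻¹]`. -/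
  skew_last : ∀ k a,
    prod k a = -∑ j ∈ Finset.Iic (fun i : Fin s => k i.castSucc), ∑ᶠ t : ℕ,
      ((-1 : ℂ) ^ (t + ∑ i : Fin s, (k i.castSucc - j i) + k (Fin.last s)) *
          binom (fun i : Fin s => k i.castSucc) j * ((t.factorial : ℂ)⁻¹)) •
        (del R ^ t) (prod (app j (t + ∑ i : Fin s, (k i.castSucc - j i) + k (Fin.last s)))
          (a ∘ Equiv.swap (Fin.last s).castSucc (Fin.last (s + 1))))
  /-- The Filippov identity
  `∑ᵢ (-1)^{n-i} [a¹ ⋯ âⁱ ⋯ aⁿ_{λₙ} [aⁱ_{λᵢ} b² ⋯ bⁿ]] = [[a¹ ⋯ aⁿ]_{λ₁+⋯+λₙ} b² ⋯ bⁿ]`. -/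
  filippov : ∀ (k : Fin (s + 2) → ℕ) (l : Fin s → ℕ) (a : Fin (s + 2) → R) (b : Fin (s + 1) → R),
    ∑ i : Fin (s + 2), (-1 : ℂ) ^ (s + 1 + (i : ℕ)) •
        prod (k ∘ i.succAbove) (app (a ∘ i.succAbove) (prod (pre (k i) l) (pre (a i) b))) =
      ∑ j ∈ Finset.Iic (fun i : Fin (s + 1) => k i.castSucc),
        binom (fun i : Fin (s + 1) => k i.castSucc) j •
          prod (pre (k (Fin.last _) + ∑ i : Fin (s + 1), (k i.castSucc - j i)) l)
            (pre (prod j a) b)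

variable {s R}
variable (A : NLieConformalAlgebra s R)
variable (M : Type v) [AddCommGroup M] [Module ℂ M] [Module ℂ[X] M] [IsScalarTower ℂ ℂ[X] M]

/-- A conformal representation of `R` on the `ℂ[∂]`-module `M`, given by the coefficients
`act k a v = a¹_(k₁) ⋯ aⁿ⁻¹_(k_{n-1}) v` of the `λ`-action:
`a¹_{λ₁} ⋯ aⁿ⁻¹_{λ_{n-1}} v = ∑ k, λ₁^{k₁}/k₁! ⋯ λ_{n-1}^{k_{n-1}}/k_{n-1}! · act k a v`. -/
structure ConformalRep where
  act : (Fin (s + 1) → ℕ) → MultilinearMap ℂ (fun _ : Fin (s + 1) => R) (M →ₗ[ℂ] M)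
  polynomial : ∀ a v, {k | act k a v ≠ 0}.Finite
  del_left : ∀ k a (i : Fin (s + 1)) v,
    act k (Function.update a i (del R (a i))) v = -(k i : ℂ) • act (lowerAt k i) a v
  del_last : ∀ k a v,
    act k a (del M v) = del M (act k a v) + ∑ i, (k i : ℂ) • act (lowerAt k i) a v
  skew : ∀ k a (i : Fin s) v,
    act (k ∘ Equiv.swap i.castSucc i.succ) (a ∘ Equiv.swap i.castSucc i.succ) v = -act k a v
  /-- `∑ᵢ (-1)^{n-i} a¹ ⋯ âⁱ ⋯ aⁿ_{λₙ} (aⁱ_{λᵢ} b¹ ⋯ bⁿ⁻² v) = [a¹ ⋯ aⁿ]_{λ₁+⋯+λₙ} b¹ ⋯ bⁿ⁻² v`. -/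
  filippov : ∀ (k : Fin (s + 2) → ℕ) (l : Fin s → ℕ) (a : Fin (s + 2) → R) (b : Fin s → R) (v : M),
    ∑ i : Fin (s + 2), (-1 : ℂ) ^ (s + 1 + (i : ℕ)) •
        act (k ∘ i.succAbove) (a ∘ i.succAbove) (act (pre (k i) l) (pre (a i) b) v) =
      ∑ j ∈ Finset.Iic (fun i : Fin (s + 1) => k i.castSucc),
        binom (fun i : Fin (s + 1) => k i.castSucc) j •
          act (pre (k (Fin.last _) + ∑ i : Fin (s + 1), (k i.castSucc - j i)) l)
            (pre (A.prod j a) b) v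
  /-- `a_λ (b_μ v) - b_μ (a_λ v) = ∑ᵢ b¹_{μ₁} ⋯ [a¹_{λ₁} ⋯ aⁿ⁻¹_{λ_{n-1}} bⁱ]_{λ₁+⋯+λ_{n-1}+μᵢ} ⋯ v`. -/
  commutator : ∀ (k l : Fin (s + 1) → ℕ) (a b : Fin (s + 1) → R) (v : M),
    act k a (act l b v) - act l b (act k a v) =
      ∑ i : Fin (s + 1), ∑ j ∈ Finset.Iic k,
        binom k j • act (Function.update l i (l i + ∑ c, (k c - j c)))
          (Function.update b i (A.prod j (app a (b i)))) v

/-! ### The basic complex -/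

/-- Families of coefficients. The member `γ m m' a a'` is the coefficient
`γ_(m, m')(a¹, …, aᵏ, a')` of the divided powers `∏ (λⁱⱼ)^{mⁱⱼ}/mⁱⱼ! · (λ')^{m'}/m'!` in
`γ_{λ, λ'}(a¹, …, aᵏ, a')`, where each `aⁱ` is an `(n-1)`-tuple of elements of `R`. -/
abbrev CoeffFamily (s : ℕ) (R : Type u) (M : Type v) (k : ℕ) : Type (max u v) :=
  (Fin k → Fin (s + 1) → ℕ) → ℕ → (Fin k → Fin (s + 1) → R) → R → M

variable (s R) in
/-- The space `C̃^q(R, M)`, `q = k + 1`. -/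
def basicCochain (k : ℕ) : Submodule ℂ (CoeffFamily s R M k) where
  carrier := {γ |
    -- linear in every argument
    (∀ m m' a a' i j, IsLinearMap ℂ fun y => γ m m' (setEntry a i j y) a') ∧
    (∀ m m' a, IsLinearMap ℂ (γ m m' a)) ∧
    -- polynomial in the variables `λ`
    (∀ a a', {m : (Fin k → Fin (s + 1) → ℕ) × ℕ | γ m.1 m.2 a a' ≠ 0}.Finite) ∧
    -- conformal antilinearity
    (∀ m m' a a' i j, γ m m' (setEntry a i j (del R (a i j))) a' =
      -(m i j : ℂ) • γ (setEntry m i j (m i j - 1)) m' a a') ∧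
    (∀ m m' a a', γ m m' a (del R a') = -(m' : ℂ) • γ m (m' - 1) a a') ∧
    -- skew-symmetry in each group; the last argument belongs to the last group
    (∀ m m' a a' i j j', j ≠ j' →
      γ (swapEntries m i j j') m' (swapEntries a i j j') a' = -γ m m' a a') ∧
    (∀ m m' a a' (i : Fin k) j, (i : ℕ) + 1 = k →
      γ (setEntry m i j m') (m i j) (setEntry a i j a') (a i j) = -γ m m' a a')}
  zero_mem' := by
    refine ⟨fun _ _ _ _ _ _ => ⟨by simp, by simp⟩, fun _ _ _ => ⟨by simp, by simp⟩, ?_, ?_, ?_,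
      ?_, ?_⟩ <;> intros <;> simp
  add_mem' := by
    rintro γ δ ⟨h1, h2, h3, h4, h5, h6, h7⟩ ⟨g1, g2, g3, g4, g5, g6, g7⟩
    refine ⟨?_, ?_, ?_, ?_, ?_, ?_, ?_⟩
    · intro m m' a a' i j
      exact ((h1 m m' a a' i j).mk' _ + (g1 m m' a a' i j).mk' _).isLinear
    · intro m m' a
      exact ((h2 m m' a).mk' _ + (g2 m m' a).mk' _).isLinear
    · intro a a'
      refine ((h3 a a').union (g3 a a')).subset ?_
      intro m hm
      by_contra hc
      simp only [Set.mem_union, Set.mem_ofPred_eq, not_or, not_not] at hc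
      exact hm (by simp [hc.1, hc.2])
    · intro m m' a a' i j; simp only [Pi.add_apply, smul_add, h4, g4]
    · intro m m' a a'; simp only [Pi.add_apply, smul_add, h5, g5]
    · intro m m' a a' i j j' h
      simp only [Pi.add_apply, h6 m m' a a' i j j' h, g6 m m' a a' i j j' h]; abel
    · intro m m' a a' i j h
      simp only [Pi.add_apply, h7 m m' a a' i j h, g7 m m' a a' i j h]; abel
  smul_mem' := by
    rintro c γ ⟨h1, h2, h3, h4, h5, h6, h7⟩
    refine ⟨?_, ?_, ?_, ?_, ?_, ?_, ?_⟩
    · intro m m' a a' i j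
      exact (c • (h1 m m' a a' i j).mk' _).isLinear
    · intro m m' a
      exact (c • (h2 m m' a).mk' _).isLinear
    · intro a a'
      refine (h3 a a').subset ?_
      intro m hm hc
      exact hm (by simp [hc])
    · intro m m' a a' i j; simp only [Pi.smul_apply, h4, smul_comm c]
    · intro m m' a a'; simp only [Pi.smul_apply, h5, smul_comm c]
    · intro m m' a a' i j j' h
      simp only [Pi.smul_apply, h6 m m' a a' i j j' h, smul_neg]
    · intro m m' a a' i j h
      simp only [Pi.smul_apply, h7 m m' a a' i j h, smul_neg]

variable (s R) in
/-- The `ℂ[∂]`-action on `C̃^q(R, M)`: multiplication of `γ_λ` by `∂ + ∑ λⁱⱼ + λ'`. -/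
def basicDel (k : ℕ) : CoeffFamily s R M k →ₗ[ℂ] CoeffFamily s R M k where
  toFun γ m m' a a' := del M (γ m m' a a') +
    ∑ i, ∑ j, (m i j : ℂ) • γ (setEntry m i j (m i j - 1)) m' a a' +
    (m' : ℂ) • γ m (m' - 1) a a'
  map_add' γ δ := by
    funext m m' a a'
    simp only [Pi.add_apply, map_add, smul_add, Finset.sum_add_distrib]; abel
  map_smul' c γ := by
    funext m m' a a'
    simp only [Pi.smul_apply, map_smul, smul_add, Finset.smul_sum, smul_comm c, RingHom.id_apply]

variable {M} in
/-- The differential `D : C̃^q(R, M) → C̃^{q+1}(R, M)`, `q = k + 1`, of the basic complex, in terms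
of coefficients. -/
def basicD {A : NLieConformalAlgebra s R} (V : ConformalRep A M) (k : ℕ) :
    CoeffFamily s R M k →ₗ[ℂ] CoeffFamily s R M (k + 1) where
  toFun γ m m' a a' :=
    (∑ i : Fin (k + 1), ∑ j ∈ Finset.Ioi i,
      (-1 : ℂ) ^ ((i : ℕ) + 1) • ∑ l : Fin (s + 1), ∑ t ∈ Finset.Iic (m i), binom (m i) t •
        γ (fun c => setEntry m j l (m j l + ∑ c, (m i c - t c)) (i.succAbove c)) m'
          (fun c => setEntry a j l (A.prod t (app (a i) (a j l))) (i.succAbove c)) a') +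
    (∑ i : Fin (k + 1), (-1 : ℂ) ^ ((i : ℕ) + 1) • ∑ t ∈ Finset.Iic (m i), binom (m i) t •
      γ (fun c => m (i.succAbove c)) (m' + ∑ c, (m i c - t c))
        (fun c => a (i.succAbove c)) (A.prod t (app (a i) a'))) +
    (∑ i : Fin (k + 1), (-1 : ℂ) ^ (i : ℕ) •
      V.act (m i) (a i) (γ (fun c => m (i.succAbove c)) m' (fun c => a (i.succAbove c)) a')) +
    (∑ j : Fin (s + 1), (-1 : ℂ) ^ (s + k + 1 + (j : ℕ)) •
      V.act (app (m (Fin.last k) ∘ j.succAbove) m') (app (a (Fin.last k) ∘ j.succAbove) a')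
        (γ (fun c => m c.castSucc) (m (Fin.last k) j)
          (fun c => a c.castSucc) (a (Fin.last k) j)))
  map_add' γ δ := by
    funext m m' a a'
    simp only [Pi.add_apply, map_add, smul_add, Finset.sum_add_distrib]
    abel
  map_smul' c γ := by
    funext m m' a a'
    simp only [Pi.smul_apply, map_smul, smul_add, Finset.smul_sum, smul_comm c, RingHom.id_apply]

end Conformal

/-! ### `n`-Lie algebras, their representations and their cohomology complexes -/

section NLie

variable {s : ℕ} {L : Type u} [AddCommGroup L] [Module ℂ L]
variable {M : Type v} [AddCommGroup M] [Module ℂ M]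

/-- `br` is an `n`-Lie bracket, `n = s + 2`: it is skew-symmetric and all `ad X` are
derivations. -/
def IsNLieBracket (br : MultilinearMap ℂ (fun _ : Fin (s + 2) => L) L) : Prop :=
  (∀ x i j, i ≠ j → br (x ∘ Equiv.swap i j) = -br x) ∧
  ∀ (x : Fin (s + 1) → L) (y : Fin (s + 2) → L),
    br (app x (br y)) = ∑ i, br (Function.update y i (br (app x (y i))))

/-- `ρ` is a representation of the `n`-Lie algebra `(L, br)` on `M`. -/
def IsNLieRep (br : MultilinearMap ℂ (fun _ : Fin (s + 2) => L) L)
    (ρ : MultilinearMap ℂ (fun _ : Fin (s + 1) => L) (M →ₗ[ℂ] M)) : Prop :=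
  (∀ x i j, i ≠ j → ρ (x ∘ Equiv.swap i j) = -ρ x) ∧
  (∀ x y : Fin (s + 1) → L, ρ x ∘ₗ ρ y - ρ y ∘ₗ ρ x =
    ∑ i, ρ (Function.update y i (br (app x (y i))))) ∧
  ∀ (x : Fin (s + 2) → L) (y : Fin s → L), ρ (pre (br x) y) =
    ∑ i : Fin (s + 2), (-1 : ℂ) ^ (s + 1 + (i : ℕ)) • (ρ (x ∘ i.succAbove) ∘ₗ ρ (pre (x i) y))

/-- Functions of `k` tuples of length `n - 1 = s + 1` and one further argument. -/
abbrev Family (s : ℕ) (L : Type u) (M : Type v) (k : ℕ) : Type (max u v) :=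
  (Fin k → Fin (s + 1) → L) → L → M

variable (s L M) in
/-- The space `C^q(L, M)`, `q = k + 1`, of all `q`-cochains of an `n`-Lie algebra `L`: linear maps
`∧ⁿ⁻¹ L ⊗ ⋯ ⊗ ∧ⁿ⁻¹ L ∧ L → M`. -/
def nLieCochain (k : ℕ) : Submodule ℂ (Family s L M k) where
  carrier := {γ |
    (∀ x x' i j, IsLinearMap ℂ fun y => γ (setEntry x i j y) x') ∧
    (∀ x, IsLinearMap ℂ (γ x)) ∧
    (∀ x x' i j j', j ≠ j' → γ (swapEntries x i j j') x' = -γ x x') ∧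
    (∀ x x' (i : Fin k) j, (i : ℕ) + 1 = k → γ (setEntry x i j x') (x i j) = -γ x x')}
  zero_mem' := by
    refine ⟨fun _ _ _ _ => ⟨by simp, by simp⟩, fun _ => ⟨by simp, by simp⟩, ?_, ?_⟩ <;> intros <;>
      simp
  add_mem' := by
    rintro γ δ ⟨h1, h2, h6, h7⟩ ⟨g1, g2, g6, g7⟩
    refine ⟨?_, ?_, ?_, ?_⟩
    · intro x x' i j
      exact ((h1 x x' i j).mk' _ + (g1 x x' i j).mk' _).isLinear
    · intro x
      exact ((h2 x).mk' _ + (g2 x).mk' _).isLinear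
    · intro x x' i j j' h
      simp only [Pi.add_apply, h6 x x' i j j' h, g6 x x' i j j' h]; abel
    · intro x x' i j h
      simp only [Pi.add_apply, h7 x x' i j h, g7 x x' i j h]; abel
  smul_mem' := by
    rintro c γ ⟨h1, h2, h6, h7⟩
    refine ⟨?_, ?_, ?_, ?_⟩
    · intro x x' i j
      exact (c • (h1 x x' i j).mk' _).isLinear
    · intro x
      exact (c • (h2 x).mk' _).isLinear
    · intro x x' i j j' h
      simp only [Pi.smul_apply, h6 x x' i j j' h, smul_neg]
    · intro x x' i j h
      simp only [Pi.smul_apply, h7 x x' i j h, smul_neg]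

/-- The differential `D : C^q(L, M) → C^{q+1}(L, M)`, `q = k + 1`, of the complex of the `n`-Lie
algebra `(L, br)` with coefficients in the representation `(M, ρ)`. -/
def nLieD (br : MultilinearMap ℂ (fun _ : Fin (s + 2) => L) L)
    (ρ : MultilinearMap ℂ (fun _ : Fin (s + 1) => L) (M →ₗ[ℂ] M)) (k : ℕ) :
    Family s L M k →ₗ[ℂ] Family s L M (k + 1) where
  toFun γ x x' :=
    (∑ i : Fin (k + 1), ∑ j ∈ Finset.Ioi i,
      (-1 : ℂ) ^ ((i : ℕ) + 1) • ∑ l : Fin (s + 1),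
        γ (fun c => setEntry x j l (br (app (x i) (x j l))) (i.succAbove c)) x') +
    (∑ i : Fin (k + 1), (-1 : ℂ) ^ ((i : ℕ) + 1) •
      γ (fun c => x (i.succAbove c)) (br (app (x i) x'))) +
    (∑ i : Fin (k + 1), (-1 : ℂ) ^ (i : ℕ) • ρ (x i) (γ (fun c => x (i.succAbove c)) x')) +
    (∑ j : Fin (s + 1), (-1 : ℂ) ^ (s + k + 1 + (j : ℕ)) •
      ρ (app (x (Fin.last k) ∘ j.succAbove) x') (γ (fun c => x c.castSucc) (x (Fin.last k) j)))
  map_add' γ δ := by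
    funext x x'
    simp only [Pi.add_apply, map_add, smul_add, Finset.sum_add_distrib]
    abel
  map_smul' c γ := by
    funext x x'
    simp only [Pi.smul_apply, map_smul, smul_add, Finset.smul_sum, smul_comm c, RingHom.id_apply]

end NLie

/-! ### Complexes from submodules -/

section Complex

/-- The maps `D k` send `C k` to `C (k + 1)` and square to zero on `C k`. -/
def IsComplex {W : ℕ → Type u} [∀ k, AddCommGroup (W k)] [∀ k, Module ℂ (W k)]
    (C : ∀ k, Submodule ℂ (W k)) (D : ∀ k, W k →ₗ[ℂ] W (k + 1)) : Prop :=
  ∀ k, ∀ γ ∈ C k, D k γ ∈ C (k + 1) ∧ D (k + 1) (D k γ) = 0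

variable {W : ℕ → Type u} [∀ k, AddCommGroup (W k)] [∀ k, Module ℂ (W k)]
  {C C' : ∀ k, Submodule ℂ (W k)} {D : ∀ k, W k →ₗ[ℂ] W (k + 1)}

/-- The cochain complex `(C, D)` of complex vector spaces. For the complexes below, the degree `k`
part consists of the `q`-cochains with `q = k + 1`, so `q` runs through `1, 2, 3, …`. -/
def IsComplex.complex (h : IsComplex C D) : CochainComplex (ModuleCat.{u} ℂ) ℕ :=
  CochainComplex.of (fun k => ModuleCat.of ℂ (C k))
    (fun k => ModuleCat.ofHom ((D k).restrict fun γ hγ => (h k γ hγ).1))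
    (fun k => by
      refine ModuleCat.hom_ext (LinearMap.ext fun γ => ?_)
      exact Subtype.ext (h k γ.1 γ.2).2)

/-- The element of `W k` underlying a cochain. -/
def IsComplex.val (h : IsComplex C D) {k : ℕ} (γ : h.complex.X k) : W k :=
  ((show C k from γ) : W k)

/-- The inclusion of a subcomplex. -/
def IsComplex.incl (h : IsComplex C D) (h' : IsComplex C' D) (hle : ∀ k, C k ≤ C' k) :
    h.complex ⟶ h'.complex :=
  CochainComplex.ofHom (X := h.complex) (Y := h'.complex)
    (fun k => ModuleCat.ofHom (Submodule.inclusion (hle k)))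
    (fun k => by
      simp only [IsComplex.complex, CochainComplex.of_d]
      rfl)

end Complex

/-! ### The annihilation algebras -/

section Annihilation

variable (p : ℕ) (R : Type u) [AddCommGroup R] [Module ℂ R] [Module ℂ[X] R]
  [IsScalarTower ℂ ℂ[X] R]

/-- The operator `∂ ⊗ 1 + 1 ⊗ ∂_{t₁} + ⋯ + 1 ⊗ ∂_{t_p}` on `R[t₁^{±1}, …, t_p^{±1}]`. -/
def loopDel : ((Fin p → ℤ) →₀ R) →ₗ[ℂ] ((Fin p → ℤ) →₀ R) :=
  Finsupp.mapRange.linearMap (del R) +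
    ∑ c, Finsupp.lsum ℂ fun m : Fin p → ℤ => (m c : ℂ) • Finsupp.lsingle (m - Pi.single c 1)

/-- The quotient `Lie_p R` of `R[t₁^{±1}, …, t_p^{±1}]` by the image of `loopDel`. -/
abbrev LieP : Type u := ((Fin p → ℤ) →₀ R) ⧸ LinearMap.range (loopDel p R)

variable {p R} in
/-- The class `a_{m₁, …, m_p}` of `a ⊗ t₁^{m₁} ⋯ t_p^{m_p}`. -/
def LieP.mon (m : Fin p → ℤ) : R →ₗ[ℂ] LieP p R :=
  (LinearMap.range (loopDel p R)).mkQ ∘ₗ Finsupp.lsingle m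

/-- The subspace `(Lie_p R)_-` of `Lie_p R` spanned by all `a_{m₁, …, m_p}` with
`m₁, …, m_p ≥ 0`. -/
def annihilation : Submodule ℂ (LieP p R) :=
  Submodule.span ℂ {x | ∃ (m : Fin p → ℕ) (a : R), LieP.mon (fun c => (m c : ℤ)) a = x}

variable {p R} in
/-- The element `a_{m₁, …, m_p}` of `(Lie_p R)_-`. -/
def ann (m : Fin p → ℕ) : R →ₗ[ℂ] annihilation p R :=
  (LieP.mon fun c => (m c : ℤ)).codRestrict _ fun a => Submodule.subset_span ⟨m, a, rfl⟩

/-- The operator `loopDel` on polynomials. -/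
def polyDel : ((Fin p → ℕ) →₀ R) →ₗ[ℂ] ((Fin p → ℕ) →₀ R) :=
  Finsupp.mapRange.linearMap (del R) +
    ∑ c, Finsupp.lsum ℂ fun m : Fin p → ℕ => (m c : ℂ) • Finsupp.lsingle (lowerAt m c)

/-- The canonical map `R[t₁, …, t_p] → (Lie_p R)_-`. -/
def toAnn : ((Fin p → ℕ) →₀ R) →ₗ[ℂ] annihilation p R := Finsupp.lsum ℂ ann

/-- The inclusion of polynomials into Laurent polynomials. -/
def polyEmb : ((Fin p → ℕ) →₀ R) →ₗ[ℂ] ((Fin p → ℤ) →₀ R) :=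
  Finsupp.lmapDomain R ℂ fun m c => (m c : ℤ)

theorem loopDel_single (m : Fin p → ℤ) (a : R) :
    loopDel p R (Finsupp.single m a) = Finsupp.single m (del R a) +
      ∑ c, (m c : ℂ) • Finsupp.single (m - Pi.single c 1) a := by
  simp [loopDel]

theorem polyDel_single (m : Fin p → ℕ) (a : R) :
    polyDel p R (Finsupp.single m a) = Finsupp.single m (del R a) +
      ∑ c, (m c : ℂ) • Finsupp.single (lowerAt m c) a := by
  simp [polyDel]

theorem cast_injective : Function.Injective fun (m : Fin p → ℕ) (c : Fin p) => (m c : ℤ) := by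
  intro m m' h
  funext c
  have := congrFun h c
  simpa using this

theorem polyEmb_polyDel (x : (Fin p → ℕ) →₀ R) :
    polyEmb p R (polyDel p R x) = loopDel p R (polyEmb p R x) := by
  induction x using Finsupp.induction_linear with
  | zero => simp
  | add x y hx hy => simp only [map_add, hx, hy]
  | single m a =>
    simp only [polyEmb, polyDel_single, map_add, map_sum, map_smul, Finsupp.lmapDomain_apply,
      Finsupp.mapDomain_single, loopDel_single]
    congr 1
    refine Finset.sum_congr rfl fun c _ => ?_
    rcases Nat.eq_zero_or_pos (m c) with h | h
    · simp [h]
    · congr 2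
      funext d
      by_cases hd : d = c
      · subst hd
        simp [lowerAt, Nat.cast_sub h]
      · simp [lowerAt, Function.update_of_ne hd, Pi.single_eq_of_ne hd]

theorem toAnn_coe (x : (Fin p → ℕ) →₀ R) :
    (toAnn p R x : LieP p R) = (LinearMap.range (loopDel p R)).mkQ (polyEmb p R x) := by
  induction x using Finsupp.induction_linear with
  | zero => simp
  | add x y hx hy => simp only [map_add, Submodule.coe_add, hx, hy]
  | single m a => simp [toAnn, polyEmb, ann, LieP.mon]

theorem toAnn_surjective : Function.Surjective (toAnn p R) := by
  rintro ⟨x, hx⟩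
  induction hx using Submodule.span_induction with
  | mem x h =>
    obtain ⟨m, a, rfl⟩ := h
    exact ⟨Finsupp.single m a, by simp only [toAnn, Finsupp.lsum_single]; rfl⟩
  | zero => exact ⟨0, map_zero _⟩
  | add x y _ _ hx hy =>
    obtain ⟨u, hu⟩ := hx
    obtain ⟨w, hw⟩ := hy
    exact ⟨u + w, by rw [map_add, hu, hw]; rfl⟩
  | smul c x _ hx =>
    obtain ⟨u, hu⟩ := hx
    exact ⟨c • u, by rw [map_smul, hu]; rfl⟩

theorem loopDel_apply (x : (Fin p → ℤ) →₀ R) (m : Fin p → ℤ) :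
    loopDel p R x m = del R (x m) + ∑ c, ((m c + 1 : ℤ) : ℂ) • x (m + Pi.single c 1) := by
  induction x using Finsupp.induction_linear with
  | zero => simp
  | add x y hx hy =>
    simp only [map_add, Finsupp.add_apply, hx, hy, smul_add, Finset.sum_add_distrib]; abel
  | single n a =>
    rw [loopDel_single, Finsupp.add_apply, Finsupp.finsetSum_apply]
    congr 1
    · simp only [Finsupp.single_apply]; split_ifs <;> simp
    · refine Finset.sum_congr rfl fun c _ => ?_
      rw [Finsupp.smul_apply, Finsupp.single_apply, Finsupp.single_apply]
      by_cases h : n = m + Pi.single c 1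
      · subst h; simp
      · rw [if_neg h, if_neg fun h' => h (by rw [← h']; simp)]; simp

theorem support_nonneg (x : (Fin p → ℤ) →₀ R)
    (h : ∀ m, (∃ c, m c < 0) → loopDel p R x m = 0) :
    ∀ m, (∃ c, m c < 0) → x m = 0 := by
  rintro m ⟨c, hc⟩
  by_contra hm
  obtain ⟨n, hn, hmin⟩ := Finset.exists_min_image x.support (fun n => n c)
    ⟨m, Finsupp.mem_support_iff.2 hm⟩
  have hnc : n c < 0 := (hmin m (Finsupp.mem_support_iff.2 hm)).trans_lt hc
  have hlow : ∀ q : Fin p → ℤ, q c < n c → x q = 0 := fun q hq => by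
    by_contra hq'
    exact absurd (hmin q (Finsupp.mem_support_iff.2 hq')) (not_le.2 hq)
  have h0 := h (n - Pi.single c 1) ⟨c, by simp; omega⟩
  rw [loopDel_apply, hlow _ (by simp), map_zero, zero_add, Finset.sum_eq_single c] at h0
  · simp only [Pi.sub_apply, Pi.single_eq_same, sub_add_cancel] at h0
    rcases smul_eq_zero.1 h0 with h1 | h1
    · exact hnc.ne (by exact_mod_cast h1)
    · exact Finsupp.mem_support_iff.1 hn h1
  · intro d _ hd
    rw [hlow _ (by simp [Pi.single_eq_of_ne hd.symm]), smul_zero]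
  · simp

theorem exists_polyEmb (x : (Fin p → ℤ) →₀ R) (h : ∀ m, (∃ c, m c < 0) → x m = 0) :
    ∃ y, polyEmb p R y = x := by
  have : (x.support : Set (Fin p → ℤ)) ⊆ Set.range fun (m : Fin p → ℕ) (c : Fin p) => (m c : ℤ) := by
    intro m hm
    refine ⟨fun c => (m c).toNat, funext fun c => Int.toNat_of_nonneg ?_⟩
    by_contra hc
    exact Finsupp.mem_support_iff.1 hm (h m ⟨c, not_le.1 hc⟩)
  exact ⟨x.comapDomain _ (cast_injective p).injOn,
    Finsupp.mapDomain_comapDomain _ (cast_injective p) x this⟩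

theorem toAnn_eq_zero {x : (Fin p → ℕ) →₀ R} :
    toAnn p R x = 0 ↔ ∃ y, polyDel p R y = x := by
  have hinj : Function.Injective (polyEmb p R) := Finsupp.mapDomain_injective (cast_injective p)
  rw [← Submodule.coe_eq_zero, toAnn_coe, Submodule.mkQ_apply, Submodule.Quotient.mk_eq_zero]
  constructor
  · rintro ⟨y, hy⟩
    obtain ⟨z, rfl⟩ := exists_polyEmb p R y (support_nonneg p R y fun m hm => by
      rw [hy]
      refine Finsupp.mapDomain_of_notMem_range _ _ ?_
      rintro ⟨n, rfl⟩
      obtain ⟨c, hc⟩ := hm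
      simp at hc
      omega)
    exact ⟨z, hinj ((polyEmb_polyDel p R z).trans hy)⟩
  · rintro ⟨y, rfl⟩
    exact ⟨polyEmb p R y, (polyEmb_polyDel p R y).symm⟩

section Lift

variable {p R}
variable {r : ℕ} {N : Type*} [AddCommGroup N] [Module ℂ N]

theorem multilinear_congr {E : Type*} [AddCommGroup E] [Module ℂ E]
    (F : MultilinearMap ℂ (fun _ : Fin r => E) N) (K : Submodule ℂ E)
    (h : ∀ x i, ∀ y ∈ K, F (Function.update x i y) = 0) (x x' : Fin r → E)
    (hx : ∀ i, x i - x' i ∈ K) : F x = F x' := by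
  classical
  have key : ∀ S : Finset (Fin r), F (S.piecewise x' x) = F x := by
    intro S
    induction S using Finset.induction_on with
    | empty => simp
    | insert i S hi ih =>
      rw [Finset.piecewise_insert, ← ih]
      have h1 := h (S.piecewise x' x) i _ (hx i)
      rw [MultilinearMap.map_update_sub, sub_eq_zero] at h1
      rw [← h1]
      congr 1
      rw [← Finset.piecewise_eq_of_notMem S x' x hi, Function.update_eq_self]
  rw [← key Finset.univ, Finset.piecewise_univ]

/-- A multilinear map on `R[t₁, …, t_p]` with given values on monomials. -/
def polyMulti (f : (Fin r → Fin p → ℕ) → MultilinearMap ℂ (fun _ : Fin r => R) N) :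
    MultilinearMap ℂ (fun _ : Fin r => (Fin p → ℕ) →₀ R) N := by
  classical
  exact (MultilinearMap.fromDFinsuppEquiv (R := ℂ) (κ := fun _ : Fin r => Fin p → ℕ)
    (M := fun _ _ => R) f).compLinearMap fun _ => (finsuppLequivDFinsupp ℂ).toLinearMap

theorem polyMulti_single (f : (Fin r → Fin p → ℕ) → MultilinearMap ℂ (fun _ : Fin r => R) N)
    (m : Fin r → Fin p → ℕ) (a : Fin r → R) :
    polyMulti f (fun i => Finsupp.single (m i) (a i)) = f m a := by
  classical
  simp only [polyMulti, MultilinearMap.compLinearMap_apply, LinearEquiv.coe_coe,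
    finsuppLequivDFinsupp_apply_apply, Finsupp.toDFinsupp_single]
  exact MultilinearMap.fromDFinsuppEquiv_single (R := ℂ) (κ := fun _ : Fin r => Fin p → ℕ)
    (M := fun _ _ => R) f m a

theorem poly_ext {F G : MultilinearMap ℂ (fun _ : Fin r => (Fin p → ℕ) →₀ R) N}
    (h : ∀ (m : Fin r → Fin p → ℕ) (a : Fin r → R), F (fun i => Finsupp.single (m i) (a i)) = G (fun i => Finsupp.single (m i) (a i))) :
    F = G := by
  classical
  have := MultilinearMap.dfinsupp_ext (R := ℂ) (κ := fun _ : Fin r => Fin p → ℕ)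
    (M := fun _ _ => R)
    (f := F.compLinearMap fun _ => (finsuppLequivDFinsupp ℂ).symm.toLinearMap)
    (g := G.compLinearMap fun _ => (finsuppLequivDFinsupp ℂ).symm.toLinearMap) (by
      intro m
      ext a
      simpa using h m a)
  ext x
  have h2 := congrArg (fun H => H fun i => finsuppLequivDFinsupp ℂ (x i)) this
  simpa using h2

/-- A family of multilinear maps, indexed by tuples of monomials, that is compatible with the
relations `(∂a)_m = -∑ c, m_c a_{m - e_c}`. -/
def Compatible (f : (Fin r → Fin p → ℕ) → MultilinearMap ℂ (fun _ : Fin r => R) N) : Prop :=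
  ∀ m a i, f m (Function.update a i (del R (a i))) +
    ∑ c, (m i c : ℂ) • f (Function.update m i (lowerAt (m i) c)) a = 0

theorem polyMulti_polyDel (f : (Fin r → Fin p → ℕ) → MultilinearMap ℂ (fun _ : Fin r => R) N)
    (hf : Compatible f) (x : Fin r → (Fin p → ℕ) →₀ R) (i : Fin r) (y : (Fin p → ℕ) →₀ R) :
    polyMulti f (Function.update x i (polyDel p R y)) = 0 := by
  have key : (polyMulti f).compLinearMap
      (Function.update (fun _ : Fin r => LinearMap.id) i (polyDel p R)) = 0 := by
    refine poly_ext fun m a => ?_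
    have e : ∀ j, Function.update (fun _ : Fin r => LinearMap.id) i (polyDel p R) j
        (Finsupp.single (m j) (a j)) =
        Function.update (fun j => Finsupp.single (m j) (a j)) i
          (polyDel p R (Finsupp.single (m i) (a i))) j := by
      intro j
      by_cases hj : j = i
      · subst hj; simp
      · simp [Function.update_of_ne hj]
    have e2 : ∀ (n : Fin p → ℕ) (b : R), Function.update (fun j => Finsupp.single (m j) (a j)) i
        (Finsupp.single n b) = fun j => Finsupp.single (Function.update m i n j)
          (Function.update a i b j) := by
      intro n b
      funext j
      by_cases hj : j = i
      · subst hj; simp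
      · simp [Function.update_of_ne hj]
    rw [MultilinearMap.compLinearMap_apply]
    simp only [e, polyDel_single]
    rw [MultilinearMap.map_update_add, MultilinearMap.map_update_sum]
    simp only [MultilinearMap.map_update_smul, e2]
    rw [polyMulti_single]
    simp only [polyMulti_single, Function.update_eq_self, zero_apply]
    exact hf m a i
  have h2 := congrArg (fun F => F (Function.update x i y)) key
  rw [MultilinearMap.compLinearMap_apply, zero_apply] at h2
  rw [← h2]
  congr 1
  funext j
  by_cases hj : j = i
  · subst hj; simp
  · simp [Function.update_of_ne hj]

theorem polyMulti_congr (f : (Fin r → Fin p → ℕ) → MultilinearMap ℂ (fun _ : Fin r => R) N)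
    (hf : Compatible f) {x x' : Fin r → (Fin p → ℕ) →₀ R}
    (h : ∀ i, toAnn p R (x i) = toAnn p R (x' i)) : polyMulti f x = polyMulti f x' := by
  refine multilinear_congr _ (LinearMap.range (polyDel p R)) ?_ x x' fun i => ?_
  · rintro x i _ ⟨y, rfl⟩
    exact polyMulti_polyDel f hf x i y
  · exact (toAnn_eq_zero p R).1 (by rw [map_sub, h, sub_self])

/-- A polynomial representing an element of `(Lie_p R)_-`. -/
def annRep (x : annihilation p R) : (Fin p → ℕ) →₀ R := Function.surjInv (toAnn_surjective p R) x

theorem toAnn_annRep (x : annihilation p R) : toAnn p R (annRep x) = x :=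
  Function.surjInv_eq (toAnn_surjective p R) x

/-- The multilinear map on `(Lie_p R)_-` that sends `(a¹_{m¹}, …, aʳ_{mʳ})` to
`f (m¹, …, mʳ) (a¹, …, aʳ)`; see `annLift_ann`. -/
def annLift (f : (Fin r → Fin p → ℕ) → MultilinearMap ℂ (fun _ : Fin r => R) N)
    (hf : Compatible f) : MultilinearMap ℂ (fun _ : Fin r => annihilation p R) N :=
  MultilinearMap.mk'
    (fun x => polyMulti f fun i => annRep (x i))
    (by
      intro x i y z
      have e : ∀ w w', toAnn p R w = w' →
          polyMulti f (fun j => annRep (Function.update x i w' j)) =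
          polyMulti f (Function.update
            (fun j => annRep (x j)) i w) := by
        intro w w' hw
        refine polyMulti_congr f hf fun j => ?_
        rw [toAnn_annRep]
        by_cases hj : j = i
        · subst hj; simp [hw]
        · simp [Function.update_of_ne hj, toAnn_annRep]
      rw [e _ y (toAnn_annRep y),
        e _ z (toAnn_annRep z), ← MultilinearMap.map_update_add]
      exact e _ _ (by rw [map_add, toAnn_annRep, toAnn_annRep]))
    (by
      intro x i c y
      have e : ∀ w w', toAnn p R w = w' →
          polyMulti f (fun j => annRep (Function.update x i w' j)) =
          polyMulti f (Function.update
            (fun j => annRep (x j)) i w) := by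
        intro w w' hw
        refine polyMulti_congr f hf fun j => ?_
        rw [toAnn_annRep]
        by_cases hj : j = i
        · subst hj; simp [hw]
        · simp [Function.update_of_ne hj, toAnn_annRep]
      rw [e _ y (toAnn_annRep y), ← MultilinearMap.map_update_smul]
      exact e _ _ (by rw [map_smul, toAnn_annRep]))

theorem annLift_ann (f : (Fin r → Fin p → ℕ) → MultilinearMap ℂ (fun _ : Fin r => R) N)
    (hf : Compatible f) (m : Fin r → Fin p → ℕ) (a : Fin r → R) :
    annLift f hf (fun i => ann (m i) (a i)) = f m a := by
  rw [← polyMulti_single f m a]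
  refine polyMulti_congr f hf fun i => ?_
  rw [toAnn_annRep]
  simp [toAnn]

end Lift

/-! ### The bracket, the action and the derivation -/

section Binomial

variable {ι : Type*} [Fintype ι] [DecidableEq ι] {N : Type*} [AddCommGroup N] [Module ℂ N]

theorem binom_update (m j : ι → ℕ) (x : ι) (u w : ℕ) :
    binom (Function.update m x u) (Function.update j x w) =
      (u.choose w : ℂ) * ∏ i ∈ Finset.univ.erase x, ((m i).choose (j i) : ℂ) := by
  rw [binom, ← Finset.mul_prod_erase _ _ (Finset.mem_univ x)]
  simp only [Function.update_self]
  congr 1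
  refine Finset.prod_congr rfl fun i hi => ?_
  rw [Function.update_of_ne (Finset.ne_of_mem_erase hi),
    Function.update_of_ne (Finset.ne_of_mem_erase hi)]

theorem sum_lower (m : ι → ℕ) (x : ι) (G : (ι → ℕ) → N) :
    ∑ j ∈ Finset.Iic m, ((j x : ℂ) * binom m j) • G (lowerAt j x) =
      (m x : ℂ) • ∑ j ∈ Finset.Iic (lowerAt m x), binom (lowerAt m x) j • G j := by
  rcases Nat.eq_zero_or_pos (m x) with h | h
  · rw [h, Nat.cast_zero, zero_smul]
    refine Finset.sum_eq_zero fun j hj => ?_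
    have : j x = 0 := Nat.le_zero.1 (h ▸ (Finset.mem_Iic.1 hj) x)
    simp [this]
  · rw [Finset.smul_sum]
    symm
    refine Finset.sum_of_injOn (fun j => Function.update j x (j x + 1)) ?_ ?_ ?_ ?_
    · intro j _ j' _ hjj
      funext i
      have := congrFun hjj i
      by_cases hi : i = x
      · subst hi; simpa using this
      · simpa [Function.update_of_ne hi] using this
    · intro j hj
      simp only [Finset.coe_Iic, Set.mem_Iic] at hj ⊢
      intro i
      have := hj i
      by_cases hi : i = x
      · subst hi; simp [lowerAt] at this ⊢; omega
      · simpa [lowerAt, Function.update_of_ne hi] using this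
    · intro j hj hj'
      have : j x = 0 := by
        by_contra h0
        refine hj' ⟨lowerAt j x, ?_, ?_⟩
        · simp only [Finset.coe_Iic, Set.mem_Iic]
          intro i
          have this : j i ≤ m i := (Finset.mem_Iic.1 hj) i
          by_cases hi : i = x
          · subst hi
            simp only [lowerAt, Function.update_self]
            omega
          · simpa [lowerAt, Function.update_of_ne hi] using this
        · funext i
          by_cases hi : i = x
          · subst hi; simp [lowerAt]; omega
          · simp [lowerAt, Function.update_of_ne hi]
      simp [this]
    · intro j _
      have e1 : lowerAt (Function.update j x (j x + 1)) x = j := by simp [lowerAt]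
      have e2 := binom_update m j x (m x) (j x + 1)
      have e3 := binom_update m j x (m x - 1) (j x)
      rw [Function.update_eq_self] at e2 e3
      have e4 : (m x : ℂ) * ((m x - 1).choose (j x) : ℂ) =
          ((j x + 1 : ℕ) : ℂ) * ((m x).choose (j x + 1) : ℂ) := by
        have := Nat.add_one_mul_choose_eq (m x - 1) (j x)
        rw [Nat.sub_add_cancel h] at this
        rw [mul_comm ((j x + 1 : ℕ) : ℂ)]
        exact_mod_cast this
      rw [e1, smul_smul, Function.update_self, e2, lowerAt, e3, ← mul_assoc, ← mul_assoc, e4]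

theorem sum_complement (m : ι → ℕ) (x : ι) (G : (ι → ℕ) → N) :
    ∑ j ∈ Finset.Iic m, (((m x - j x : ℕ) : ℂ) * binom m j) • G j =
      (m x : ℂ) • ∑ j ∈ Finset.Iic (lowerAt m x), binom (lowerAt m x) j • G j := by
  rcases Nat.eq_zero_or_pos (m x) with h | h
  · simp [h]
  · rw [Finset.smul_sum]
    symm
    have hsub : Finset.Iic (lowerAt m x) ⊆ Finset.Iic m := by
      refine Finset.Iic_subset_Iic.2 fun i => ?_
      by_cases hi : i = x
      · subst hi; simp [lowerAt]
      · simp [lowerAt, Function.update_of_ne hi]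
    rw [← Finset.sum_subset hsub]
    · refine Finset.sum_congr rfl fun j hj => ?_
      have e2 := binom_update m j x (m x) (j x)
      have e3 := binom_update m j x (m x - 1) (j x)
      rw [Function.update_eq_self] at e2 e3
      rw [Function.update_eq_self] at e2
      have e4 : (m x : ℂ) * ((m x - 1).choose (j x) : ℂ) =
          ((m x - j x : ℕ) : ℂ) * ((m x).choose (j x) : ℂ) := by
        have := Nat.choose_mul_succ_eq (m x - 1) (j x)
        rw [Nat.sub_add_cancel h] at this
        rw [mul_comm, mul_comm ((m x - j x : ℕ) : ℂ)]
        exact_mod_cast this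
      rw [smul_smul, e2, lowerAt, e3, ← mul_assoc, ← mul_assoc, e4]
    · intro j hj hj'
      have : m x ≤ j x := by
        by_contra hlt
        refine hj' (Finset.mem_Iic.2 fun i => ?_)
        have this : j i ≤ m i := (Finset.mem_Iic.1 hj) i
        by_cases hi : i = x
        · subst hi; simp [lowerAt]; omega
        · simpa [lowerAt, Function.update_of_ne hi] using this
      simp [Nat.sub_eq_zero_of_le this]

end Binomial

theorem ann_del (m : Fin p → ℕ) (a : R) :
    ann m (del R a) = -∑ c, (m c : ℂ) • ann (lowerAt m c) a := by
  have h := (toAnn_eq_zero p R).2 ⟨Finsupp.single m a, rfl⟩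
  rw [polyDel_single] at h
  simp only [toAnn, map_add, map_sum, map_smul, Finsupp.lsum_single] at h
  exact eq_neg_of_add_eq_zero_left h

variable {R} {s : ℕ} (A : NLieConformalAlgebra s R)

/-- The exponents of the monomials in the bracket of `a¹_{m¹}, …, aⁿ_{mⁿ}`. -/
def bracketExp {p : ℕ} (m : Fin (s + 2) → Fin p → ℕ) (j : Fin (s + 1) × Fin p → ℕ) : Fin p → ℕ :=
  fun c => m (Fin.last _) c + ∑ i : Fin (s + 1), (m i.castSucc c - j (i, c))

/-- The bracket of `a¹_{m¹}, …, aⁿ_{mⁿ}`: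
`∑ j, ∏ (mⁱ_c choose jⁱ_c) · (a¹_(∑ j¹) ⋯ _(∑ jⁿ⁻¹) aⁿ)_{m¹ + ⋯ + mⁿ - j¹ - ⋯ - jⁿ⁻¹}`. -/
def bracketFamily (m : Fin (s + 2) → Fin p → ℕ) :
    MultilinearMap ℂ (fun _ : Fin (s + 2) => R) (annihilation p R) :=
  ∑ j ∈ Finset.Iic (fun x : Fin (s + 1) × Fin p => m x.1.castSucc x.2),
    binom (fun x : Fin (s + 1) × Fin p => m x.1.castSucc x.2) j •
      (ann (bracketExp m j)).compMultilinearMap (A.prod fun i => ∑ c, j (i, c))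

theorem lowerAt_sum (j : Fin (s + 1) × Fin p → ℕ) (i : Fin (s + 1)) (c : Fin p)
    (h : j (i, c) ≠ 0) : (fun i' => ∑ c', lowerAt j (i, c) (i', c')) =
      lowerAt (fun i' => ∑ c', j (i', c')) i := by
  funext i'
  by_cases hi : i' = i
  · subst hi
    rw [lowerAt, lowerAt, Function.update_self, ← Finset.add_sum_erase _ _ (Finset.mem_univ c),
      ← Finset.add_sum_erase _ (fun c' => j (i', c')) (Finset.mem_univ c), Function.update_self,
      Finset.sum_congr rfl (g := fun c' => j (i', c'))]
    · omega
    · intro c' hc'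
      rw [Function.update_of_ne]
      simpa using Finset.ne_of_mem_erase hc'
  · rw [lowerAt, lowerAt, Function.update_of_ne hi]
    refine Finset.sum_congr rfl fun c' _ => ?_
    rw [Function.update_of_ne]
    simp [hi]

theorem bracketFamily_compatible : Compatible (bracketFamily p A) := by
  intro m a i
  induction i using Fin.lastCases with
  | cast i =>
    have e1 : ∀ c, (fun x : Fin (s + 1) × Fin p =>
        Function.update m i.castSucc (lowerAt (m i.castSucc) c) x.1.castSucc x.2) =
        lowerAt (fun x : Fin (s + 1) × Fin p => m x.1.castSucc x.2) (i, c) := by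
      intro c
      funext ⟨i', c'⟩
      by_cases hi : i' = i
      · subst hi
        by_cases hc : c' = c
        · subst hc; simp [lowerAt]
        · simp [lowerAt, hc]
      · simp [lowerAt, hi]
    simp only [bracketFamily, sum_apply, smul_apply,
      LinearMap.compMultilinearMap_apply, e1, A.del_left]
    simp only [← sum_lower (fun x : Fin (s + 1) × Fin p => m x.1.castSucc x.2) (i, _)
      (fun j => ann (bracketExp (Function.update m i.castSucc (lowerAt (m i.castSucc) _)) j)
        (A.prod (fun i => ∑ c, j (i, c)) a))]
    rw [Finset.sum_comm, ← Finset.sum_add_distrib]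
    refine Finset.sum_eq_zero fun j hj => ?_
    rw [Nat.cast_sum, ← Finset.sum_neg_distrib, Finset.sum_smul, map_sum, Finset.smul_sum,
      ← Finset.sum_add_distrib]
    refine Finset.sum_eq_zero fun c _ => ?_
    by_cases h0 : j (i, c) = 0
    · simp [h0]
    · rw [lowerAt_sum p j i c h0]
      have e2 : bracketExp (Function.update m i.castSucc (lowerAt (m i.castSucc) c))
          (lowerAt j (i, c)) = bracketExp m j := by
        funext d
        simp only [bracketExp]
        congr 1
        · rw [Function.update_of_ne (Fin.castSucc_lt_last i).ne']
        · refine Finset.sum_congr rfl fun i' _ => ?_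
          by_cases hi : i' = i
          · subst hi
            by_cases hd : d = c
            · subst hd
              have := Finset.mem_Iic.1 hj (i', d)
              simp [lowerAt] at this ⊢
              omega
            · simp [lowerAt, hd]
          · simp [lowerAt, hi]
      rw [e2, map_smul, smul_smul, mul_comm]
      simp
  | last =>
    have e1 : ∀ c, (fun x : Fin (s + 1) × Fin p =>
        Function.update m (Fin.last _) (lowerAt (m (Fin.last _)) c) x.1.castSucc x.2) =
        (fun x : Fin (s + 1) × Fin p => m x.1.castSucc x.2) := by
      intro c
      funext x
      rw [Function.update_of_ne (Fin.castSucc_lt_last x.1).ne]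
    have e2 : ∀ c j, (m (Fin.last _) c : ℂ) • ann (bracketExp (Function.update m (Fin.last _)
        (lowerAt (m (Fin.last _)) c)) j) (A.prod (fun i => ∑ c, j (i, c)) a) =
        (m (Fin.last _) c : ℂ) • ann (lowerAt (bracketExp m j) c)
          (A.prod (fun i => ∑ c, j (i, c)) a) := by
      intro c j
      rcases Nat.eq_zero_or_pos (m (Fin.last _) c) with h | h
      · simp [h]
      · congr 3
        funext d
        by_cases hd : d = c
        · subst hd
          simp [bracketExp, lowerAt]
          omega
        · simp [bracketExp, lowerAt, hd]
    have key : ∀ (i : Fin (s + 1)) (c : Fin p),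
        ∑ j ∈ Finset.Iic (fun x : Fin (s + 1) × Fin p => m x.1.castSucc x.2),
          (((m i.castSucc c - j (i, c) : ℕ) : ℂ) *
            binom (fun x : Fin (s + 1) × Fin p => m x.1.castSucc x.2) j) •
              ann (lowerAt (bracketExp m j) c) (A.prod (fun i => ∑ c, j (i, c)) a) =
        ∑ j ∈ Finset.Iic (fun x : Fin (s + 1) × Fin p => m x.1.castSucc x.2),
          ((j (i, c) : ℂ) *
            binom (fun x : Fin (s + 1) × Fin p => m x.1.castSucc x.2) j) •
              ann (bracketExp m j) (A.prod (lowerAt (fun i => ∑ c, j (i, c)) i) a) := by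
      intro i c
      have h1 := sum_complement (fun x : Fin (s + 1) × Fin p => m x.1.castSucc x.2) (i, c)
        (fun j => ann (lowerAt (bracketExp m j) c) (A.prod (fun i => ∑ c, j (i, c)) a))
      have h2 := sum_lower (fun x : Fin (s + 1) × Fin p => m x.1.castSucc x.2) (i, c)
        (fun j => ann (lowerAt (bracketExp m j) c) (A.prod (fun i => ∑ c, j (i, c)) a))
      refine (h1.trans h2.symm).trans (Finset.sum_congr rfl fun j hj => ?_)
      by_cases h0 : j (i, c) = 0
      · simp [h0]
      · rw [lowerAt_sum p j i c h0]
        congr 3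
        have hle := Finset.mem_Iic.1 hj (i, c)
        simp only at hle
        funext d
        by_cases hd : d = c
        · subst hd
          rw [lowerAt, Function.update_self]
          simp only [bracketExp]
          rw [← Finset.add_sum_erase _ _ (Finset.mem_univ i),
            ← Finset.add_sum_erase _ (fun i' => m i'.castSucc d - j (i', d)) (Finset.mem_univ i),
            Finset.sum_congr rfl (g := fun i' => m i'.castSucc d - j (i', d))]
          · simp only [lowerAt, Function.update_self]
            omega
          · intro i' hi'
            rw [lowerAt, Function.update_of_ne]
            simpa using Finset.ne_of_mem_erase hi'
        · rw [lowerAt, Function.update_of_ne hd]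
          simp only [bracketExp]
          congr 1
          refine Finset.sum_congr rfl fun i' _ => ?_
          rw [lowerAt, Function.update_of_ne]
          simp [hd]
    simp only [bracketFamily, sum_apply, smul_apply,
      LinearMap.compMultilinearMap_apply, e1, A.del_last, map_add, ann_del, map_sum, map_smul]
    have e3 : ∀ c, (m (Fin.last _) c : ℂ) •
        ∑ j ∈ Finset.Iic (fun x : Fin (s + 1) × Fin p => m x.1.castSucc x.2),
          binom (fun x : Fin (s + 1) × Fin p => m x.1.castSucc x.2) j •
          ann (bracketExp (Function.update m (Fin.last _) (lowerAt (m (Fin.last _)) c)) j)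
            (A.prod (fun i => ∑ c, j (i, c)) a) =
        ∑ j ∈ Finset.Iic (fun x : Fin (s + 1) × Fin p => m x.1.castSucc x.2),
          binom (fun x : Fin (s + 1) × Fin p => m x.1.castSucc x.2) j •
          (m (Fin.last _) c : ℂ) • ann (lowerAt (bracketExp m j) c)
            (A.prod (fun i => ∑ c, j (i, c)) a) := by
      intro c
      rw [Finset.smul_sum]
      refine Finset.sum_congr rfl fun j _ => ?_
      rw [smul_comm, e2]
    simp only [e3]
    have e4 : ∀ j c, ((bracketExp m j c : ℕ) : ℂ) = (m (Fin.last _) c : ℂ) +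
        ∑ i : Fin (s + 1), ((m i.castSucc c - j (i, c) : ℕ) : ℂ) := by
      intro j c
      simp [bracketExp]
    simp only [e4, add_smul, Finset.sum_smul, Finset.sum_add_distrib, smul_add, smul_neg, neg_add,
      Nat.cast_sum, Finset.smul_sum, smul_smul]
    have k3 : ∀ (S : Finset (Fin (s + 1) × Fin p → ℕ)) (F G : (Fin (s + 1) × Fin p → ℕ) →
        Fin p → Fin (s + 1) → annihilation p R)
        (_ : ∀ i c, ∑ j ∈ S, F j c i = ∑ j ∈ S, G j c i),
        ∑ j ∈ S, ∑ c, ∑ i, F j c i = ∑ j ∈ S, ∑ i, ∑ c, G j c i := by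
      intro S F G h
      rw [Finset.sum_comm, Finset.sum_comm (s := S)]
      simp only [Finset.sum_comm (s := S), h]
      rw [Finset.sum_comm]
    have k4 := k3 _ _ _ key
    simp only [mul_comm (binom _ _), Finset.sum_neg_distrib]
    rw [k4, Finset.sum_comm (s := Finset.univ) (t := Finset.Iic _)]
    abel

/-- The `n`-Lie bracket of `(Lie_p R)_-`. -/
def annBracket : MultilinearMap ℂ (fun _ : Fin (s + 2) => annihilation p R) (annihilation p R) :=
  annLift (bracketFamily p A) (bracketFamily_compatible p A)

theorem annBracket_ann (m : Fin (s + 2) → Fin p → ℕ) (a : Fin (s + 2) → R) :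
    annBracket p A (fun i => ann (m i) (a i)) =
      ∑ j ∈ Finset.Iic (fun x : Fin (s + 1) × Fin p => m x.1.castSucc x.2),
        binom (fun x : Fin (s + 1) × Fin p => m x.1.castSucc x.2) j •
          ann (fun c => m (Fin.last _) c + ∑ i : Fin (s + 1), (m i.castSucc c - j (i, c)))
            (A.prod (fun i => ∑ c, j (i, c)) a) := by
  rw [annBracket, annLift_ann, bracketFamily, sum_apply]
  rfl

variable {A}
variable {M : Type v} [AddCommGroup M] [Module ℂ M] [Module ℂ[X] M] [IsScalarTower ℂ ℂ[X] M]
variable (V : ConformalRep A M)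

theorem act_compatible : Compatible fun m : Fin (s + 1) → Fin p → ℕ => V.act fun i => ∑ c, m i c := by
  intro m a i
  ext v
  simp only [LinearMap.add_apply, V.del_left, LinearMap.sum_apply, LinearMap.smul_apply,
    LinearMap.zero_apply]
  rw [Nat.cast_sum, ← Finset.sum_neg_distrib, Finset.sum_smul, ← Finset.sum_add_distrib]
  refine Finset.sum_eq_zero fun c _ => ?_
  rcases Nat.eq_zero_or_pos (m i c) with h | h
  · simp [h]
  · have : (fun i' => ∑ c', Function.update m i (lowerAt (m i) c) i' c') =
        lowerAt (fun i' => ∑ c', m i' c') i := by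
      funext i'
      by_cases hi : i' = i
      · subst hi
        rw [lowerAt, Function.update_self,
          ← Finset.add_sum_erase _ _ (Finset.mem_univ c),
          Finset.sum_congr rfl (g := fun c' => m i' c')]
        · simp only [lowerAt, Function.update_self]
          have h5 := Finset.add_sum_erase Finset.univ (fun x => m i' x) (Finset.mem_univ c)
          omega
        · intro c' hc'
          rw [Function.update_of_ne (Finset.ne_of_mem_erase hc')]
      · simp [lowerAt, hi]
    rw [this]
    simp

/-- The representation of `(Lie_p R)_-` on `M`. -/
def annAction : MultilinearMap ℂ (fun _ : Fin (s + 1) => annihilation p R) (M →ₗ[ℂ] M) :=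
  annLift _ (act_compatible p V)

theorem annAction_ann (m : Fin (s + 1) → Fin p → ℕ) (a : Fin (s + 1) → R) :
    annAction p V (fun i => ann (m i) (a i)) = V.act (fun i => ∑ c, m i c) a :=
  annLift_ann _ _ m a

variable (R)

/-- The action `a_m ↦ (∂a)_m` of `∂` on `(Lie_p R)_-`. -/
def annDel : annihilation p R →ₗ[ℂ] annihilation p R :=
  ((LinearMap.range (loopDel p R)).mapQ _ (Finsupp.mapRange.linearMap (del R)) (by
    rintro _ ⟨x, rfl⟩
    refine ⟨Finsupp.mapRange.linearMap (del R) x, ?_⟩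
    have hs : ∀ (m : Fin p → ℤ) (a : R), Finsupp.mapRange.linearMap (del R) (Finsupp.single m a) =
        Finsupp.single m (del R a) := by simp
    induction x using Finsupp.induction_linear with
    | zero => simp
    | add x y hx hy => simp only [map_add, hx, hy]
    | single m a => simp only [loopDel_single, map_add, map_sum, map_smul, hs])).restrict (by
    intro x hx
    induction hx using Submodule.span_induction with
    | mem x h =>
      obtain ⟨m, a, rfl⟩ := h
      exact Submodule.subset_span ⟨m, del R a, by simp [LieP.mon]⟩
    | zero => simp
    | add x y _ _ hx hy => rw [map_add]; exact add_mem hx hy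
    | smul c x _ hx => rw [map_smul]; exact Submodule.smul_mem _ c hx)

theorem annDel_ann (m : Fin p → ℕ) (a : R) : annDel p R (ann m a) = ann m (del R a) := by
  refine Subtype.ext ?_
  simp [annDel, ann, LieP.mon]

/-! ### Cochains of `(Lie_p R)_-` -/

variable (s M) in
/-- The `∂`-action on the cochains of `(Lie_p R)_-`. -/
def annCochainDel (k : ℕ) :
    Family s (annihilation p R) M k →ₗ[ℂ] Family s (annihilation p R) M k where
  toFun γ x x' := del M (γ x x') - ∑ i, ∑ j, γ (setEntry x i j (annDel p R (x i j))) x' -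
    γ x (annDel p R x')
  map_add' γ δ := by
    funext x x'
    simp only [Pi.add_apply, map_add, Finset.sum_add_distrib]; abel
  map_smul' c γ := by
    funext x x'
    simp only [Pi.smul_apply, map_smul, smul_sub, Finset.smul_sum, RingHom.id_apply]

variable (s M) in
/-- The `q`-cochains `γ`, `q = k + 1`, of `(Lie_p R)_-` that are local: for fixed `aⁱⱼ, a' ∈ R` the
value of `γ` on the elements `(aⁱⱼ)_{mⁱⱼ}, a'_{m'}` is non-zero for only finitely many choices of
the exponents. If `R` is a finitely generated `ℂ[∂]`-module, these are the continuous cochains. -/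
def localCochain (k : ℕ) : Submodule ℂ (Family s (annihilation p R) M k) :=
  nLieCochain s (annihilation p R) M k ⊓
  { carrier := {γ | ∀ (a : Fin k → Fin (s + 1) → R) (a' : R),
      {m : (Fin k → Fin (s + 1) → Fin p → ℕ) × (Fin p → ℕ) |
        γ (fun i j => ann (m.1 i j) (a i j)) (ann m.2 a') ≠ 0}.Finite}
    zero_mem' := fun a a' => by simp
    add_mem' := by
      intro γ δ h g a a'
      refine ((h a a').union (g a a')).subset ?_
      intro m hm
      by_contra hc
      simp only [Set.mem_union, Set.mem_ofPred_eq, not_or, not_not] at hc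
      exact hm (by simp [hc.1, hc.2])
    smul_mem' := by
      intro c γ h a a'
      refine (h a a').subset ?_
      intro m hm hc
      exact hm (by simp [hc]) }

theorem localCochain_le (k : ℕ) : localCochain p R s M k ≤ nLieCochain s (annihilation p R) M k :=
  inf_le_left

variable {R} in
/-- The subspace of `(Lie_p R)_-` spanned by all `vⁱ_{m₁, …, m_p}` with `m₁ + ⋯ + m_p ≥ N`. -/
def annFiltration {d : ℕ} (v : Fin d → R) (N : ℕ) : Submodule ℂ (annihilation p R) :=
  Submodule.span ℂ {x | ∃ (i : Fin d) (m : Fin p → ℕ), N ≤ ∑ c, m c ∧ ann m (v i) = x}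

variable {R} in
/-- The linear topology on `(Lie_p R)_-` with the subspaces `annFiltration p v N` as a basis of
neighbourhoods of `0`. -/
@[reducible] def annTopology {d : ℕ} (v : Fin d → R) : TopologicalSpace (annihilation p R) where
  IsOpen U := ∀ x ∈ U, ∃ N, ∀ y ∈ annFiltration p v N, x + y ∈ U
  isOpen_univ := fun _ _ => ⟨0, fun _ _ => trivial⟩
  isOpen_inter := by
    intro U W hU hW x hx
    obtain ⟨N, hN⟩ := hU x hx.1
    obtain ⟨N', hN'⟩ := hW x hx.2
    have hmono : ∀ n n', n ≤ n' → annFiltration p v n' ≤ annFiltration p v n := by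
      intro n n' h
      refine Submodule.span_mono ?_
      rintro y ⟨i, m, hm, rfl⟩
      exact ⟨i, m, h.trans hm, rfl⟩
    exact ⟨max N N', fun y hy => ⟨hN y (hmono _ _ (le_max_left _ _) hy),
      hN' y (hmono _ _ (le_max_right _ _) hy)⟩⟩
  isOpen_sUnion := by
    intro S hS x ⟨U, hU, hx⟩
    obtain ⟨N, hN⟩ := hS U hU x hx
    exact ⟨N, fun y hy => ⟨U, hU, hN y hy⟩⟩

/-- Continuity of a function of several arguments with values in the discrete space `M`. -/
def IsContinuousFamily {L : Type u} {M : Type v} {k : ℕ} (τ : TopologicalSpace L)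
    (γ : Family s L M k) : Prop :=
  letI := τ
  letI : TopologicalSpace M := ⊥
  Continuous fun x : (Fin k → Fin (s + 1) → L) × L => γ x.1 x.2

end Annihilation

end NLieConf

end

/-!
The proof combines three parts and a compactness argument.

*The complex of an `n`-Lie algebra.* For an `n`-Lie algebra `L` and a representation `M`, let `ι_X γ`
be the cochain `γ` with the tuple `X` inserted as its first row (`insertRow`) and let `L_X` be the
Lie derivative along `X` (`lieRow`). The differential satisfies Cartan's formula
`ι_X (D γ) = L_X γ - D (ι_X γ)` (`nLieD_pre`). Hence, by induction on the degree, `D` commutes with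
all `L_X` (`nLieD_lieRow`), `D² = 0` (`nLieD_nLieD`) and `D` preserves cochains (`nLieD_mem`); only
the lowest degree needs a computation, which rests on the Filippov identity of the representation.

*`(Lie_p R)_-` is an `n`-Lie algebra, and `M` is a representation.* An element of `(Lie_p R)_-` is
written as `annPoly p R f a`, the class of `a ⊗ f` with a polynomial `f`. By Taylor's formula the
bracket of such elements is obtained from the `λ`-bracket by pairing its coefficients with the product
of the shifted polynomials `fᵢ (t + λᵢ)` (`annBracket_annPoly`). The axioms of the conformal algebra
become substitutions in the variables `λ`, and skew-symmetry and the Filippov identity follow from the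
fact that shifts compose additively (`annBracket_annPoly_swap_left`, `annBracket_annPoly_swap_last`,
`filippov_annPoly`). The action on `M` depends only on the total exponents `∑ c, m c`; Vandermonde's
identity (`sum_binom_fiber`, `map_annBracket`) reduces the bracket to `p = 1` under any map with this
property, and the axioms of a representation become those of the conformal representation.

*Comparison with the basic complex.* Conformal antilinearity of a basic cochain is exactly the
compatibility needed to define a multilinear map on `(Lie_p R)_-` through the total exponents
(`exists_lift`). It is local because the coefficients of a polynomial are finitely many, and
conversely a local cochain with `p = 1` gives a basic one (`restrict_mem`). By Vandermonde's identity
the differentials correspond (`nLieD_ann`), so that the basic complex inherits `D² = 0` and the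
membership statements from the case `p = 1`, in which the lift is bijective.

For the topological statement, torsion elements of `R` vanish in `(Lie_p R)_-` (`ann_torsion`), so that
`(Lie_p R)_-` is spanned by the elements `vⁱ_m`, and a local cochain vanishes once one of its arguments
is in a fixed filtration step. Conversely, for fixed elements of `R`, a continuous cochain extends
continuously to exponents in the one-point compactification of `ℕᵖ`, with value zero at infinity, and
the set on which it does not vanish is compact and discrete, hence finite.
-/

noncomputable section

namespace NLieConf

/-! ### Cochains as multilinear maps -/

section Flat

variable {α : Type*} {k r : ℕ}

/-- All arguments of a cochain, `k` rows of length `r` and one further argument, as one tuple. -/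
def flat (x : Fin k → Fin r → α) (x' : α) : Option (Fin k × Fin r) → α :=
  fun o => o.elim x' fun q => x q.1 q.2

theorem flat_unflat (z : Option (Fin k × Fin r) → α) :
    flat (fun i j => z (some (i, j))) (z none) = z := by
  funext o
  cases o <;> rfl

theorem flat_setEntry (x : Fin k → Fin r → α) (x' y : α) (i : Fin k) (j : Fin r) :
    flat (setEntry x i j y) x' = Function.update (flat x x') (some (i, j)) y := by
  funext o
  rcases o with _ | ⟨i', j'⟩
  · simp [flat]
  · by_cases hi : i' = i
    · subst hi
      by_cases hj : j' = j
      · subst hj; simp [flat, setEntry]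
      · simp [flat, setEntry, hj]
    · simp [flat, setEntry, hi]

theorem flat_last (x : Fin k → Fin r → α) (x' y : α) :
    flat x y = Function.update (flat x x') none y := by
  funext o
  cases o <;> simp [flat]

theorem flat_swapEntries (x : Fin k → Fin r → α) (x' : α) (i : Fin k) (j j' : Fin r) :
    flat (swapEntries x i j j') x' =
      flat x x' ∘ Equiv.swap (some (i, j)) (some (i, j')) := by
  funext o
  rcases o with _ | ⟨i', l⟩
  · simp [flat, Equiv.swap_apply_of_ne_of_ne]
  · by_cases hi : i' = i
    · subst hi
      have := (Option.some_injective _).comp (Prod.mk_right_injective i') |>.swap_apply j j' l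
      simp only [Function.comp] at this
      simp [flat, swapEntries, this]
    · rw [Function.comp, Equiv.swap_apply_of_ne_of_ne]
      · simp [flat, swapEntries, hi]
      · simp [hi]
      · simp [hi]

theorem flat_exchange (x : Fin k → Fin r → α) (x' : α) (i : Fin k) (j : Fin r) :
    flat (setEntry x i j x') (x i j) = flat x x' ∘ Equiv.swap (some (i, j)) none := by
  rw [flat_last _ x', flat_setEntry]
  funext o
  by_cases h1 : o = none
  · subst h1; simp [flat]
  · by_cases h2 : o = some (i, j)
    · subst h2; simp [flat]
    · simp [h1, h2, Equiv.swap_apply_of_ne_of_ne]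

/-- The transpositions under which cochains are skew-symmetric: those of two arguments in the same
row, where the additional argument belongs to the last row. -/
def rowSwaps (k r : ℕ) : Set (Equiv.Perm (Option (Fin k × Fin r))) :=
  {σ | (∃ i j j', j ≠ j' ∧ σ = Equiv.swap (some (i, j)) (some (i, j'))) ∨
    ∃ (i : Fin k) (j : Fin r), (i : ℕ) + 1 = k ∧ σ = Equiv.swap (some (i, j)) none}

end Flat

section Derivation

variable {L : Type u} [AddCommGroup L] [Module ℂ L] {M : Type v} [AddCommGroup M] [Module ℂ M]
  {ι : Type*} [Fintype ι] [DecidableEq ι]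

/-- The action of a pair of endomorphisms `(a, ρ)` of `L` and `M` on multilinear maps from `L` to
`M`. -/
def extDer (a : L →ₗ[ℂ] L) (ρ : M →ₗ[ℂ] M) (G : MultilinearMap ℂ (fun _ : ι => L) M) :
    MultilinearMap ℂ (fun _ : ι => L) M :=
  ρ.compMultilinearMap G -
    ∑ q, G.compLinearMap (Function.update (fun _ => LinearMap.id) q a)

theorem extDer_apply (a : L →ₗ[ℂ] L) (ρ : M →ₗ[ℂ] M) (G : MultilinearMap ℂ (fun _ : ι => L) M)
    (z : ι → L) : extDer a ρ G z = ρ (G z) - ∑ q, G (Function.update z q (a (z q))) := by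
  simp only [extDer, sub_apply, LinearMap.compMultilinearMap_apply,
    sum_apply, MultilinearMap.compLinearMap_apply]
  congr 1
  refine Finset.sum_congr rfl fun q _ => congrArg G (funext fun i => ?_)
  by_cases hi : i = q
  · subst hi; simp
  · simp [hi]

theorem extDer_perm (a : L →ₗ[ℂ] L) (ρ : M →ₗ[ℂ] M) (G : MultilinearMap ℂ (fun _ : ι => L) M)
    (σ : Equiv.Perm ι) (h : ∀ z, G (z ∘ σ) = -G z) (z : ι → L) :
    extDer a ρ G (z ∘ σ) = -extDer a ρ G z := by
  rw [extDer_apply, extDer_apply, h, map_neg, neg_sub', ← Finset.sum_neg_distrib]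
  congr 1
  rw [← Equiv.sum_comp σ fun q => -G (Function.update z q (a (z q)))]
  refine Finset.sum_congr rfl fun q _ => ?_
  rw [← h, Function.update_comp_eq_of_injective _ σ.injective]
  rfl

/-- The derivation actions attached to pairs `(a, ρ)` and `(b, τ)` commute up to the action of the pair
of commutators. -/
theorem extDer_commutator (a b : L →ₗ[ℂ] L) (ρ τ : M →ₗ[ℂ] M)
    (G : MultilinearMap ℂ (fun _ : ι => L) M) (z : ι → L) :
    extDer a ρ (extDer b τ G) z - extDer b τ (extDer a ρ G) z =
      extDer (a ∘ₗ b - b ∘ₗ a) (ρ ∘ₗ τ - τ ∘ₗ ρ) G z := by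
  have key : ∀ a b : L →ₗ[ℂ] L, ∑ q, ∑ q', G (Function.update (Function.update z q (a (z q))) q'
      (b (Function.update z q (a (z q)) q'))) = ∑ q, G (Function.update z q (b (a (z q)))) +
      ∑ q, ∑ q' ∈ Finset.univ.erase q,
        G (Function.update (Function.update z q (a (z q))) q' (b (z q'))) := by
    intro a b
    rw [← Finset.sum_add_distrib]
    refine Finset.sum_congr rfl fun q _ => ?_
    rw [← Finset.add_sum_erase _ _ (Finset.mem_univ q)]
    congr 1
    · simp
    · refine Finset.sum_congr rfl fun q' hq => ?_
      rw [Function.update_of_ne (Finset.ne_of_mem_erase hq)]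
  have key2 : ∑ q, ∑ q' ∈ Finset.univ.erase q,
        G (Function.update (Function.update z q (a (z q))) q' (b (z q'))) =
      ∑ q, ∑ q' ∈ Finset.univ.erase q,
        G (Function.update (Function.update z q (b (z q))) q' (a (z q'))) := by
    rw [Finset.sum_comm' (t' := Finset.univ) (s' := fun q => Finset.univ.erase q)
      (by simp [eq_comm])]
    refine Finset.sum_congr rfl fun q _ => Finset.sum_congr rfl fun q' hq => ?_
    rw [Function.update_comm (Finset.ne_of_mem_erase hq)]
  simp only [extDer_apply, map_sub, map_sum, Finset.sum_sub_distrib, key, LinearMap.sub_apply,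
    LinearMap.comp_apply, MultilinearMap.map_update_sub, key2]
  abel

end Derivation

section Cochains

variable {s : ℕ} {L : Type u} [AddCommGroup L] [Module ℂ L]
variable {M : Type v} [AddCommGroup M] [Module ℂ M]

/-- A family that is linear in each argument is given by a multilinear map. -/
theorem exists_multilinear {k : ℕ} {γ : Family s L M k}
    (h1 : ∀ x x' i j, IsLinearMap ℂ fun y => γ (setEntry x i j y) x')
    (h2 : ∀ x, IsLinearMap ℂ (γ x)) :
    ∃ G : MultilinearMap ℂ (fun _ : Option (Fin k × Fin (s + 1)) => L) M,
      ∀ x x', γ x x' = G (flat x x') := by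
  have hlin : ∀ (z : Option (Fin k × Fin (s + 1)) → L) q, IsLinearMap ℂ fun y =>
      (fun z : Option (Fin k × Fin (s + 1)) → L =>
        γ (fun i j => z (some (i, j))) (z none)) (Function.update z q y) := by
    intro z q
    rcases q with _ | ⟨i, j⟩
    · convert h2 (fun i j => z (some (i, j))) using 2
      simp
    · convert h1 (fun i j => z (some (i, j))) (z none) i j using 2 with y
      have := flat_setEntry (fun i j => z (some (i, j))) (z none) y i j
      rw [flat_unflat] at this
      rw [← this]
      rfl
  exact ⟨MultilinearMap.mk' (fun z => γ (fun i j => z (some (i, j))) (z none))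
    (fun z q => (hlin z q).map_add) (fun z q => (hlin z q).map_smul), fun x x' => rfl⟩

theorem mem_nLieCochain_iff {k : ℕ} {γ : Family s L M k} : γ ∈ nLieCochain s L M k ↔
    ∃ G : MultilinearMap ℂ (fun _ : Option (Fin k × Fin (s + 1)) => L) M,
      (∀ x x', γ x x' = G (flat x x')) ∧
        ∀ σ ∈ rowSwaps k (s + 1), ∀ z, G (z ∘ σ) = -G z := by
  constructor
  · rintro ⟨h1, h2, h3, h4⟩
    obtain ⟨G, hG⟩ := exists_multilinear h1 h2
    refine ⟨G, hG, ?_⟩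
    rintro σ (⟨i, j, j', hj, rfl⟩ | ⟨i, j, hi, rfl⟩) z
    · rw [← flat_unflat z, ← flat_swapEntries, ← hG, ← hG]
      exact h3 _ _ i j j' hj
    · rw [← flat_unflat z, ← flat_exchange, ← hG, ← hG]
      exact h4 _ _ i j hi
  · rintro ⟨G, hG, hs⟩
    refine ⟨fun x x' i j => ?_, fun x => ?_, ?_, ?_⟩
    · simp only [hG, flat_setEntry]
      exact (G.toLinearMap _ _).isLinear
    · have : γ x = fun y => G (Function.update (flat x 0) none y) := by
        funext y
        rw [hG, ← flat_last]
      rw [this]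
      exact (G.toLinearMap _ _).isLinear
    · intro x x' i j j' hj
      rw [hG, hG, flat_swapEntries, hs _ (Or.inl ⟨i, j, j', hj, rfl⟩)]
    · intro x x' i j hi
      rw [hG, hG, flat_exchange, hs _ (Or.inr ⟨i, j, hi, rfl⟩)]

/-- The action of a pair of endomorphisms `(a, ρ)` of `L` and `M` on cochains. -/
def lieFamily (a : L →ₗ[ℂ] L) (ρ : M →ₗ[ℂ] M) (k : ℕ) : Family s L M k →ₗ[ℂ] Family s L M k where
  toFun γ x x' := ρ (γ x x') - ∑ i, ∑ j, γ (setEntry x i j (a (x i j))) x' - γ x (a x')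
  map_add' γ δ := by
    funext x x'
    simp only [Pi.add_apply, map_add, Finset.sum_add_distrib]; abel
  map_smul' c γ := by
    funext x x'
    simp only [Pi.smul_apply, map_smul, smul_sub, Finset.smul_sum, RingHom.id_apply]

theorem lieFamily_apply (a : L →ₗ[ℂ] L) (ρ : M →ₗ[ℂ] M) {k : ℕ} (γ : Family s L M k) (x x') :
    lieFamily a ρ k γ x x' =
      ρ (γ x x') - ∑ i, ∑ j, γ (setEntry x i j (a (x i j))) x' - γ x (a x') := rfl

theorem lieFamily_flat (a : L →ₗ[ℂ] L) (ρ : M →ₗ[ℂ] M) {k : ℕ} {γ : Family s L M k}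
    {G : MultilinearMap ℂ (fun _ : Option (Fin k × Fin (s + 1)) => L) M}
    (hG : ∀ x x', γ x x' = G (flat x x')) (x x') :
    lieFamily a ρ k γ x x' = extDer a ρ G (flat x x') := by
  rw [lieFamily_apply, extDer_apply, Fintype.sum_option, Fintype.sum_prod_type, hG, hG,
    flat_last x x' (a x'), sub_sub, add_comm (∑ _, _)]
  simp only [hG, flat_setEntry]
  rfl

theorem lieFamily_mem (a : L →ₗ[ℂ] L) (ρ : M →ₗ[ℂ] M) {k : ℕ} {γ : Family s L M k}
    (hγ : γ ∈ nLieCochain s L M k) : lieFamily a ρ k γ ∈ nLieCochain s L M k := by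
  obtain ⟨G, hG, hs⟩ := mem_nLieCochain_iff.1 hγ
  exact mem_nLieCochain_iff.2 ⟨extDer a ρ G, lieFamily_flat a ρ hG,
    fun σ hσ z => extDer_perm a ρ G σ (hs σ hσ) z⟩

theorem lieFamily_commutator (a b : L →ₗ[ℂ] L) (ρ τ : M →ₗ[ℂ] M) {k : ℕ} {γ : Family s L M k}
    (hγ : γ ∈ nLieCochain s L M k) :
    lieFamily a ρ k (lieFamily b τ k γ) - lieFamily b τ k (lieFamily a ρ k γ) =
      lieFamily (a ∘ₗ b - b ∘ₗ a) (ρ ∘ₗ τ - τ ∘ₗ ρ) k γ := by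
  obtain ⟨G, hG, -⟩ := mem_nLieCochain_iff.1 hγ
  funext x x'
  rw [Pi.sub_apply, Pi.sub_apply, lieFamily_flat _ _ (lieFamily_flat b τ hG),
    lieFamily_flat _ _ (lieFamily_flat a ρ hG), lieFamily_flat _ _ hG, extDer_commutator]

theorem lieFamily_isLinear {k : ℕ} {γ : Family s L M k} (hγ : γ ∈ nLieCochain s L M k) :
    IsLinearMap ℂ fun q : (L →ₗ[ℂ] L) × (M →ₗ[ℂ] M) => lieFamily q.1 q.2 k γ := by
  obtain ⟨G, hG, -⟩ := mem_nLieCochain_iff.1 hγ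
  constructor
  · intro q q'
    funext x x'
    simp only [Pi.add_apply, lieFamily_flat _ _ hG, extDer_apply, Prod.fst_add, Prod.snd_add,
      LinearMap.add_apply, MultilinearMap.map_update_add, Finset.sum_add_distrib]
    abel
  · intro c q
    funext x x'
    simp only [Pi.smul_apply, lieFamily_flat _ _ hG, extDer_apply, Prod.smul_fst, Prod.smul_snd,
      LinearMap.smul_apply, MultilinearMap.map_update_smul, smul_sub, Finset.smul_sum]

variable (M) in
/-- Insertion of a tuple into the first row of a cochain. -/
def insertRow (X : Fin (s + 1) → L) (k : ℕ) : Family s L M (k + 1) →ₗ[ℂ] Family s L M k where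
  toFun γ x x' := γ (pre X x) x'
  map_add' _ _ := rfl
  map_smul' _ _ := rfl

theorem insertRow_apply (X : Fin (s + 1) → L) {k : ℕ} (γ : Family s L M (k + 1)) (x x') :
    insertRow M X k γ x x' = γ (pre X x) x' := rfl

theorem setEntry_pre_zero {α : Type*} {k r : ℕ} (X : Fin r → α) (x : Fin k → Fin r → α)
    (l : Fin r) (y : α) :
    setEntry (pre X x) 0 l y = pre (Function.update X l y) x := by
  simp [setEntry, pre, Fin.update_cons_zero]

theorem setEntry_pre_succ {α : Type*} {k r : ℕ} (X : Fin r → α) (x : Fin k → Fin r → α)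
    (i : Fin k) (l : Fin r) (y : α) :
    setEntry (pre X x) i.succ l y = pre X (setEntry x i l y) := by
  simp [setEntry, pre, Fin.cons_update]

theorem insertRow_mem (X : Fin (s + 1) → L) {k : ℕ} {γ : Family s L M (k + 1)}
    (hγ : γ ∈ nLieCochain s L M (k + 1)) : insertRow M X k γ ∈ nLieCochain s L M k := by
  obtain ⟨h1, h2, h3, h4⟩ := hγ
  refine ⟨fun x x' i j => ?_, fun x => h2 _, ?_, ?_⟩
  · simp only [insertRow_apply, ← setEntry_pre_succ]
    exact h1 _ _ _ _
  · intro x x' i j j' hj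
    rw [insertRow_apply, insertRow_apply, ← h3 _ _ i.succ j j' hj]
    congr 1
    simp [swapEntries, pre, Fin.cons_update]
  · intro x x' i j hi
    rw [insertRow_apply, insertRow_apply, ← h4 _ _ i.succ j (by simp [hi]), setEntry_pre_succ]
    rfl

theorem insertRow_lieFamily (a : L →ₗ[ℂ] L) (ρ : M →ₗ[ℂ] M) (Y : Fin (s + 1) → L) {k : ℕ}
    (γ : Family s L M (k + 1)) : insertRow M Y k (lieFamily a ρ (k + 1) γ) =
      lieFamily a ρ k (insertRow M Y k γ) -
        ∑ l, insertRow M (Function.update Y l (a (Y l))) k γ := by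
  funext x x'
  simp only [insertRow_apply, lieFamily_apply, Fin.sum_univ_succ (n := k), Pi.sub_apply,
    Finset.sum_apply, setEntry_pre_succ, pre, Fin.cons_zero, Fin.cons_succ]
  have := fun l y => setEntry_pre_zero Y x l y
  simp only [pre] at this
  simp only [this]
  abel

end Cochains

/-! ### The differential of an n-Lie algebra and Cartan calculus -/

section Skew

variable {L : Type*} [AddCommGroup L] [Module ℂ L] {N : Type*} [AddCommGroup N] [Module ℂ N]

/-- A multilinear map that changes sign under transpositions, as an alternating map. -/
def alternatingOfSwap {ι : Type*} [DecidableEq ι] (f : MultilinearMap ℂ (fun _ : ι => L) N)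
    (h : ∀ x i j, i ≠ j → f (x ∘ Equiv.swap i j) = -f x) : L [⋀^ι]→ₗ[ℂ] N :=
  { f with
    map_eq_zero_of_eq' := by
      intro x i j hx hij
      have h1 := h x i j hij
      rw [show x ∘ Equiv.swap i j = x by
        funext q
        by_cases hi : q = i
        · subst hi; simp [hx]
        · by_cases hj : q = j
          · subst hj; simp [hx]
          · simp [Equiv.swap_apply_of_ne_of_ne hi hj]] at h1
      have h2 : (2 : ℂ) • f x = 0 := by
        rw [two_smul]; nth_rewrite 1 [h1]; exact neg_add_cancel _
      exact (smul_eq_zero.1 h2).resolve_left two_ne_zero }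

theorem alternatingOfSwap_apply {ι : Type*} [DecidableEq ι]
    (f : MultilinearMap ℂ (fun _ : ι => L) N)
    (h : ∀ x i j, i ≠ j → f (x ∘ Equiv.swap i j) = -f x) (x : ι → L) :
    alternatingOfSwap f h x = f x := rfl

/-- Skew-symmetry need only be checked for transpositions of neighbours. -/
theorem swap_of_adjacent {n : ℕ} (f : (Fin (n + 1) → L) → N)
    (h : ∀ x (i : Fin n), f (x ∘ Equiv.swap i.castSucc i.succ) = -f x) (x : Fin (n + 1) → L)
    (i j : Fin (n + 1)) (hij : i ≠ j) : f (x ∘ Equiv.swap i j) = -f x := by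
  have key : ∀ σ : Equiv.Perm (Fin (n + 1)), ∀ x, f (x ∘ σ) = (Equiv.Perm.sign σ : ℤ) • f x := by
    intro σ
    have hσ : σ ∈ Submonoid.closure
        (Set.range fun i : Fin n => Equiv.swap i.castSucc i.succ) := by
      rw [Equiv.Perm.mclosure_swap_castSucc_succ]; trivial
    induction hσ using Submonoid.closure_induction with
    | mem σ hσ =>
      obtain ⟨i, rfl⟩ := hσ
      intro x
      rw [Equiv.Perm.sign_swap (Fin.castSucc_lt_succ).ne]
      simp [h]
    | one => intro x; simp
    | mul σ τ _ _ hσ hτ =>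
      intro x
      rw [Equiv.Perm.coe_mul, ← Function.comp_assoc, hτ, hσ, Equiv.Perm.sign_mul, smul_smul,
        mul_comm]
      rfl
  rw [key, Equiv.Perm.sign_swap hij]
  simp

variable {s : ℕ}

theorem app_eq_insertNth {α : Type*} {n : ℕ} (x : Fin n → α) (y : α) :
    app x y = (Fin.last n).insertNth (α := fun _ => α) y x := by
  rw [Fin.insertNth_last']

theorem alternating_app (f : L [⋀^Fin (s + 1)]→ₗ[ℂ] N) (x : Fin s → L) (y : L) :
    f (app x y) = (-1 : ℂ) ^ s • f (pre y x) := by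
  have := f.map_insertNth (Fin.last s) y x
  rw [app_eq_insertNth, this, Fin.val_last]
  rcases Nat.even_or_odd s with h | h <;> simp [h.neg_one_pow] <;> rfl

theorem alternating_update (f : L [⋀^Fin (s + 1)]→ₗ[ℂ] N) (x : Fin (s + 1) → L) (y : L)
    (i : Fin (s + 1)) :
    f (Function.update x i y) = (-1 : ℂ) ^ (s + i : ℕ) • f (app (x ∘ i.succAbove) y) := by
  have := f.map_insertNth i y (x ∘ i.succAbove)
  rw [alternating_app, smul_smul, ← pow_add, show s + i + s = 2 * s + i by ring, pow_add, pow_mul,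
    neg_one_sq, one_pow, one_mul]
  have e : Function.update x i y = i.insertNth (α := fun _ => L) y (x ∘ i.succAbove) := by
    have := i.insertNth_removeNth (α := fun _ => L) y x
    rw [← this]; rfl
  rw [e, this]
  rcases Nat.even_or_odd (i : ℕ) with h | h <;> simp [h.neg_one_pow] <;> rfl

/-- For a skew-symmetric bracket, the Filippov identity says that the maps `ad Y` are
derivations. -/
theorem derivation_of_filippov (br : MultilinearMap ℂ (fun _ : Fin (s + 2) => L) L)
    (h : ∀ x i j, i ≠ j → br (x ∘ Equiv.swap i j) = -br x) (x : Fin (s + 2) → L)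
    (y : Fin (s + 1) → L)
    (hF : ∑ i : Fin (s + 2), (-1 : ℂ) ^ (s + 1 + (i : ℕ)) •
      br (app (x ∘ i.succAbove) (br (pre (x i) y))) = br (pre (br x) y)) :
    br (app y (br x)) = ∑ i, br (Function.update x i (br (app y (x i)))) := by
  have h1 := fun x y => alternating_app (alternatingOfSwap br h) x y
  have h2 := fun x y i => alternating_update (alternatingOfSwap br h) x y i
  simp only [alternatingOfSwap_apply] at h1 h2
  rw [h1 y, ← hF, Finset.smul_sum]
  refine Finset.sum_congr rfl fun i _ => ?_
  have h3 : br (app (x ∘ i.succAbove) ((-1 : ℂ) ^ (s + 1) • br (pre (x i) y))) =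
      (-1 : ℂ) ^ (s + 1) • br (app (x ∘ i.succAbove) (br (pre (x i) y))) :=
    (br.curryRight (x ∘ i.succAbove)).map_smul _ _
  rw [h2, h1 y, h3, smul_smul, smul_smul, mul_comm]

end Skew

section Complex

variable {s : ℕ} {L : Type u} [AddCommGroup L] [Module ℂ L]
variable {M : Type v} [AddCommGroup M] [Module ℂ M]
variable (br : MultilinearMap ℂ (fun _ : Fin (s + 2) => L) L)
  (ρ : MultilinearMap ℂ (fun _ : Fin (s + 1) => L) (M →ₗ[ℂ] M))

/-- The inner derivation `ad X = [X₁, …, X_{n-1}, ·]`. -/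
def ad : MultilinearMap ℂ (fun _ : Fin (s + 1) => L) (L →ₗ[ℂ] L) := br.curryRight

theorem ad_apply (X : Fin (s + 1) → L) (y : L) : ad br X y = br (app X y) := rfl

/-- The Lie derivative of cochains along a tuple `X`. -/
def lieRow (X : Fin (s + 1) → L) (k : ℕ) : Family s L M k →ₗ[ℂ] Family s L M k :=
  lieFamily (ad br X) (ρ X) k

theorem comp_succAbove_zero {α : Type*} {k : ℕ} (X : α) (x : Fin k → α) :
    (fun c => (pre X x : Fin (k + 1) → α) (Fin.succAbove 0 c)) = x := by
  funext c; simp [pre]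

theorem pre_comp_succ_succAbove {α : Type*} {k : ℕ} (X : α) (x : Fin (k + 1) → α)
    (i : Fin (k + 1)) :
    (fun c => (pre X x : Fin (k + 2) → α) (i.succ.succAbove c)) =
      pre X fun c => x (i.succAbove c) := by
  funext c
  induction c using Fin.cases <;> simp [pre]

theorem pre_comp_castSucc {α : Type*} {k : ℕ} (X : α) (x : Fin (k + 1) → α) :
    (fun c : Fin (k + 1) => (pre X x : Fin (k + 2) → α) c.castSucc) =
      pre X fun c => x c.castSucc := by
  funext c
  induction c using Fin.cases with
  | zero => simp [pre]
  | succ c => rw [← Fin.succ_castSucc]; simp [pre]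

/-- Cartan's formula `ι_X D = L_X - D ι_X`. -/
theorem nLieD_pre (k : ℕ) (γ : Family s L M (k + 1)) (X : Fin (s + 1) → L)
    (x : Fin (k + 1) → Fin (s + 1) → L) (x' : L) :
    nLieD br ρ (k + 1) γ (pre X x) x' =
      lieRow br ρ X (k + 1) γ x x' - nLieD br ρ k (insertRow M X k γ) x x' := by
  simp only [nLieD, LinearMap.coe_mk, AddHom.coe_mk, lieRow, lieFamily_apply, insertRow_apply]
  rw [Fin.sum_univ_succ, Fin.sum_univ_succ (n := k + 1), Fin.sum_univ_succ (n := k + 1),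
    Fin.sum_Ioi_zero]
  simp only [Fin.sum_Ioi_succ, comp_succAbove_zero, setEntry_pre_succ, pre_comp_succ_succAbove,
    pre_comp_castSucc, ← Fin.succ_last]
  simp only [pre, Fin.cons_zero, Fin.cons_succ, Fin.val_zero, Fin.val_succ, pow_succ, pow_zero,
    one_smul, zero_add, mul_neg, mul_one, neg_smul, Finset.sum_neg_distrib, ad_apply, neg_mul,
    neg_neg, pow_add]
  abel

theorem pre_tail {α : Type*} {k : ℕ} (x : Fin (k + 1) → α) : pre (x 0) (fun c => x c.succ) = x :=
  Fin.cons_self_tail x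

/-- Cartan's formula as an identity of cochains. -/
theorem insertRow_nLieD (k : ℕ) (γ : Family s L M (k + 1)) (X : Fin (s + 1) → L) :
    insertRow M X (k + 1) (nLieD br ρ (k + 1) γ) =
      lieRow br ρ X (k + 1) γ - nLieD br ρ k (insertRow M X k γ) := by
  funext x x'
  exact nLieD_pre br ρ k γ X x x'

theorem family_ext {k : ℕ} {γ δ : Family s L M (k + 1)}
    (h : ∀ X, insertRow M X k γ = insertRow M X k δ) : γ = δ := by
  funext x x'
  rw [← pre_tail x]
  exact congrFun (congrFun (h (x 0)) _) x'

/-- The differential of a cochain of the lowest degree, a linear map `γ`, as a function of `n`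
arguments. -/
def lowestD (γ : L → M) (z : Fin (s + 2) → L) : M :=
  ∑ i : Fin (s + 2), (-1 : ℂ) ^ (s + 1 + (i : ℕ)) • ρ (z ∘ i.succAbove) (γ (z i)) - γ (br z)

theorem nLieD_zero (γ : Family s L M 0) (x : Fin 1 → Fin (s + 1) → L) (x' : L) :
    nLieD br ρ 0 γ x x' = lowestD br ρ (γ Fin.elim0) (app (x 0) x') := by
  have e : ∀ y : Fin 0 → Fin (s + 1) → L, y = Fin.elim0 := fun y => Subsingleton.elim _ _
  have h1 : ∀ j : Fin (s + 1), app (x 0) x' ∘ j.castSucc.succAbove = app (x 0 ∘ j.succAbove) x' := by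
    intro j
    funext q
    induction q using Fin.lastCases with
    | last => simp [app]
    | cast q => simp [app]
  have h2 : app (x 0) x' ∘ (Fin.last (s + 1)).succAbove = x 0 := by
    funext q; simp [app]
  simp only [nLieD, LinearMap.coe_mk, AddHom.coe_mk, lowestD]
  rw [Fin.sum_univ_castSucc (n := s + 1)]
  simp only [h1, h2]
  simp only [e (fun c => _), app, Fin.snoc_last, Fin.snoc_castSucc]
  have h3 : (-1 : ℂ) ^ (s + 1 + (s + 1)) = 1 := by
    rw [← two_mul, pow_mul]; simp
  simp [h3]
  abel

end Complex

/-! ### The differential squares to zero -/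

section Complex

variable {s : ℕ} {L : Type u} [AddCommGroup L] [Module ℂ L]
variable {M : Type v} [AddCommGroup M] [Module ℂ M]
variable {br : MultilinearMap ℂ (fun _ : Fin (s + 2) => L) L}
  {ρ : MultilinearMap ℂ (fun _ : Fin (s + 1) => L) (M →ₗ[ℂ] M)}

theorem app_update {α : Type*} {n : ℕ} (x : Fin n → α) (y z : α) (i : Fin n) :
    Function.update (app x y) i.castSucc z = app (Function.update x i z) y := by
  exact (Fin.snoc_update (α := fun _ => α) _ _ _ _).symm

theorem app_update_last {α : Type*} {n : ℕ} (x : Fin n → α) (y z : α) :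
    Function.update (app x y) (Fin.last n) z = app x z := by
  rw [app, Fin.update_snoc_last]

/-- `ad` is a morphism of Leibniz algebras. -/
theorem ad_commutator (hbr : IsNLieBracket br) (X Y : Fin (s + 1) → L) :
    ad br X ∘ₗ ad br Y - ad br Y ∘ₗ ad br X =
      ∑ l, ad br (Function.update Y l (ad br X (Y l))) := by
  ext z
  have := hbr.2 X (app Y z)
  rw [Fin.sum_univ_castSucc] at this
  simp only [app_update, app_update_last] at this
  simp only [LinearMap.sub_apply, LinearMap.comp_apply, LinearMap.sum_apply, ad_apply, this]
  simp [app]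

theorem rho_commutator (hρ : IsNLieRep br ρ) (X Y : Fin (s + 1) → L) :
    ρ X ∘ₗ ρ Y - ρ Y ∘ₗ ρ X = ∑ l, ρ (Function.update Y l (ad br X (Y l))) :=
  hρ.2.1 X Y

theorem lieRow_commutator (hbr : IsNLieBracket br) (hρ : IsNLieRep br ρ) (X Y : Fin (s + 1) → L)
    {k : ℕ} {γ : Family s L M k} (hγ : γ ∈ nLieCochain s L M k) :
    lieRow br ρ X k (lieRow br ρ Y k γ) - lieRow br ρ Y k (lieRow br ρ X k γ) =
      ∑ l, lieRow br ρ (Function.update Y l (ad br X (Y l))) k γ := by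
  simp only [lieRow]
  rw [lieFamily_commutator _ _ _ _ hγ, ad_commutator hbr, rho_commutator hρ]
  have := map_sum (lieFamily_isLinear hγ).mk'
    (fun l => (ad br (Function.update Y l (ad br X (Y l))), ρ (Function.update Y l (ad br X (Y l)))))
    Finset.univ
  simp only [IsLinearMap.mk'_apply, Prod.fst_sum, Prod.snd_sum] at this
  exact this

/-- The lowest differential commutes with Lie derivatives. -/
theorem lowestD_lie (hbr : IsNLieBracket br) (hρ : IsNLieRep br ρ) (X : Fin (s + 1) → L)
    (γ : L →ₗ[ℂ] M) (z : Fin (s + 2) → L) :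
    lowestD br ρ (fun y => ρ X (γ y) - γ (ad br X y)) z =
      ρ X (lowestD br ρ γ z) -
        ∑ q, lowestD br ρ γ (Function.update z q (ad br X (z q))) := by
  have h1 : ∀ i : Fin (s + 2), ∑ q,
      ρ (Function.update z q (ad br X (z q)) ∘ i.succAbove)
        (γ (Function.update z q (ad br X (z q)) i)) =
      ρ (z ∘ i.succAbove) (γ (ad br X (z i))) +
        (ρ X (ρ (z ∘ i.succAbove) (γ (z i))) - ρ (z ∘ i.succAbove) (ρ X (γ (z i)))) := by
    intro i
    have h2 := LinearMap.congr_fun (rho_commutator hρ X (z ∘ i.succAbove)) (γ (z i))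
    simp only [LinearMap.sub_apply, LinearMap.comp_apply, LinearMap.sum_apply] at h2
    rw [h2, Fin.sum_univ_succAbove _ i]
    congr 1
    · rw [Function.update_self]
      congr 2
      funext q
      simp [Fin.succAbove_ne]
    · refine Finset.sum_congr rfl fun q _ => ?_
      rw [Function.update_of_ne (Fin.succAbove_ne i q).symm]
      congr 2
      exact Function.update_comp_eq_of_injective _ Fin.succAbove_right_injective _ _
  have h3 := hbr.2 X z
  simp only [← ad_apply] at h3
  simp only [lowestD, map_sub, Finset.sum_sub_distrib, map_sum, map_smul, smul_sub, h3]
  rw [Finset.sum_comm (s := Finset.univ) (t := Finset.univ)]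
  simp only [← Finset.smul_sum, h1, smul_add, smul_sub, Finset.sum_add_distrib,
    Finset.sum_sub_distrib]
  abel

theorem nLieCochain_zero_isLinear {γ : Family s L M 0} (hγ : γ ∈ nLieCochain s L M 0) :
    IsLinearMap ℂ (γ Fin.elim0) := hγ.2.1 _

/-- The differential commutes with Lie derivatives. -/
theorem nLieD_lieRow (hbr : IsNLieBracket br) (hρ : IsNLieRep br ρ) (k : ℕ) :
    ∀ (X : Fin (s + 1) → L) (γ : Family s L M k), γ ∈ nLieCochain s L M k →
      nLieD br ρ k (lieRow br ρ X k γ) = lieRow br ρ X (k + 1) (nLieD br ρ k γ) := by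
  induction k with
  | zero =>
    intro X γ hγ
    funext x x'
    have h1 := lowestD_lie hbr hρ X ((nLieCochain_zero_isLinear hγ).mk' _) (app (x 0) x')
    have h2 : lieRow br ρ X 0 γ Fin.elim0 =
        fun y => ρ X (γ Fin.elim0 y) - γ Fin.elim0 (ad br X y) := by
      funext y; simp [lieRow, lieFamily_apply]
    simp only [IsLinearMap.mk'_apply] at h1
    rw [nLieD_zero, h2, lieRow, lieFamily_apply, h1, Fin.sum_univ_castSucc (n := s + 1), ← sub_sub]
    simp only [nLieD_zero, app_update, app_update_last, setEntry]
    simp [app]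
    rfl
  | succ k ih =>
    intro X γ hγ
    refine family_ext fun Y => ?_
    rw [insertRow_nLieD]
    have h1 := insertRow_lieFamily (ad br X) (ρ X) Y γ
    have h2 := insertRow_lieFamily (ad br X) (ρ X) Y (nLieD br ρ (k + 1) γ)
    have h3 := lieRow_commutator hbr hρ X Y hγ
    simp only [← lieRow.eq_def] at h1 h2
    rw [h2, h1, map_sub, map_sum, ih X _ (insertRow_mem Y hγ)]
    simp only [insertRow_nLieD, map_sub, Finset.sum_sub_distrib, ← h3]
    abel

/-- Composition of the two representation identities makes the square of the differential vanish
in the lowest degree. -/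
theorem lowestD_comp (hρ : IsNLieRep br ρ) (W : Fin s → L) (v : M) (z : Fin (s + 2) → L) :
    lowestD br ρ (fun y => ρ (app W y) v) z = 0 := by
  have h1 := fun (y : L) => alternating_app (alternatingOfSwap ρ hρ.1) W y
  simp only [alternatingOfSwap_apply] at h1
  have h2 := LinearMap.congr_fun (hρ.2.2 z W) v
  simp only [LinearMap.sum_apply, LinearMap.smul_apply, LinearMap.comp_apply] at h2
  simp only [lowestD, h1, LinearMap.smul_apply, h2, map_smul, Finset.smul_sum]
  simp only [smul_comm ((-1 : ℂ) ^ s), sub_self]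

theorem lowestD_sum {I : Type*} (S : Finset I) (c : I → ℂ) (γ : I → L → M)
    (z : Fin (s + 2) → L) :
    lowestD br ρ (fun y => ∑ i ∈ S, c i • γ i y) z = ∑ i ∈ S, c i • lowestD br ρ (γ i) z := by
  simp only [lowestD, map_sum, map_smul, smul_sub, Finset.smul_sum, Finset.sum_sub_distrib]
  rw [Finset.sum_comm]
  congr 1
  exact Finset.sum_congr rfl fun i _ => Finset.sum_congr rfl fun j _ => smul_comm _ _ _

/-- The square of the differential vanishes. -/
theorem nLieD_nLieD (hbr : IsNLieBracket br) (hρ : IsNLieRep br ρ) (k : ℕ) :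
    ∀ γ : Family s L M k, γ ∈ nLieCochain s L M k →
      nLieD br ρ (k + 1) (nLieD br ρ k γ) = 0 := by
  induction k with
  | zero =>
    intro γ hγ
    refine family_ext fun X => ?_
    rw [insertRow_nLieD, ← nLieD_lieRow hbr hρ 0 X γ hγ, ← map_sub, map_zero]
    funext x x'
    rw [nLieD_zero]
    have h1 : (lieRow br ρ X 0 γ - insertRow M X 0 (nLieD br ρ 0 γ)) Fin.elim0 =
        fun y => ∑ j : Fin (s + 1), (-(-1 : ℂ) ^ (s + 1 + (j : ℕ))) •
          ρ (app (X ∘ j.succAbove) y) (γ Fin.elim0 (X j)) := by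
      funext y
      simp only [Pi.sub_apply, insertRow_apply]
      have e : ∀ y : Fin 0 → Fin (s + 1) → L, y = Fin.elim0 := fun y => Subsingleton.elim _ _
      simp [lieRow, lieFamily_apply, nLieD, pre, ad_apply]
      simp only [e (fun c => _)]
      abel
    rw [h1, lowestD_sum]
    simp only [lowestD_comp hρ, smul_zero, Finset.sum_const_zero]
    rfl
  | succ k ih =>
    intro γ hγ
    refine family_ext fun X => ?_
    rw [insertRow_nLieD, insertRow_nLieD, map_sub, nLieD_lieRow hbr hρ (k + 1) X γ hγ,
      ih _ (insertRow_mem X hγ)]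
    simp

/-- `lowestD` of a linear map, as an alternating map. -/
theorem exists_lowestD_alternating (hbr : IsNLieBracket br) (hρ : IsNLieRep br ρ)
    (γ : L →ₗ[ℂ] M) :
    ∃ G : L [⋀^Fin (s + 2)]→ₗ[ℂ] M, ∀ z, G z = lowestD br ρ γ z := by
  let f : L →ₗ[ℂ] L [⋀^Fin (s + 1)]→ₗ[ℂ] M :=
    { toFun := fun y => (LinearMap.applyₗ (γ y)).compAlternatingMap (alternatingOfSwap ρ hρ.1)
      map_add' := fun y y' => by ext; simp
      map_smul' := fun c y => by ext; simp }
  refine ⟨(-1 : ℂ) ^ (s + 1) • AlternatingMap.alternatizeUncurryFin f -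
    γ.compAlternatingMap (alternatingOfSwap br hbr.1), fun z => ?_⟩
  rw [AlternatingMap.sub_apply, AlternatingMap.smul_apply,
    AlternatingMap.alternatizeUncurryFin_apply, lowestD, Finset.smul_sum]
  congr 1
  refine Finset.sum_congr rfl fun i _ => ?_
  have e : f (z i) (i.removeNth z) = ρ (z ∘ i.succAbove) (γ (z i)) := rfl
  rw [e, pow_add (-1 : ℂ) (s + 1), mul_smul]
  congr 1
  rcases Nat.even_or_odd (i : ℕ) with h | h <;> simp [h.neg_one_pow]

theorem alternating_swap {ι : Type*} [DecidableEq ι] (G : L [⋀^ι]→ₗ[ℂ] M) (z : ι → L) {i j : ι}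
    (h : i ≠ j) : G (z ∘ Equiv.swap i j) = -G z := G.map_swap z h

theorem app_comp_swap {α : Type*} {n : ℕ} (x : Fin n → α) (y : α) (i j : Fin n) :
    app (x ∘ Equiv.swap i j) y = app x y ∘ Equiv.swap i.castSucc j.castSucc := by
  funext q
  induction q using Fin.lastCases with
  | last => simp [app, Equiv.swap_apply_of_ne_of_ne, (Fin.castSucc_lt_last _).ne']
  | cast q => simp [app, (Fin.castSucc_injective _).swap_apply]

theorem app_exchange {α : Type*} {n : ℕ} (x : Fin n → α) (y : α) (i : Fin n) :
    app (Function.update x i y) (x i) = app x y ∘ Equiv.swap i.castSucc (Fin.last n) := by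
  funext q
  induction q using Fin.lastCases with
  | last => simp [app]
  | cast q =>
    by_cases h : q = i
    · subst h; simp [app]
    · simp [app, h, Equiv.swap_apply_of_ne_of_ne, (Fin.castSucc_lt_last _).ne]

theorem lieRow_update_isLinear {k : ℕ} {γ : Family s L M k} (hγ : γ ∈ nLieCochain s L M k)
    (X : Fin (s + 1) → L) (j : Fin (s + 1)) :
    IsLinearMap ℂ fun y => lieRow br ρ (Function.update X j y) k γ := by
  have h := lieFamily_isLinear hγ
  constructor
  · intro y y'
    simp only [lieRow, MultilinearMap.map_update_add]
    exact h.map_add (_, _) (_, _)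
  · intro c y
    simp only [lieRow, MultilinearMap.map_update_smul]
    exact h.map_smul c (_, _)

/-- The differential maps cochains to cochains. -/
theorem nLieD_mem (hbr : IsNLieBracket br) (hρ : IsNLieRep br ρ) (k : ℕ) :
    ∀ γ : Family s L M k, γ ∈ nLieCochain s L M k →
      nLieD br ρ k γ ∈ nLieCochain s L M (k + 1) := by
  induction k with
  | zero =>
    intro γ hγ
    obtain ⟨G, hG⟩ := exists_lowestD_alternating hbr hρ ((nLieCochain_zero_isLinear hγ).mk' _)
    have hD : ∀ x x', nLieD br ρ 0 γ x x' = G (app (x 0) x') := fun x x' => by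
      rw [nLieD_zero, hG]; rfl
    refine ⟨fun x x' i j => ?_, fun x => ?_, ?_, ?_⟩
    · have hi : i = 0 := Fin.fin_one_eq_zero i
      subst hi
      simp only [hD, setEntry, Function.update_self, ← app_update]
      exact (G.toMultilinearMap.toLinearMap _ _).isLinear
    · have : nLieD br ρ 0 γ x = fun y => G (Function.update (app (x 0) 0) (Fin.last _) y) := by
        funext y
        rw [app_update_last, hD]
      rw [this]
      exact (G.toMultilinearMap.toLinearMap _ _).isLinear
    · intro x x' i j j' hj
      have hi : i = 0 := Fin.fin_one_eq_zero i
      subst hi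
      rw [hD, hD, swapEntries, Function.update_self, app_comp_swap, alternating_swap]
      simpa using hj
    · intro x x' i j _
      have hi : i = 0 := Fin.fin_one_eq_zero i
      subst hi
      rw [hD, hD, setEntry, Function.update_self, app_exchange, alternating_swap]
      exact (Fin.castSucc_lt_last _).ne
  | succ k ih =>
    intro γ hγ
    have hX : ∀ X, insertRow M X (k + 1) (nLieD br ρ (k + 1) γ) ∈
        nLieCochain s L M (k + 1) := by
      intro X
      rw [insertRow_nLieD]
      exact sub_mem (lieFamily_mem _ _ hγ) (ih _ (insertRow_mem X hγ))
    refine ⟨fun x x' i j => ?_, fun x => ?_, ?_, ?_⟩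
    · rw [← pre_tail x]
      induction i using Fin.cases with
      | zero =>
        simp only [setEntry_pre_zero, nLieD_pre]
        have h1 := lieRow_update_isLinear (br := br) (ρ := ρ) hγ (x 0) j
        have h2 : IsLinearMap ℂ fun y => insertRow M (Function.update (x 0) j y) k γ := by
          constructor
          · intro y y'
            funext z z'
            have := (hγ.1 (pre (x 0) z) z' 0 j).map_add y y'
            simp only [setEntry_pre_zero] at this
            exact this
          · intro c y
            funext z z'
            have := (hγ.1 (pre (x 0) z) z' 0 j).map_smul c y
            simp only [setEntry_pre_zero] at this
            exact this
        constructor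
        · intro y y'
          rw [h1.map_add, h2.map_add, map_add]
          simp only [Pi.add_apply]
          abel
        · intro c y
          rw [h1.map_smul, h2.map_smul, map_smul]
          simp only [Pi.smul_apply, smul_sub]
      | succ i =>
        simp only [setEntry_pre_succ]
        exact (hX (x 0)).1 _ _ _ _
    · rw [← pre_tail x]
      exact (hX (x 0)).2.1 _
    · intro x x' i j j' hj
      rw [← pre_tail x]
      induction i using Fin.cases with
      | zero =>
        have h0 : swapEntries (pre (x 0) fun c => x c.succ) 0 j j' =
            pre (x 0 ∘ Equiv.swap j j') fun c => x c.succ := by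
          simp [swapEntries, pre, Fin.update_cons_zero]
        have h1 : lieRow br ρ (x 0 ∘ Equiv.swap j j') (k + 1) γ = -lieRow br ρ (x 0) (k + 1) γ := by
          have e : ad br (x 0 ∘ Equiv.swap j j') = -ad br (x 0) := by
            ext y
            rw [ad_apply, app_comp_swap, hbr.1 _ _ _ (by simpa using hj)]
            rfl
          rw [lieRow, e, hρ.1 _ _ _ hj]
          exact (lieFamily_isLinear hγ).map_neg (_, _)
        have h2 : insertRow M (x 0 ∘ Equiv.swap j j') k γ = -insertRow M (x 0) k γ := by
          funext z z'
          have := hγ.2.2.1 (pre (x 0) z) z' 0 j j' hj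
          simp only [swapEntries, pre, Fin.update_cons_zero, Fin.cons_zero] at this
          exact this
        rw [h0, nLieD_pre, nLieD_pre, h1, h2, map_neg]
        simp only [Pi.neg_apply]
        abel
      | succ i =>
        have h0 : swapEntries (pre (x 0) fun c => x c.succ) i.succ j j' =
            pre (x 0) (swapEntries (fun c => x c.succ) i j j') := by
          simp [swapEntries, pre, Fin.cons_update]
        rw [h0]
        exact (hX (x 0)).2.2.1 _ _ _ _ _ hj
    · intro x x' i j hi
      rw [← pre_tail x]
      induction i using Fin.cases with
      | zero => simp at hi
      | succ i =>
        rw [setEntry_pre_succ]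
        exact (hX (x 0)).2.2.2 _ _ _ _ (by simpa using hi)

/-- The cochains of an `n`-Lie algebra form a complex. -/
theorem nLieCochain_isComplex (hbr : IsNLieBracket br) (hρ : IsNLieRep br ρ) :
    IsComplex (nLieCochain s L M) (nLieD br ρ) :=
  fun k γ hγ => ⟨nLieD_mem hbr hρ k γ hγ, nLieD_nLieD hbr hρ k γ hγ⟩

end Complex

/-! ### Polynomials acting on the annihilation algebra -/

section Shift

variable {p : ℕ}

/-- The binomial theorem for a product of powers of binomials. -/
theorem prod_add_pow_eq_sum_Iic {ι S : Type*} [Fintype ι] [DecidableEq ι] [CommRing S] [Algebra ℂ S]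
    (A B : ι → S) (m : ι → ℕ) :
    ∏ i, (A i + B i) ^ m i =
      ∑ j ∈ Finset.Iic m, binom m j • ∏ i, (A i ^ j i * B i ^ (m i - j i)) := by
  have h : Finset.Iic m = Fintype.piFinset fun i => Finset.range (m i + 1) := by
    ext j; simp [Pi.le_def]
  simp only [add_pow, h]
  rw [Finset.prod_univ_sum]
  refine Finset.sum_congr rfl fun j _ => ?_
  rw [Finset.prod_mul_distrib, mul_comm, binom, Algebra.smul_def, map_prod]
  simp

/-- The pairing `f ⊗ b ↦ b_f`, the linear extension of `b_{t^m} = b_m` to all polynomials in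
`t₁, …, t_p`. -/
def annPoly (p : ℕ) (R : Type u) [AddCommGroup R] [Module ℂ R] [Module ℂ[X] R]
    [IsScalarTower ℂ ℂ[X] R] : MvPolynomial (Fin p) ℂ →ₗ[ℂ] R →ₗ[ℂ] annihilation p R :=
  (MvPolynomial.basisMonomials (Fin p) ℂ).constr ℂ fun m => ann ⇑m

variable {R : Type u} [AddCommGroup R] [Module ℂ R] [Module ℂ[X] R] [IsScalarTower ℂ ℂ[X] R]

theorem annPoly_monomial (m : Fin p →₀ ℕ) (b : R) :
    annPoly p R (MvPolynomial.monomial m 1) b = ann ⇑m b := by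
  have := (MvPolynomial.basisMonomials (Fin p) ℂ).constr_basis ℂ
    (fun m => (ann ⇑m : R →ₗ[ℂ] annihilation p R)) m
  rw [MvPolynomial.coe_basisMonomials] at this
  rw [annPoly, this]

/-- The linear map `F ↦ ∑ k, (h k)_{F_k}`, where `F = ∑ k, F_k X^k` is a polynomial whose
coefficients `F_k` are polynomials in `t₁, …, t_p`. -/
def pairing {J : Type*} (h : (J → ℕ) → R) :
    MvPolynomial J (MvPolynomial (Fin p) ℂ) →ₗ[ℂ] annihilation p R :=
  Finsupp.lsum ℂ (fun k : J →₀ ℕ => (annPoly p R).flip (h k)) ∘ₗ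
    (AddMonoidAlgebra.coeffLinearEquiv ℂ).toLinearMap

theorem pairing_monomial {J : Type*} (h : (J → ℕ) → R) (k : J →₀ ℕ) (f : MvPolynomial (Fin p) ℂ) :
    pairing h (MvPolynomial.monomial k f) = annPoly p R f (h k) := by
  have : (AddMonoidAlgebra.coeffLinearEquiv ℂ) (MvPolynomial.monomial k f) = Finsupp.single k f :=
    rfl
  simp [pairing, this]

theorem MvPolynomial_linear_ext {J P N : Type*} [CommRing P] [Algebra ℂ P] [AddCommGroup N]
    [Module ℂ N] {u w : MvPolynomial J P →ₗ[ℂ] N}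
    (h : ∀ k f, u (MvPolynomial.monomial k f) = w (MvPolynomial.monomial k f)) : u = w := by
  refine LinearMap.ext fun F => ?_
  induction F using MvPolynomial.induction_on' with
  | monomial k f => exact h k f
  | add F G hF hG => rw [map_add, map_add, hF, hG]

/-- Linear maps on polynomials are determined by their values on monomials with coefficient 1. -/
theorem poly_linear_ext {N : Type*} [AddCommGroup N]
    [Module ℂ N] {u w : MvPolynomial (Fin p) ℂ →ₗ[ℂ] N}
    (h : ∀ k, u (MvPolynomial.monomial k 1) = w (MvPolynomial.monomial k 1)) : u = w := by
  refine (MvPolynomial.basisMonomials (Fin p) ℂ).ext fun k => ?_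
  simpa using h k

variable {S S' : Type*} [CommRing S] [Algebra ℂ S] [CommRing S'] [Algebra ℂ S']
  [Algebra (MvPolynomial (Fin p) ℂ) S] [IsScalarTower ℂ (MvPolynomial (Fin p) ℂ) S]
  [Algebra (MvPolynomial (Fin p) ℂ) S'] [IsScalarTower ℂ (MvPolynomial (Fin p) ℂ) S']

/-- The Taylor shift `f(t₁, …, t_p) ↦ f(t₁ + z, …, t_p + z)`. -/
def shift (z : S) : MvPolynomial (Fin p) ℂ →ₐ[ℂ] S :=
  MvPolynomial.aeval fun c => algebraMap (MvPolynomial (Fin p) ℂ) S (MvPolynomial.X c) + z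

theorem shift_zero (f : MvPolynomial (Fin p) ℂ) :
    shift (0 : S) f = algebraMap (MvPolynomial (Fin p) ℂ) S f := by
  have : shift (0 : S) = IsScalarTower.toAlgHom ℂ (MvPolynomial (Fin p) ℂ) S := by
    ext c; simp [shift]
  rw [this]; rfl

/-- Shifts compose additively. -/
theorem map_shift (g : S →+* S') (w : S')
    (hg : ∀ f : MvPolynomial (Fin p) ℂ, g (algebraMap _ S f) = shift w f) (z : S)
    (f : MvPolynomial (Fin p) ℂ) : g (shift z f) = shift (g z + w) f := by
  have hC : ∀ c : ℂ, g (algebraMap ℂ S c) = algebraMap ℂ S' c := by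
    intro c
    rw [IsScalarTower.algebraMap_apply ℂ (MvPolynomial (Fin p) ℂ) S, hg]
    exact (shift w).commutes c
  induction f using MvPolynomial.induction_on with
  | C a =>
    have e : (MvPolynomial.C a : MvPolynomial (Fin p) ℂ) = algebraMap ℂ _ a := rfl
    rw [e, AlgHom.commutes, AlgHom.commutes, hC]
  | add f f' hf hf' => simp only [map_add, hf, hf']
  | mul_X f c hf =>
    rw [map_mul, map_mul, map_mul, hf]
    congr 1
    simp only [shift, MvPolynomial.aeval_X, map_add]
    rw [hg]
    simp only [shift, MvPolynomial.aeval_X]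
    ring

theorem shift_monomial (z : S) (m : Fin p →₀ ℕ) :
    shift z (MvPolynomial.monomial m 1) =
      ∏ c, (algebraMap (MvPolynomial (Fin p) ℂ) S (MvPolynomial.X c) + z) ^ m c := by
  rw [shift, MvPolynomial.aeval_monomial, Finsupp.prod_fintype _ _ (by simp)]
  simp

end Shift

section Divided

variable {p : ℕ} {R : Type u} [AddCommGroup R] [Module ℂ R] [Module ℂ[X] R] [IsScalarTower ℂ ℂ[X] R]

/-- The derivation `∂_{t₁} + ⋯ + ∂_{t_p}`. -/
def totalDeriv (p : ℕ) : Derivation ℂ (MvPolynomial (Fin p) ℂ) (MvPolynomial (Fin p) ℂ) :=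
  MvPolynomial.mkDerivation ℂ fun _ => 1

theorem totalDeriv_monomial (m : Fin p →₀ ℕ) :
    totalDeriv p (MvPolynomial.monomial m 1) =
      ∑ c, (m c : ℂ) • MvPolynomial.monomial (m - Finsupp.single c 1) (1 : ℂ) := by
  rw [totalDeriv, MvPolynomial.mkDerivation_monomial, Finsupp.sum_fintype _ _ (by simp)]
  simp [MvPolynomial.smul_monomial]

/-- The relation `(∂b)_f = -b_{f'}`. -/
theorem annPoly_del (f : MvPolynomial (Fin p) ℂ) (b : R) :
    annPoly p R f (del R b) = -annPoly p R (totalDeriv p f) b := by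
  have : (annPoly p R).flip (del R b) =
      -((annPoly p R).flip b ∘ₗ (totalDeriv p : MvPolynomial (Fin p) ℂ →ₗ[ℂ] _)) := by
    refine poly_linear_ext fun m => ?_
    simp only [LinearMap.flip_apply, LinearMap.neg_apply, LinearMap.comp_apply,
      Derivation.coeFn_coe, annPoly_monomial, ann_del, totalDeriv_monomial, map_sum, map_smul]
    congr 1
    refine Finset.sum_congr rfl fun c _ => ?_
    congr 2
    congr 1
    funext d
    by_cases hd : d = c
    · subst hd; simp [lowerAt]
    · simp [lowerAt, hd]
  exact LinearMap.congr_fun this f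

/-- `∂^{(t)} f`, the coefficient of `z^t` in `f(t₁ + z, …, t_p + z)`. -/
def dividedDeriv (t : ℕ) (f : MvPolynomial (Fin p) ℂ) : MvPolynomial (Fin p) ℂ :=
  (shift (Polynomial.X : (MvPolynomial (Fin p) ℂ)[X]) f).coeff t

theorem shift_eq_sum {S : Type*} [CommRing S] [Algebra ℂ S]
    [Algebra (MvPolynomial (Fin p) ℂ) S] [IsScalarTower ℂ (MvPolynomial (Fin p) ℂ) S] (z : S)
    (f : MvPolynomial (Fin p) ℂ) {N : ℕ}
    (hN : (shift (Polynomial.X : (MvPolynomial (Fin p) ℂ)[X]) f).natDegree < N) :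
    shift z f = ∑ t ∈ Finset.range N, algebraMap _ S (dividedDeriv t f) * z ^ t := by
  have := map_shift (S := (MvPolynomial (Fin p) ℂ)[X])
    (Polynomial.aeval z : (MvPolynomial (Fin p) ℂ)[X] →ₐ[MvPolynomial (Fin p) ℂ] S).toRingHom
    0 (by intro f; rw [shift_zero]; simp) Polynomial.X f
  simp only [AlgHom.toRingHom_eq_coe, RingHom.coe_coe, Polynomial.aeval_X, add_zero] at this
  rw [← this, Polynomial.aeval_eq_sum_range' hN]
  simp only [Algebra.smul_def, dividedDeriv]

theorem shift_X_totalDeriv (f : MvPolynomial (Fin p) ℂ) :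
    shift (Polynomial.X : (MvPolynomial (Fin p) ℂ)[X]) (totalDeriv p f) =
      Polynomial.derivative (shift (Polynomial.X : (MvPolynomial (Fin p) ℂ)[X]) f) := by
  induction f using MvPolynomial.induction_on with
  | C a =>
    have e : (MvPolynomial.C a : MvPolynomial (Fin p) ℂ) = algebraMap ℂ _ a := rfl
    rw [e, Derivation.map_algebraMap, map_zero, AlgHom.commutes,
      IsScalarTower.algebraMap_apply ℂ (MvPolynomial (Fin p) ℂ) (MvPolynomial (Fin p) ℂ)[X]]
    simp
  | add f f' hf hf' => simp only [map_add, hf, hf']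
  | mul_X f c hf =>
    have e : Polynomial.derivative
        (shift (Polynomial.X : (MvPolynomial (Fin p) ℂ)[X]) (MvPolynomial.X c)) = 1 := by
      simp [shift]
    have e' : totalDeriv p (MvPolynomial.X c) = 1 := by simp [totalDeriv]
    rw [Derivation.leibniz, map_mul, Polynomial.derivative_mul, e, ← hf, e']
    simp only [smul_eq_mul, map_add, map_mul, map_one]
    ring

/-- Integration by parts: `(∂^t b)_f = (-1)^t t! b_{∂^{(t)} f}`. -/
theorem annPoly_del_pow (t : ℕ) (f : MvPolynomial (Fin p) ℂ) (b : R) :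
    annPoly p R f ((del R ^ t) b) =
      ((-1 : ℂ) ^ t * t.factorial) • annPoly p R (dividedDeriv t f) b := by
  induction t generalizing f with
  | zero =>
    have : dividedDeriv 0 f = f := by
      rw [dividedDeriv, Polynomial.coeff_zero_eq_aeval_zero]
      have := map_shift (S := (MvPolynomial (Fin p) ℂ)[X]) (S' := MvPolynomial (Fin p) ℂ)
        (Polynomial.aeval (0 : MvPolynomial (Fin p) ℂ)).toRingHom
        0 (by intro f; rw [shift_zero]; simp) Polynomial.X f
      simp only [AlgHom.toRingHom_eq_coe, RingHom.coe_coe, Polynomial.aeval_X, add_zero] at this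
      rw [this, shift_zero]; rfl
    simp [this]
  | succ t ih =>
    rw [pow_succ', Module.End.mul_apply, annPoly_del, ih]
    have : dividedDeriv t (totalDeriv p f) = ((t + 1 : ℕ) : ℂ) • dividedDeriv (t + 1) f := by
      rw [dividedDeriv, shift_X_totalDeriv, Polynomial.coeff_derivative, dividedDeriv,
        Algebra.smul_def, mul_comm]
      simp
    rw [this, map_smul, LinearMap.smul_apply, smul_smul, ← neg_smul, Nat.factorial_succ]
    congr 1
    push_cast
    ring

end Divided

/-! ### The bracket of the annihilation algebra in terms of polynomials -/

section Bracket

variable {p s : ℕ} {R : Type u} [AddCommGroup R] [Module ℂ R] [Module ℂ[X] R]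
  [IsScalarTower ℂ ℂ[X] R] (A : NLieConformalAlgebra s R)

theorem monomial_eq_prod_univ {J P : Type*} [Fintype J] [CommRing P] (k : J →₀ ℕ) (f : P) :
    MvPolynomial.monomial k f = MvPolynomial.C f * ∏ i, MvPolynomial.X i ^ k i := by
  rw [MvPolynomial.monomial_eq, Finsupp.prod_fintype _ _ (by simp)]

/-- The variables substituted into the arguments of a bracket: `X_{u i}` for the `i`-th argument
with `i < n`, and `0` for the last one. -/
def bracketVar {J : Type*} (u : Fin (s + 1) → J) :
    Fin (s + 2) → MvPolynomial J (MvPolynomial (Fin p) ℂ) :=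
  app (fun i => MvPolynomial.X (u i)) 0

/-- The bracket of `(a^i)_{f_i}` pairs the coefficients of the `λ`-bracket with the Taylor expansion of
`f₁(t + λ₁) ⋯ fₙ(t + λₙ)`, where `λₙ = 0`. -/
theorem annBracket_annPoly (a : Fin (s + 2) → R) (f : Fin (s + 2) → MvPolynomial (Fin p) ℂ) :
    annBracket p A (fun i => annPoly p R (f i) (a i)) =
      pairing (fun k => A.prod k a) (∏ i, shift (bracketVar id i) (f i)) := by
  have key : (annBracket p A).compLinearMap (fun i => (annPoly p R).flip (a i)) =
      (pairing fun k => A.prod k a).compMultilinearMap ((MultilinearMap.mkPiAlgebra ℂ (Fin (s + 2))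
        (MvPolynomial (Fin (s + 1)) (MvPolynomial (Fin p) ℂ))).compLinearMap
          fun i => (shift (bracketVar id i)).toLinearMap) := by
    refine Module.Basis.ext_multilinear
      (fun _ => MvPolynomial.basisMonomials (Fin p) ℂ) fun m => ?_
    simp only [MvPolynomial.coe_basisMonomials, MultilinearMap.compLinearMap_apply,
      LinearMap.compMultilinearMap_apply, LinearMap.flip_apply, annPoly_monomial,
      MultilinearMap.mkPiAlgebra_apply, AlgHom.toLinearMap_apply, shift_monomial]
    rw [annBracket_ann, Fin.prod_univ_castSucc]
    simp only [bracketVar, app, Fin.snoc_castSucc, Fin.snoc_last, add_zero, id]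
    rw [← Fintype.prod_prod_type' (f := fun (i : Fin (s + 1)) (c : Fin p) =>
      (algebraMap (MvPolynomial (Fin p) ℂ) (MvPolynomial (Fin (s + 1)) (MvPolynomial (Fin p) ℂ))
        (MvPolynomial.X c) + MvPolynomial.X i) ^ m i.castSucc c)]
    simp only [add_comm (algebraMap _ _ _)]
    rw [prod_add_pow_eq_sum_Iic, Finset.sum_mul, map_sum]
    refine Finset.sum_congr rfl fun j _ => ?_
    rw [smul_mul_assoc, map_smul]
    congr 1
    have : (∏ x : Fin (s + 1) × Fin p, (MvPolynomial.X x.1 ^ j x *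
        algebraMap (MvPolynomial (Fin p) ℂ) (MvPolynomial (Fin (s + 1)) (MvPolynomial (Fin p) ℂ))
          (MvPolynomial.X x.2) ^ (m x.1.castSucc x.2 - j x))) *
        ∏ c, algebraMap (MvPolynomial (Fin p) ℂ)
          (MvPolynomial (Fin (s + 1)) (MvPolynomial (Fin p) ℂ)) (MvPolynomial.X c) ^
            m (Fin.last _) c =
        MvPolynomial.monomial (Finsupp.equivFunOnFinite.symm fun i => ∑ c, j (i, c))
          (MvPolynomial.monomial (Finsupp.equivFunOnFinite.symm
            (fun c => m (Fin.last _) c + ∑ i : Fin (s + 1), (m i.castSucc c - j (i, c)))) 1) := by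
      rw [monomial_eq_prod_univ, monomial_eq_prod_univ, Finset.prod_mul_distrib]
      simp only [map_one, one_mul, map_mul, map_prod, map_pow, Finsupp.equivFunOnFinite_symm_apply_apply,
        pow_add, ← Finset.prod_pow_eq_pow_sum, Finset.prod_mul_distrib, Fintype.prod_prod_type,
        MvPolynomial.algebraMap_eq]
      rw [Finset.prod_comm (f := fun (c : Fin p) (i : Fin (s + 1)) => _ ^ (_ - _))]
      ring
    rw [this, pairing_monomial, annPoly_monomial]
    rfl
  have := congrArg (fun G => G f) key
  simpa using this

set_option maxHeartbeats 800000 in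
/-- The bracket of `n` elements one of which is of the form `pairing h F`. -/
theorem annBracket_update_pairing {J J' : Type*} (u : Fin (s + 1) → J) (w : J' → J)
    (hu : Function.Injective u) (hw : Function.Injective w) (hd : ∀ i j, u i ≠ w j)
    (a : Fin (s + 2) → R) (f : Fin (s + 2) → MvPolynomial (Fin p) ℂ) (i₀ : Fin (s + 2))
    (h : (J' → ℕ) → R) (F : MvPolynomial J' (MvPolynomial (Fin p) ℂ)) :
    annBracket p A (Function.update (fun i => annPoly p R (f i) (a i)) i₀ (pairing h F)) =
      pairing (fun k => A.prod (k ∘ u) (Function.update a i₀ (h (k ∘ w))))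
        ((∏ i ∈ Finset.univ.erase i₀, shift (bracketVar u i) (f i)) *
          MvPolynomial.eval₂Hom (shift (bracketVar u i₀) : MvPolynomial (Fin p) ℂ →ₐ[ℂ] _).toRingHom
            (fun j => MvPolynomial.X (w j)) F) := by
  induction F using MvPolynomial.induction_on' with
  | add F G hF hG => rw [map_add, MultilinearMap.map_update_add, hF, hG, map_add, mul_add, map_add]
  | monomial l g =>
    have e1 : Function.update (fun i => annPoly p R (f i) (a i)) i₀ (annPoly p R g (h l)) =
        fun i => annPoly p R (Function.update f i₀ g i) (Function.update a i₀ (h l) i) := by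
      funext i
      by_cases hi : i = i₀
      · subst hi; simp
      · simp [hi]
    have e2 : MvPolynomial.eval₂Hom
        (shift (bracketVar (p := p) u i₀) : MvPolynomial (Fin p) ℂ →ₐ[ℂ] _).toRingHom
        (fun j => MvPolynomial.X (w j)) (MvPolynomial.monomial l g) =
        shift (bracketVar (p := p) u i₀) g * MvPolynomial.monomial (Finsupp.mapDomain w l) 1 := by
      rw [← MvPolynomial.rename_monomial, MvPolynomial.coe_eval₂Hom, MvPolynomial.eval₂_monomial]
      congr 1
      rw [MvPolynomial.rename_eq_aeval, MvPolynomial.aeval_monomial]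
      simp
    have e3 : ∀ (i : Fin (s + 2)) (f : MvPolynomial (Fin p) ℂ),
        shift (bracketVar (p := p) u i) f =
        MvPolynomial.rename u (shift (bracketVar (p := p) id i) f) := by
      intro i f
      have := map_shift (MvPolynomial.rename u : MvPolynomial (Fin (s + 1))
        (MvPolynomial (Fin p) ℂ) →ₐ[MvPolynomial (Fin p) ℂ] _).toRingHom
        0 (by intro f; rw [shift_zero]; simp) (bracketVar (p := p) id i) f
      simp only [AlgHom.toRingHom_eq_coe, RingHom.coe_coe, add_zero] at this
      rw [this]
      congr 2
      induction i using Fin.lastCases <;> simp [bracketVar]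
    have e4 : ∀ G, pairing (fun k => A.prod (k ∘ u) (Function.update a i₀ (h (k ∘ w))))
        (MvPolynomial.rename u G * MvPolynomial.monomial (Finsupp.mapDomain w l) 1) =
        pairing (p := p) (fun k => A.prod k (Function.update a i₀ (h l))) G := by
      intro G
      induction G using MvPolynomial.induction_on' with
      | add F G hF hG => simp only [map_add, add_mul, hF, hG]
      | monomial k f =>
        rw [MvPolynomial.rename_monomial, MvPolynomial.monomial_mul, pairing_monomial,
          pairing_monomial, mul_one]
        have h1 : ⇑(Finsupp.mapDomain u k + Finsupp.mapDomain w l) ∘ u = k := by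
          funext i
          simp only [Function.comp, Finsupp.add_apply, Finsupp.mapDomain_apply hu]
          rw [Finsupp.mapDomain_of_notMem_range, add_zero]
          rintro ⟨j, hj⟩
          exact hd i j hj.symm
        have h2 : ⇑(Finsupp.mapDomain u k + Finsupp.mapDomain w l) ∘ w = l := by
          funext i
          simp only [Function.comp, Finsupp.add_apply, Finsupp.mapDomain_apply hw]
          rw [Finsupp.mapDomain_of_notMem_range, zero_add]
          rintro ⟨j, hj⟩
          exact hd j i hj
        rw [h1, h2]
    have e5 : (∏ i ∈ Finset.univ.erase i₀, shift (bracketVar (p := p) u i) (f i)) *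
        shift (bracketVar (p := p) u i₀) g = MvPolynomial.rename u
          (∏ i, shift (bracketVar (p := p) id i) (Function.update f i₀ g i)) := by
      rw [map_prod, ← Finset.prod_erase_mul _ _ (Finset.mem_univ i₀), ← e3, Function.update_self,
        Finset.prod_congr rfl fun i hi => ?_]
      rw [← e3, Function.update_of_ne (Finset.ne_of_mem_erase hi)]
    rw [pairing_monomial, e1, annBracket_annPoly, e2, ← mul_assoc, e5]
    exact (e4 _).symm

end Bracket

/-! ### Skew-symmetry of the bracket -/

section SkewSymmetry

variable {p s : ℕ} {R : Type u} [AddCommGroup R] [Module ℂ R] [Module ℂ[X] R]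
  [IsScalarTower ℂ ℂ[X] R] (A : NLieConformalAlgebra s R)

theorem pairing_sum_smul {J I : Type*} (S : Finset I) (c : I → ℂ) (h : I → (J → ℕ) → R)
    (F : MvPolynomial J (MvPolynomial (Fin p) ℂ)) :
    pairing (fun k => ∑ i ∈ S, c i • h i k) F = ∑ i ∈ S, c i • pairing (h i) F := by
  have : pairing (fun k => ∑ i ∈ S, c i • h i k) = ∑ i ∈ S, c i • pairing (p := p) (h i) := by
    refine MvPolynomial_linear_ext fun k f => ?_
    simp [pairing_monomial]
  rw [this]; simp

theorem map_prod_shift {J J' I : Type*} (g : MvPolynomial J (MvPolynomial (Fin p) ℂ) →+*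
    MvPolynomial J' (MvPolynomial (Fin p) ℂ)) (w : MvPolynomial J' (MvPolynomial (Fin p) ℂ))
    (hg : ∀ f : MvPolynomial (Fin p) ℂ, g (MvPolynomial.C f) = shift w f) (S : Finset I)
    (z : I → MvPolynomial J (MvPolynomial (Fin p) ℂ)) (f : I → MvPolynomial (Fin p) ℂ) :
    g (∏ i ∈ S, shift (z i) (f i)) = ∏ i ∈ S, shift (g (z i) + w) (f i) := by
  rw [map_prod]
  exact Finset.prod_congr rfl fun i _ => map_shift g w hg _ _

theorem annBracket_annPoly_swap_left (i : Fin s) (a : Fin (s + 2) → R)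
    (f : Fin (s + 2) → MvPolynomial (Fin p) ℂ) :
    annBracket p A ((fun i => annPoly p R (f i) (a i)) ∘
      Equiv.swap i.castSucc.castSucc i.succ.castSucc) =
        -annBracket p A (fun i => annPoly p R (f i) (a i)) := by
  set σ := Equiv.swap i.castSucc.castSucc i.succ.castSucc with hσ
  set τ := Equiv.swap i.castSucc i.succ with hτ
  have h1 := annBracket_annPoly A (a ∘ σ) (f ∘ σ)
  have h2 : ∀ F, pairing (p := p) (fun k => A.prod k (a ∘ σ)) (MvPolynomial.rename τ F) =
      -pairing (fun k => A.prod k a) F := by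
    intro F
    induction F using MvPolynomial.induction_on' with
    | add F G hF hG => simp only [map_add, hF, hG, neg_add]
    | monomial k f =>
      rw [MvPolynomial.rename_monomial, pairing_monomial, pairing_monomial, ← map_neg,
        ← A.skew_left k a i]
      congr 3
      funext j
      have := Finsupp.mapDomain_apply τ.injective k (τ j)
      rwa [hτ, Equiv.swap_apply_self] at this
  have h3 : ∀ q, σ (Fin.castSucc q) = Fin.castSucc (τ q) := by
    intro q
    rw [hσ, hτ]
    exact ((Fin.castSucc_injective _).swap_apply _ _ _)
  have h4 : σ (Fin.last (s + 1)) = Fin.last (s + 1) :=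
    Equiv.swap_apply_of_ne_of_ne (Fin.castSucc_lt_last _).ne' (Fin.castSucc_lt_last _).ne'
  have h5 : ∏ q, shift (bracketVar (p := p) id q) ((f ∘ σ) q) =
      MvPolynomial.rename τ (∏ q, shift (bracketVar (p := p) id q) (f q)) := by
    have := map_prod_shift (MvPolynomial.rename τ : MvPolynomial (Fin (s + 1))
      (MvPolynomial (Fin p) ℂ) →ₐ[MvPolynomial (Fin p) ℂ] _).toRingHom 0
      (fun f => by rw [shift_zero]; simp) Finset.univ (bracketVar id) f
    simp only [AlgHom.toRingHom_eq_coe, RingHom.coe_coe] at this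
    rw [this, ← Equiv.prod_comp σ]
    refine Finset.prod_congr rfl fun q _ => ?_
    have h6 : (f ∘ σ) (σ q) = f q := by simp [hσ]
    have h7 : bracketVar (p := p) id (σ q) =
        MvPolynomial.rename τ (bracketVar (p := p) id q) + 0 := by
      induction q using Fin.lastCases with
      | last => rw [h4]; simp [bracketVar]
      | cast q => rw [h3]; simp [bracketVar]
    rw [h6, h7]
  have h0 : (fun i => annPoly p R (f i) (a i)) ∘ σ =
      fun i => annPoly p R ((f ∘ σ) i) ((a ∘ σ) i) := rfl
  rw [h0, h1, h5, h2, ← annBracket_annPoly]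

/-- The substitution `λ_i ↦ λ_i` for `i < n - 1`, `λ_{n-1} ↦ -∂ - λ₁ - ⋯ - λ_{n-1}` of the conformal
skew-symmetry, where `∂` acts on the coefficients as `-d/dt`. -/
theorem pairing_skew_last (a : Fin (s + 2) → R)
    (F : MvPolynomial (Fin (s + 1)) (MvPolynomial (Fin p) ℂ)) :
    pairing (fun k => A.prod k a) F = -pairing (fun k => A.prod k
      (a ∘ Equiv.swap (Fin.last s).castSucc (Fin.last (s + 1))))
      (MvPolynomial.eval₂Hom (shift (MvPolynomial.X (Fin.last s)) :
          MvPolynomial (Fin p) ℂ →ₐ[ℂ] MvPolynomial (Fin (s + 1)) (MvPolynomial (Fin p) ℂ)).toRingHom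
        (app (fun i : Fin s => MvPolynomial.X i.castSucc - MvPolynomial.X (Fin.last s))
          (-MvPolynomial.X (Fin.last s))) F) := by
  set a' := a ∘ Equiv.swap (Fin.last s).castSucc (Fin.last (s + 1)) with ha'
  induction F using MvPolynomial.induction_on' with
  | add F G hF hG => simp only [map_add, hF, hG, neg_add]
  | monomial k f =>
    obtain ⟨b, hb⟩ := (A.polynomial a').bddAbove
    set T := max ((shift (Polynomial.X : (MvPolynomial (Fin p) ℂ)[X]) f).natDegree + 1)
      (b (Fin.last s) + 1) with hT
    set W : MvPolynomial (Fin (s + 1)) (MvPolynomial (Fin p) ℂ) := MvPolynomial.X (Fin.last s)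
    set k' : Fin s → ℕ := fun i => k i.castSucc with hk'
    have e1 : MvPolynomial.eval₂Hom (shift W :
          MvPolynomial (Fin p) ℂ →ₐ[ℂ] MvPolynomial (Fin (s + 1)) (MvPolynomial (Fin p) ℂ)).toRingHom
        (app (fun i : Fin s => MvPolynomial.X i.castSucc - W) (-W)) (MvPolynomial.monomial k f) =
        ∑ j ∈ Finset.Iic k', ∑ t ∈ Finset.range T,
          (binom k' j * (-1 : ℂ) ^ (∑ i : Fin s, (k' i - j i) + k (Fin.last s))) •
            MvPolynomial.monomial (Finsupp.equivFunOnFinite.symm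
              (app j (t + ∑ i : Fin s, (k' i - j i) + k (Fin.last s)))) (dividedDeriv t f) := by
      rw [MvPolynomial.coe_eval₂Hom, MvPolynomial.eval₂_monomial,
        Finsupp.prod_fintype _ _ (by simp), Fin.prod_univ_castSucc]
      simp only [app, Fin.snoc_castSucc, Fin.snoc_last, sub_eq_add_neg]
      have := prod_add_pow_eq_sum_Iic (fun i : Fin s => (MvPolynomial.X i.castSucc :
        MvPolynomial (Fin (s + 1)) (MvPolynomial (Fin p) ℂ))) (fun _ => -W) k'
      rw [this, AlgHom.toRingHom_eq_coe, RingHom.coe_coe, shift_eq_sum W f (N := T) (by omega),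
        Finset.sum_mul]
      simp only [Finset.mul_sum, Finset.sum_mul]
      rw [Finset.sum_comm]
      refine Finset.sum_congr rfl fun j _ => Finset.sum_congr rfl fun t _ => ?_
      have e3 : ∏ i : Fin s, ((MvPolynomial.X i.castSucc :
          MvPolynomial (Fin (s + 1)) (MvPolynomial (Fin p) ℂ)) ^ j i * (-W) ^ (k' i - j i)) =
          (∏ i : Fin s, MvPolynomial.X i.castSucc ^ j i) * (-W) ^ ∑ i, (k' i - j i) := by
        rw [Finset.prod_mul_distrib, Finset.prod_pow_eq_pow_sum]
      rw [e3, monomial_eq_prod_univ, Fin.prod_univ_castSucc, mul_smul, smul_mul_assoc,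
        mul_smul_comm]
      congr 1
      simp only [Finsupp.equivFunOnFinite_symm_apply_apply, Fin.snoc_castSucc, Fin.snoc_last,
        Algebra.smul_def, map_pow, map_neg, map_one, MvPolynomial.algebraMap_eq]
      rw [neg_pow W, neg_pow W]
      ring
    have e2 : A.prod k a = ∑ j ∈ Finset.Iic k', ∑ t ∈ Finset.range T,
        -(((-1 : ℂ) ^ (t + ∑ i : Fin s, (k' i - j i) + k (Fin.last s)) *
            binom k' j * ((t.factorial : ℂ)⁻¹)) •
          (del R ^ t) (A.prod (app j (t + ∑ i : Fin s, (k' i - j i) + k (Fin.last s))) a')) := by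
      rw [A.skew_last, ← Finset.sum_neg_distrib]
      refine Finset.sum_congr rfl fun j _ => ?_
      rw [finsum_eq_sum_of_support_subset (s := Finset.range T), Finset.sum_neg_distrib]
      intro t ht
      by_contra hc
      simp only [Finset.coe_range, Set.mem_Iio, not_lt] at hc
      refine ht ?_
      have : A.prod (app j (t + ∑ i : Fin s, (k' i - j i) + k (Fin.last s))) a' = 0 := by
        by_contra hne
        have := hb hne (Fin.last s)
        simp only [app, Fin.snoc_last] at this
        omega
      simp only
      rw [this, map_zero, smul_zero]
    rw [pairing_monomial, e1, e2]
    simp only [map_sum, map_smul, map_neg, pairing_monomial, annPoly_del_pow, smul_smul,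
      Finset.sum_neg_distrib]
    congr 1
    refine Finset.sum_congr rfl fun j _ => Finset.sum_congr rfl fun t _ => ?_
    congr 1
    have : (t.factorial : ℂ) ≠ 0 := by exact_mod_cast t.factorial_ne_zero
    have h1 : (-1 : ℂ) ^ t * (-1) ^ t = 1 := by rw [← mul_pow]; simp
    have h2 := inv_mul_cancel₀ this
    rw [add_assoc, pow_add]
    generalize (-1 : ℂ) ^ (∑ i : Fin s, (k' i - j i) + k (Fin.last s)) = E
    linear_combination (binom k' j * E * (t.factorial : ℂ)⁻¹ * t.factorial) * h1 +
      binom k' j * E * h2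

theorem annBracket_annPoly_swap_last (a : Fin (s + 2) → R)
    (f : Fin (s + 2) → MvPolynomial (Fin p) ℂ) :
    annBracket p A ((fun i => annPoly p R (f i) (a i)) ∘
      Equiv.swap (Fin.last s).castSucc (Fin.last (s + 1))) =
        -annBracket p A (fun i => annPoly p R (f i) (a i)) := by
  set σ := Equiv.swap (Fin.last s).castSucc (Fin.last (s + 1)) with hσ
  have h1 := annBracket_annPoly A (a ∘ σ) (f ∘ σ)
  have h0 : (fun i => annPoly p R (f i) (a i)) ∘ σ =
      fun i => annPoly p R ((f ∘ σ) i) ((a ∘ σ) i) := rfl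
  rw [h0, h1, annBracket_annPoly A a f, pairing_skew_last A a, neg_neg]
  rw [map_prod_shift _ (MvPolynomial.X (Fin.last s)) (fun f => by simp), ← Equiv.prod_comp σ]
  have h7 : ∀ q, bracketVar (p := p) id (σ q) = MvPolynomial.eval₂Hom
      (shift (MvPolynomial.X (Fin.last s)) :
          MvPolynomial (Fin p) ℂ →ₐ[ℂ] MvPolynomial (Fin (s + 1)) (MvPolynomial (Fin p) ℂ)).toRingHom
        (app (fun i : Fin s => MvPolynomial.X i.castSucc - MvPolynomial.X (Fin.last s))
          (-MvPolynomial.X (Fin.last s))) (bracketVar id q) + MvPolynomial.X (Fin.last s) := by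
    intro q
    induction q using Fin.lastCases with
    | last => simp [bracketVar, hσ]
    | cast q =>
      induction q using Fin.lastCases with
      | last => simp [bracketVar, hσ]
      | cast q =>
        rw [hσ, Equiv.swap_apply_of_ne_of_ne]
        · simp [bracketVar]
        · simp [Fin.ext_iff]; omega
        · simp [Fin.ext_iff]; omega
  have h6 : ∀ q, (f ∘ σ) (σ q) = f q := fun q => by simp [hσ]
  simp only [h6, h7]
  rfl

end SkewSymmetry

/-! ### The Filippov identity -/

section Filippov

variable {p s : ℕ} {R : Type u} [AddCommGroup R] [Module ℂ R] [Module ℂ[X] R]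
  [IsScalarTower ℂ ℂ[X] R] (A : NLieConformalAlgebra s R)

/-- The substitution `λᵢ ↦ λᵢ + W` for `i < n`, `λₙ ↦ W` that relates the two sides of the conformal
Filippov identity; here `W` is the variable in which the inner bracket is inserted. -/
def filippovSubst (p s : ℕ) :
    MvPolynomial (Fin (s + 2) ⊕ Fin s) (MvPolynomial (Fin p) ℂ) →ₐ[MvPolynomial (Fin p) ℂ]
      MvPolynomial (Fin (s + 1) ⊕ Fin (s + 1)) (MvPolynomial (Fin p) ℂ) :=
  MvPolynomial.aeval (Sum.elim
    (app (fun i => MvPolynomial.X (Sum.inl i) + MvPolynomial.X (Sum.inr 0))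
      (MvPolynomial.X (Sum.inr 0)))
    fun j => MvPolynomial.X (Sum.inr j.succ))

theorem pairing_filippov_right (a : Fin (s + 2) → R) (b : Fin (s + 1) → R)
    (F : MvPolynomial (Fin (s + 2) ⊕ Fin s) (MvPolynomial (Fin p) ℂ)) :
    pairing (fun k => ∑ j ∈ Finset.Iic (fun i : Fin (s + 1) => k (Sum.inl i.castSucc)),
        binom (fun i : Fin (s + 1) => k (Sum.inl i.castSucc)) j •
          A.prod (pre (k (Sum.inl (Fin.last _)) +
            ∑ i : Fin (s + 1), (k (Sum.inl i.castSucc) - j i)) (k ∘ Sum.inr))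
            (pre (A.prod j a) b)) F =
      pairing (fun k : Fin (s + 1) ⊕ Fin (s + 1) → ℕ =>
          A.prod (k ∘ Sum.inr) (pre (A.prod (k ∘ Sum.inl) a) b))
        (filippovSubst p s F) := by
  induction F using MvPolynomial.induction_on' with
  | add F G hF hG => simp only [map_add, hF, hG]
  | monomial k f =>
    set k' : Fin (s + 1) → ℕ := fun i => k (Sum.inl i.castSucc) with hk'
    set W : MvPolynomial (Fin (s + 1) ⊕ Fin (s + 1)) (MvPolynomial (Fin p) ℂ) :=
      MvPolynomial.X (Sum.inr 0) with hW
    have e1 : filippovSubst p s (MvPolynomial.monomial k f) =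
        ∑ j ∈ Finset.Iic k', binom k' j • MvPolynomial.monomial (Finsupp.equivFunOnFinite.symm
          (Sum.elim j (pre (k (Sum.inl (Fin.last _)) + ∑ i : Fin (s + 1), (k' i - j i))
            (k ∘ Sum.inr)))) f := by
      rw [filippovSubst, MvPolynomial.aeval_monomial, Finsupp.prod_fintype _ _ (by simp),
        Fintype.prod_sum_type,
        Fin.prod_univ_castSucc]
      simp only [app, Fin.snoc_castSucc, Fin.snoc_last, Sum.elim_inl, Sum.elim_inr]
      have := prod_add_pow_eq_sum_Iic (fun i : Fin (s + 1) => (MvPolynomial.X (Sum.inl i) :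
        MvPolynomial (Fin (s + 1) ⊕ Fin (s + 1)) (MvPolynomial (Fin p) ℂ))) (fun _ => W) k'
      rw [this, Finset.sum_mul, Finset.sum_mul, Finset.mul_sum]
      refine Finset.sum_congr rfl fun j _ => ?_
      rw [Finset.prod_mul_distrib, Finset.prod_pow_eq_pow_sum, monomial_eq_prod_univ,
        Fintype.prod_sum_type]
      have e2 : ∀ N : ℕ, ∏ x, (MvPolynomial.X (Sum.inr x) :
          MvPolynomial (Fin (s + 1) ⊕ Fin (s + 1)) (MvPolynomial (Fin p) ℂ)) ^
            (pre N (k ∘ Sum.inr) x) =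
          W ^ N * ∏ x : Fin s, MvPolynomial.X (Sum.inr x.succ) ^ k (Sum.inr x) := by
        intro N
        rw [Fin.prod_univ_succ]
        simp [pre, hW]
      simp only [Finsupp.equivFunOnFinite_symm_apply_apply, Sum.elim_inl, Sum.elim_inr,
        smul_mul_assoc, mul_smul_comm, MvPolynomial.algebraMap_eq, e2]
      refine congrArg (fun G => binom k' j • G) ?_
      ring
    rw [e1, pairing_monomial]
    simp only [map_sum, map_smul, pairing_monomial]
    rfl

theorem prod_erase_last {S : Type*} [CommMonoid S] {n : ℕ} (F : Fin (n + 1) → S) :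
    ∏ q ∈ Finset.univ.erase (Fin.last n), F q = ∏ q : Fin n, F q.castSucc := by
  have : Finset.univ.erase (Fin.last n) = Finset.univ.map Fin.castSuccEmb := by
    ext q
    induction q using Fin.lastCases <;> simp [(Fin.castSucc_lt_last _).ne]
  rw [this, Finset.prod_map]
  rfl

theorem prod_erase_zero {S : Type*} [CommMonoid S] {n : ℕ} (F : Fin (n + 1) → S) :
    ∏ q ∈ Finset.univ.erase (0 : Fin (n + 1)), F q = ∏ q : Fin n, F q.succ := by
  have : Finset.univ.erase (0 : Fin (n + 1)) = Finset.univ.map (Fin.succEmb n) := by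
    ext q
    induction q using Fin.cases <;> simp
  rw [this, Finset.prod_map]
  rfl

/-- The product of the shifted arguments of both sides of the Filippov identity. -/
def filippovPoly (f : Fin (s + 2) → MvPolynomial (Fin p) ℂ)
    (g : Fin (s + 1) → MvPolynomial (Fin p) ℂ) :
    MvPolynomial (Fin (s + 2) ⊕ Fin s) (MvPolynomial (Fin p) ℂ) :=
  (∏ i, shift (MvPolynomial.X (Sum.inl i)) (f i)) *
    ∏ q, shift (app (fun j => MvPolynomial.X (Sum.inr j)) 0 q) (g q)

theorem filippovPoly_left (f : Fin (s + 2) → MvPolynomial (Fin p) ℂ)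
    (g : Fin (s + 1) → MvPolynomial (Fin p) ℂ) (i : Fin (s + 2)) :
    (∏ q ∈ Finset.univ.erase (Fin.last (s + 1)),
      shift (bracketVar (Sum.inl ∘ i.succAbove) q) (app (f ∘ i.succAbove) 0 q)) *
      MvPolynomial.eval₂Hom (shift (bracketVar (Sum.inl ∘ i.succAbove) (Fin.last (s + 1))) :
        MvPolynomial (Fin p) ℂ →ₐ[ℂ] _).toRingHom
        (fun j => MvPolynomial.X ((pre (Sum.inl i) Sum.inr : Fin (s + 1) → Fin (s + 2) ⊕ Fin s) j))
        (∏ q, shift (bracketVar id q) (pre (f i) g q)) = filippovPoly f g := by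
  rw [map_prod_shift _ 0 (fun f => by simp [bracketVar]), filippovPoly, prod_erase_last,
    Fin.prod_univ_succAbove (fun i => shift (MvPolynomial.X (Sum.inl i)) (f i)) i,
    Fin.prod_univ_succ (n := s + 1)]
  have h1 : ∀ q, app (f ∘ i.succAbove) 0 (Fin.castSucc q) = f (i.succAbove q) := by simp [app]
  have h2 : ∀ q, bracketVar (p := p) (Sum.inl ∘ i.succAbove : _ → Fin (s + 2) ⊕ Fin s)
      (Fin.castSucc q) = MvPolynomial.X (Sum.inl (i.succAbove q)) := by simp [bracketVar]
  have h3 : bracketVar (p := p) (id : Fin (s + 1) → _) 0 = MvPolynomial.X 0 := by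
    rw [← Fin.castSucc_zero]
    simp only [bracketVar, app, Fin.snoc_castSucc]
    rfl
  have h4 : ∀ (q : Fin (s + 1)) (w : MvPolynomial (Fin (s + 2) ⊕ Fin s) (MvPolynomial (Fin p) ℂ)),
      MvPolynomial.eval₂Hom (shift w : MvPolynomial (Fin p) ℂ →ₐ[ℂ] _).toRingHom
        (fun j => MvPolynomial.X ((pre (Sum.inl i) Sum.inr : Fin (s + 1) → Fin (s + 2) ⊕ Fin s) j))
        (bracketVar (id : Fin (s + 1) → _) q.succ) =
        app (fun j => MvPolynomial.X (Sum.inr j)) 0 q := by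
    intro q w
    induction q using Fin.lastCases with
    | last => simp [bracketVar]
    | cast q =>
      rw [← Fin.castSucc_succ]
      simp only [bracketVar, app, Fin.snoc_castSucc, id, MvPolynomial.coe_eval₂Hom,
        MvPolynomial.eval₂_X, pre, Fin.cons_succ]
  simp only [h1, h2, h3, h4, add_zero, pre, Fin.cons_zero, Fin.cons_succ, MvPolynomial.coe_eval₂Hom,
    MvPolynomial.eval₂_X]
  ring

/-- The terms of the left-hand side of the Filippov identity in `(Lie_p R)_-`, as pairings with
nested `λ`-brackets. -/
theorem filippov_left (a : Fin (s + 2) → R) (b : Fin (s + 1) → R)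
    (f : Fin (s + 2) → MvPolynomial (Fin p) ℂ) (g : Fin (s + 1) → MvPolynomial (Fin p) ℂ)
    (i : Fin (s + 2)) :
    annBracket p A (app (fun q => annPoly p R (f (i.succAbove q)) (a (i.succAbove q)))
      (annBracket p A (pre (annPoly p R (f i) (a i)) fun q => annPoly p R (g q) (b q)))) =
    pairing (fun k => A.prod (k ∘ Sum.inl ∘ i.succAbove) (app (a ∘ i.succAbove)
      (A.prod (pre (k (Sum.inl i)) (k ∘ Sum.inr)) (pre (a i) b)))) (filippovPoly f g) := by
  have h1 : (pre (annPoly p R (f i) (a i)) fun q => annPoly p R (g q) (b q)) =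
      fun q => annPoly p R (pre (f i) g q) (pre (a i) b q) := by
    funext q
    induction q using Fin.cases <;> simp [pre]
  rw [h1, annBracket_annPoly]
  have h2 : ∀ y, app (fun q => annPoly p R (f (i.succAbove q)) (a (i.succAbove q))) y =
      Function.update (fun q => annPoly p R (app (f ∘ i.succAbove) 0 q)
        (app (a ∘ i.succAbove) 0 q)) (Fin.last _) y := by
    intro y
    funext q
    induction q using Fin.lastCases <;> simp [app, (Fin.castSucc_lt_last _).ne]
  have hu : Function.Injective (Sum.inl ∘ i.succAbove : Fin (s + 1) → Fin (s + 2) ⊕ Fin s) :=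
    Sum.inl_injective.comp Fin.succAbove_right_injective
  have hw : Function.Injective (pre (Sum.inl i) Sum.inr : Fin (s + 1) → Fin (s + 2) ⊕ Fin s) := by
    rw [pre, Fin.cons_injective_iff]
    exact ⟨by rintro ⟨j, hj⟩; simp at hj, Sum.inr_injective⟩
  have hd : ∀ q j, (Sum.inl ∘ i.succAbove : Fin (s + 1) → Fin (s + 2) ⊕ Fin s) q ≠
      (pre (Sum.inl i) Sum.inr : Fin (s + 1) → Fin (s + 2) ⊕ Fin s) j := by
    intro q j
    induction j using Fin.cases with
    | zero => simp [pre]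
    | succ j => simp [pre]
  rw [h2, annBracket_update_pairing A _ _ hu hw hd]
  have h3 : ∀ k : Fin (s + 2) ⊕ Fin s → ℕ,
      k ∘ (pre (Sum.inl i) Sum.inr : Fin (s + 1) → Fin (s + 2) ⊕ Fin s) =
        pre (k (Sum.inl i)) (k ∘ Sum.inr) := by
    intro k
    funext q
    induction q using Fin.cases <;> simp [pre]
  have h4 : ∀ y, Function.update (app (a ∘ i.succAbove) 0) (Fin.last (s + 1)) y =
      app (a ∘ i.succAbove) y := by
    intro y
    funext q
    induction q using Fin.lastCases <;> simp [app, (Fin.castSucc_lt_last _).ne]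
  simp only [h3, h4]
  rw [filippovPoly_left]

theorem filippovPoly_right (f : Fin (s + 2) → MvPolynomial (Fin p) ℂ)
    (g : Fin (s + 1) → MvPolynomial (Fin p) ℂ) :
    (∏ q ∈ Finset.univ.erase (0 : Fin (s + 2)),
      shift (bracketVar (p := p) (Sum.inr : Fin (s + 1) → Fin (s + 1) ⊕ Fin (s + 1)) q) (pre 0 g q)) *
      MvPolynomial.eval₂Hom (shift (bracketVar (p := p) Sum.inr 0) : MvPolynomial (Fin p) ℂ →ₐ[ℂ] _).toRingHom
        (fun j => MvPolynomial.X (Sum.inl j)) (∏ q, shift (bracketVar id q) (f q)) =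
      filippovSubst p s (filippovPoly f g) := by
  have h0 : bracketVar (p := p) (Sum.inr : Fin (s + 1) → Fin (s + 1) ⊕ Fin (s + 1)) 0 =
      MvPolynomial.X (Sum.inr 0) := by
    rw [← Fin.castSucc_zero]
    simp only [bracketVar, app, Fin.snoc_castSucc]
  have h1 : ∀ q, (app (fun i => MvPolynomial.X (Sum.inl i) + MvPolynomial.X (Sum.inr 0))
      (MvPolynomial.X (Sum.inr 0)) :
        Fin (s + 2) → MvPolynomial (Fin (s + 1) ⊕ Fin (s + 1)) (MvPolynomial (Fin p) ℂ)) q =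
      MvPolynomial.eval₂Hom
        (shift (MvPolynomial.X (Sum.inr 0)) : MvPolynomial (Fin p) ℂ →ₐ[ℂ] _).toRingHom
        (fun j => MvPolynomial.X (Sum.inl j)) (bracketVar id q) + MvPolynomial.X (Sum.inr 0) := by
    intro q
    induction q using Fin.lastCases with
    | last => simp [bracketVar]
    | cast q => simp [bracketVar]
  have h2 : ∀ q : Fin (s + 1), bracketVar (p := p)
      (Sum.inr : Fin (s + 1) → Fin (s + 1) ⊕ Fin (s + 1)) q.succ =
      filippovSubst p s (app (fun j => MvPolynomial.X (Sum.inr j)) 0 q) := by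
    intro q
    induction q using Fin.lastCases with
    | last => simp [bracketVar, filippovSubst]
    | cast q =>
      rw [← Fin.castSucc_succ]
      simp only [bracketVar, app, Fin.snoc_castSucc, filippovSubst, MvPolynomial.aeval_X, Sum.elim_inr]
  have h3 := fun {I : Type} (S : Finset I) z (f : I → MvPolynomial (Fin p) ℂ) =>
    map_prod_shift (filippovSubst p s).toRingHom 0
      (fun f => by rw [shift_zero]; simp) S z f
  simp only [AlgHom.toRingHom_eq_coe, RingHom.coe_coe, add_zero] at h3
  rw [filippovPoly, map_mul, h3, h3, prod_erase_zero, h0,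
    map_prod_shift _ (MvPolynomial.X (Sum.inr 0)) (fun f => by simp), mul_comm]
  have h4 : ∀ q : Fin (s + 2), filippovSubst p s (MvPolynomial.X (Sum.inl q)) = _ := fun q =>
    (MvPolynomial.aeval_X _ _).trans (h1 q)
  simp only [h2, h4, pre, Fin.cons_succ]

/-- The right-hand side of the Filippov identity in `(Lie_p R)_-`, as a pairing with nested
`λ`-brackets. -/
theorem filippov_right (a : Fin (s + 2) → R) (b : Fin (s + 1) → R)
    (f : Fin (s + 2) → MvPolynomial (Fin p) ℂ) (g : Fin (s + 1) → MvPolynomial (Fin p) ℂ) :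
    annBracket p A (pre (annBracket p A fun i => annPoly p R (f i) (a i))
      fun q => annPoly p R (g q) (b q)) =
    pairing (fun k : Fin (s + 1) ⊕ Fin (s + 1) → ℕ =>
          A.prod (k ∘ Sum.inr) (pre (A.prod (k ∘ Sum.inl) a) b))
        (filippovSubst p s (filippovPoly f g)) := by
  have h2 : ∀ y, pre y (fun q => annPoly p R (g q) (b q)) =
      Function.update (fun q => annPoly p R (pre 0 g q) (pre 0 b q)) 0 y := by
    intro y
    funext q
    induction q using Fin.cases <;> simp [pre]
  have h4 : ∀ y, Function.update (pre 0 b : Fin (s + 2) → R) 0 y = pre y b := by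
    intro y
    funext q
    induction q using Fin.cases <;> simp [pre]
  rw [annBracket_annPoly, h2, annBracket_update_pairing A Sum.inr Sum.inl Sum.inr_injective
    Sum.inl_injective (fun i j => by simp)]
  simp only [h4]
  rw [filippovPoly_right]

/-- The Filippov identity for the generators of `(Lie_p R)_-`. -/
theorem filippov_annPoly (a : Fin (s + 2) → R) (b : Fin (s + 1) → R)
    (f : Fin (s + 2) → MvPolynomial (Fin p) ℂ) (g : Fin (s + 1) → MvPolynomial (Fin p) ℂ) :
    ∑ i : Fin (s + 2), (-1 : ℂ) ^ (s + 1 + (i : ℕ)) • annBracket p A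
      (app (fun q => annPoly p R (f (i.succAbove q)) (a (i.succAbove q)))
      (annBracket p A (pre (annPoly p R (f i) (a i)) fun q => annPoly p R (g q) (b q)))) =
    annBracket p A (pre (annBracket p A fun i => annPoly p R (f i) (a i))
      fun q => annPoly p R (g q) (b q)) := by
  rw [filippov_right, ← pairing_filippov_right]
  simp only [filippov_left]
  rw [← pairing_sum_smul]
  congr 2
  funext k
  exact A.filippov (k ∘ Sum.inl) (k ∘ Sum.inr) a b

end Filippov

/-! ### The annihilation algebra and its representation -/

section Annihilation

variable {p s : ℕ} {R : Type u} [AddCommGroup R] [Module ℂ R] [Module ℂ[X] R]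
  [IsScalarTower ℂ ℂ[X] R] {N : Type*} [AddCommGroup N] [Module ℂ N]
  {ι : Type*} [Fintype ι] [DecidableEq ι]

/-- Multilinear maps on `(Lie_p R)_-` are determined by their values on the elements `a_m`. -/
theorem ann_multilinear_ext {F G : MultilinearMap ℂ (fun _ : ι => annihilation p R) N}
    (h : ∀ (m : ι → Fin p → ℕ) (a : ι → R),
      F (fun i => ann (m i) (a i)) = G (fun i => ann (m i) (a i))) : F = G := by
  obtain ⟨e⟩ : Nonempty (ι ≃ Fin (Fintype.card ι)) := ⟨Fintype.equivFin ι⟩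
  have key : (F.domDomCongr e).compLinearMap (fun _ => toAnn p R) =
      (G.domDomCongr e).compLinearMap (fun _ => toAnn p R) := by
    refine poly_ext fun m a => ?_
    simp only [MultilinearMap.compLinearMap_apply, MultilinearMap.domDomCongr_apply, toAnn,
      Finsupp.lsum_single]
    exact h (m ∘ e) (a ∘ e)
  ext z
  choose w hw using fun i => toAnn_surjective p R (z i)
  have := congrArg (fun H => H (w ∘ e.symm)) key
  simp only [MultilinearMap.compLinearMap_apply, MultilinearMap.domDomCongr_apply,
    Function.comp_apply, hw] at this
  have e2 : (fun i => z (e.symm (e i))) = z := funext fun i => congrArg z (e.symm_apply_apply i)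
  rwa [e2] at this

/-- Each `a_m` has the form `a_f`, where `f = t^m`. -/
theorem exists_annPoly_eq_ann (p : ℕ) (R : Type u) [AddCommGroup R] [Module ℂ R] [Module ℂ[X] R]
    [IsScalarTower ℂ ℂ[X] R] : ∃ P : (Fin p → ℕ) → MvPolynomial (Fin p) ℂ,
      ∀ m (a : R), annPoly p R (P m) a = ann m a :=
  ⟨fun m => MvPolynomial.monomial (Finsupp.equivFunOnFinite.symm m) 1,
    fun _ a => annPoly_monomial _ a⟩

variable (A : NLieConformalAlgebra s R)

theorem annBracket_swap (x : Fin (s + 2) → annihilation p R) (i j : Fin (s + 2)) (hij : i ≠ j) :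
    annBracket p A (x ∘ Equiv.swap i j) = -annBracket p A x := by
  refine swap_of_adjacent (annBracket p A) (fun x i => ?_) x i j hij
  have key : (annBracket p A).domDomCongr (Equiv.swap i.castSucc i.succ) = -annBracket p A := by
    refine ann_multilinear_ext fun m a => ?_
    obtain ⟨P, hP⟩ := exists_annPoly_eq_ann p R
    rw [neg_apply, MultilinearMap.domDomCongr_apply]
    induction i using Fin.lastCases with
    | last =>
      have h := annBracket_annPoly_swap_last A a fun i => P (m i)
      simp only [hP] at h
      exact h
    | cast i =>
      have h := annBracket_annPoly_swap_left A i a fun i => P (m i)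
      simp only [hP] at h
      exact h
  exact congrArg (fun H => H x) key

/-- `(Lie_p R)_-` is an `n`-Lie algebra. -/
theorem annBracket_isNLieBracket : IsNLieBracket (annBracket p A) := by
  refine ⟨annBracket_swap A, fun y x => ?_⟩
  set br := annBracket p A
  -- Both sides are multilinear in `x` for fixed `y`, and multilinear in `y` for fixed `x`.
  let F₁ : (Fin (s + 1) → annihilation p R) → MultilinearMap ℂ (fun _ : Fin (s + 2) => _) _ :=
    fun y => (ad br y).compMultilinearMap br -
      ∑ i, br.compLinearMap (Function.update (fun _ => LinearMap.id) i (ad br y))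
  let F₂ : (Fin (s + 2) → annihilation p R) → MultilinearMap ℂ (fun _ : Fin (s + 1) => _) _ :=
    fun x => (LinearMap.applyₗ (br x)).compMultilinearMap (ad br) -
      ∑ i, (br.toLinearMap x i ∘ₗ LinearMap.applyₗ (x i)).compMultilinearMap (ad br)
  have h₁ : ∀ x y, F₁ y x = br (app y (br x)) -
      ∑ i, br (Function.update x i (br (app y (x i)))) := by
    intro x y
    simp only [F₁, sub_apply, sum_apply, LinearMap.compMultilinearMap_apply,
      MultilinearMap.compLinearMap_apply, ad_apply]
    congr 1
    refine Finset.sum_congr rfl fun q _ => congrArg br (funext fun i => ?_)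
    by_cases hi : i = q
    · subst hi; simp [ad_apply]
    · simp [hi]
  have h₂ : ∀ x y, F₂ x y = br (app y (br x)) -
      ∑ i, br (Function.update x i (br (app y (x i)))) := by
    intro x y
    simp [F₂, ad_apply]
  rw [← sub_eq_zero, ← h₁]
  have key : F₁ y = 0 := by
    refine ann_multilinear_ext fun m a => ?_
    rw [h₁, ← h₂]
    have key : F₂ (fun i => ann (m i) (a i)) = 0 := by
      refine ann_multilinear_ext fun l b => ?_
      rw [h₂, zero_apply, sub_eq_zero]
      refine derivation_of_filippov br (annBracket_swap A) _ _ ?_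
      obtain ⟨P, hP⟩ := exists_annPoly_eq_ann p R
      have h := filippov_annPoly A a b (fun i => P (m i)) fun i => P (l i)
      simp only [hP] at h
      exact h
    rw [key]; rfl
  rw [key]; rfl

end Annihilation

section Representation

variable {p s : ℕ} {R : Type u} [AddCommGroup R] [Module ℂ R] [Module ℂ[X] R]
  [IsScalarTower ℂ ℂ[X] R] {N : Type*} [AddCommGroup N] [Module ℂ N]

/-- Vandermonde's identity: in a sum over `j ≤ m` with binomial weights, a summand that depends only
on the sums `∑ c, j (i, c)` may be summed over these. -/
theorem sum_binom_fiber {r : ℕ} (m : Fin r × Fin p → ℕ) (g : (Fin r → ℕ) → N) :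
    ∑ j ∈ Finset.Iic m, binom m j • g (fun i => ∑ c, j (i, c)) =
      ∑ t ∈ Finset.Iic (fun i => ∑ c, m (i, c)), binom (fun i => ∑ c, m (i, c)) t • g t := by
  let Φ : MvPolynomial (Fin r) ℂ →ₗ[ℂ] N :=
    (MvPolynomial.basisMonomials (Fin r) ℂ).constr ℂ fun k => g k
  have hΦ : ∀ t : Fin r → ℕ, Φ (∏ i, MvPolynomial.X i ^ t i) = g t := by
    intro t
    have h1 := (MvPolynomial.basisMonomials (Fin r) ℂ).constr_basis ℂ (fun k => g k)
      (Finsupp.equivFunOnFinite.symm t)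
    rw [MvPolynomial.coe_basisMonomials] at h1
    have h2 := monomial_eq_prod_univ (Finsupp.equivFunOnFinite.symm t) (1 : ℂ)
    rw [MvPolynomial.C_1, one_mul] at h2
    simp only [Finsupp.equivFunOnFinite_symm_apply_apply] at h2
    rw [← h2]
    exact h1
  have h1 := prod_add_pow_eq_sum_Iic
    (fun x : Fin r × Fin p => (MvPolynomial.X x.1 : MvPolynomial (Fin r) ℂ)) (fun _ => 1) m
  have h2 := prod_add_pow_eq_sum_Iic
    (fun i : Fin r => (MvPolynomial.X i : MvPolynomial (Fin r) ℂ)) (fun _ => 1)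
    (fun i => ∑ c, m (i, c))
  have h3 : ∏ x : Fin r × Fin p, ((MvPolynomial.X x.1 : MvPolynomial (Fin r) ℂ) + 1) ^ m x =
      ∏ i, (MvPolynomial.X i + 1) ^ ∑ c, m (i, c) := by
    simp only [Fintype.prod_prod_type, Finset.prod_pow_eq_pow_sum]
  rw [h1, h2] at h3
  have h4 := congrArg Φ h3
  simp only [one_pow, mul_one, map_sum, map_smul, Fintype.prod_prod_type,
    Finset.prod_pow_eq_pow_sum, hΦ] at h4
  exact h4

variable (A : NLieConformalAlgebra s R)

/-- A linear map that depends only on the total exponents transforms the bracket of `(Lie_p R)_-`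
into the bracket with `p = 1`. -/
theorem map_annBracket (Λ : annihilation p R →ₗ[ℂ] N) (Ψ : ℕ → R → N)
    (hΛ : ∀ (e : Fin p → ℕ) b, Λ (ann e b) = Ψ (∑ c, e c) b) (m : Fin (s + 2) → Fin p → ℕ)
    (a : Fin (s + 2) → R) :
    Λ (annBracket p A fun i => ann (m i) (a i)) =
      ∑ j ∈ Finset.Iic (fun i : Fin (s + 1) => ∑ c, m i.castSucc c),
        binom (fun i : Fin (s + 1) => ∑ c, m i.castSucc c) j •
          Ψ (∑ c, m (Fin.last _) c + ∑ i : Fin (s + 1), (∑ c, m i.castSucc c - j i))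
            (A.prod j a) := by
  have h := sum_binom_fiber (N := N) (fun x : Fin (s + 1) × Fin p => m x.1.castSucc x.2)
    fun j : Fin (s + 1) → ℕ =>
      Ψ (∑ c, m (Fin.last _) c + ∑ i : Fin (s + 1), (∑ c, m i.castSucc c - j i)) (A.prod j a)
  rw [annBracket_ann, map_sum, ← h]
  refine Finset.sum_congr rfl fun j hj => ?_
  have e : ∑ c, (m (Fin.last _) c + ∑ i : Fin (s + 1), (m i.castSucc c - j (i, c))) =
      ∑ c, m (Fin.last _) c + ∑ i : Fin (s + 1), (∑ c, m i.castSucc c - ∑ c, j (i, c)) := by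
    rw [Finset.sum_add_distrib, Finset.sum_comm]
    refine congrArg _ (Finset.sum_congr rfl fun i _ => ?_)
    exact Finset.sum_tsub_distrib Finset.univ (f := fun c => m i.castSucc c)
      (g := fun c => j (i, c)) fun c _ => Finset.mem_Iic.1 hj (i, c)
  rw [map_smul, hΛ, e]

/-- The form of `map_annBracket` for `[X, y]`, where `X` is a tuple of length `n - 1`. -/
theorem map_annBracket_app (Λ : annihilation p R →ₗ[ℂ] N) (Ψ : ℕ → R → N)
    (hΛ : ∀ (e : Fin p → ℕ) b, Λ (ann e b) = Ψ (∑ c, e c) b) (m : Fin (s + 1) → Fin p → ℕ)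
    (a : Fin (s + 1) → R) (m' : Fin p → ℕ) (a' : R) :
    Λ (annBracket p A (app (fun i => ann (m i) (a i)) (ann m' a'))) =
      ∑ j ∈ Finset.Iic (fun i => ∑ c, m i c), binom (fun i => ∑ c, m i c) j •
          Ψ (∑ c, m' c + ∑ i, (∑ c, m i c - j i)) (A.prod j (app a a')) := by
  have e : app (fun i => ann (m i) (a i)) (ann m' a') =
      fun i => ann (app m m' i) (app a a' i) := by
    funext i
    induction i using Fin.lastCases <;> simp [app]
  rw [e, map_annBracket A Λ Ψ hΛ]
  simp only [app, Fin.snoc_castSucc, Fin.snoc_last]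

variable {A}
variable {M : Type v} [AddCommGroup M] [Module ℂ M] [Module ℂ[X] M] [IsScalarTower ℂ ℂ[X] M]
variable (V : ConformalRep A M)

theorem update_ann {α : Type*} [DecidableEq α] (m : α → Fin p → ℕ) (a : α → R) (i : α)
    (e : Fin p → ℕ) (b : R) :
    Function.update (fun i => ann (m i) (a i)) i (ann e b) =
      fun j => ann (Function.update m i e j) (Function.update a i b j) := by
  funext j
  by_cases hj : j = i
  · subst hj; simp
  · simp [hj]

theorem sum_update {α : Type*} [DecidableEq α] (m : α → Fin p → ℕ) (i : α) (e : Fin p → ℕ) :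
    (fun j => ∑ c, Function.update m i e j c) =
      Function.update (fun j => ∑ c, m j c) i (∑ c, e c) := by
  funext j
  by_cases hj : j = i
  · subst hj; simp
  · simp [hj]

theorem annAction_swap (x : Fin (s + 1) → annihilation p R) (i j : Fin (s + 1)) (hij : i ≠ j) :
    annAction p V (x ∘ Equiv.swap i j) = -annAction p V x := by
  refine swap_of_adjacent (annAction p V) (fun x i => ?_) x i j hij
  have key : (annAction p V).domDomCongr (Equiv.swap i.castSucc i.succ) = -annAction p V := by
    refine ann_multilinear_ext fun m a => ?_
    have h1 := annAction_ann p V (m ∘ Equiv.swap i.castSucc i.succ)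
      (a ∘ Equiv.swap i.castSucc i.succ)
    rw [neg_apply, annAction_ann]
    refine h1.trans (LinearMap.ext fun v => ?_)
    exact V.skew (fun i => ∑ c, m i c) a i v
  exact congrArg (fun H => H x) key

theorem annAction_commutator_ann (m l : Fin (s + 1) → Fin p → ℕ) (a b : Fin (s + 1) → R) :
    annAction p V (fun i => ann (m i) (a i)) ∘ₗ annAction p V (fun i => ann (l i) (b i)) -
      annAction p V (fun i => ann (l i) (b i)) ∘ₗ annAction p V (fun i => ann (m i) (a i)) =
    ∑ i, annAction p V (Function.update (fun i => ann (l i) (b i)) i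
      (annBracket p A (app (fun i => ann (m i) (a i)) (ann (l i) (b i))))) := by
  ext v
  have h1 := V.commutator (fun i => ∑ c, m i c) (fun i => ∑ c, l i c) a b v
  simp only [LinearMap.sub_apply, LinearMap.comp_apply, annAction_ann, LinearMap.sum_apply, h1]
  refine Finset.sum_congr rfl fun i _ => ?_
  have h2 := map_annBracket_app A (LinearMap.applyₗ v ∘ₗ
    (annAction p V).toLinearMap (fun i => ann (l i) (b i)) i)
    (fun e c => V.act (Function.update (fun i => ∑ c, l i c) i e) (Function.update b i c) v)
    (by
      intro e c
      simp only [LinearMap.comp_apply, MultilinearMap.toLinearMap_apply, update_ann, annAction_ann,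
        sum_update]
      rfl) m a (l i) (b i)
  exact h2.symm

theorem annAction_filippov_ann (m : Fin (s + 2) → Fin p → ℕ) (l : Fin s → Fin p → ℕ)
    (a : Fin (s + 2) → R) (b : Fin s → R) :
    annAction p V (pre (annBracket p A fun i => ann (m i) (a i)) fun i => ann (l i) (b i)) =
      ∑ i : Fin (s + 2), (-1 : ℂ) ^ (s + 1 + (i : ℕ)) •
        (annAction p V ((fun i => ann (m i) (a i)) ∘ i.succAbove) ∘ₗ
          annAction p V (pre (ann (m i) (a i)) fun i => ann (l i) (b i))) := by
  have e : ∀ n c, (pre (ann n c) fun i => ann (l i) (b i)) =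
      fun i => ann ((pre n l : Fin (s + 1) → Fin p → ℕ) i) (pre c b i) := by
    intro n c
    funext i
    induction i using Fin.cases <;> simp [pre]
  have e2 : ∀ n, (fun i => ∑ c, (pre n l : Fin (s + 1) → Fin p → ℕ) i c) =
      pre (∑ c, n c) fun i => ∑ c, l i c := by
    intro n
    funext i
    induction i using Fin.cases <;> simp [pre]
  ext v
  have h1 := V.filippov (fun i => ∑ c, m i c) (fun i => ∑ c, l i c) a b v
  have h2 := map_annBracket A (LinearMap.applyₗ v ∘ₗ
    (annAction p V).toLinearMap (pre 0 fun i => ann (l i) (b i)) 0)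
    (fun e c => V.act (pre e (fun i => ∑ c, l i c)) (pre c b) v)
    (by
      intro n c
      have : annAction p V (pre (ann n c) fun i => ann (l i) (b i)) v =
        V.act (pre (∑ c, n c) (fun i => ∑ c, l i c)) (pre c b) v := by
        rw [e, annAction_ann, e2]
      rw [LinearMap.comp_apply, MultilinearMap.toLinearMap_apply, Fin.update_cons_zero]
      exact this) m a
  rw [LinearMap.comp_apply, MultilinearMap.toLinearMap_apply, Fin.update_cons_zero] at h2
  refine (h2.trans h1.symm).trans ?_
  simp only [LinearMap.sum_apply, LinearMap.smul_apply, LinearMap.comp_apply]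
  refine Finset.sum_congr rfl fun i _ => ?_
  have h3 := annAction_ann p V (m ∘ i.succAbove) (a ∘ i.succAbove)
  have h4 : annAction p V ((fun i => ann (m i) (a i)) ∘ i.succAbove) = _ := h3
  rw [h4, e, annAction_ann, e2]
  rfl

/-- `M` is a representation of `(Lie_p R)_-`. -/
theorem annAction_isNLieRep : IsNLieRep (annBracket p A) (annAction p V) := by
  set br := annBracket p A
  set ρ := annAction p V
  refine ⟨annAction_swap V, fun x y => ?_, fun x y => ?_⟩
  · -- Both sides are multilinear in `x` for fixed `y`, and in `y` for fixed `x`.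
    let F₁ : (Fin (s + 1) → annihilation p R) →
        MultilinearMap ℂ (fun _ : Fin (s + 1) => annihilation p R) (M →ₗ[ℂ] M) := fun y =>
      (LinearMap.lcomp ℂ M (ρ y)).compMultilinearMap ρ -
        (LinearMap.llcomp ℂ M M M (ρ y)).compMultilinearMap ρ -
        ∑ i, (ρ.toLinearMap y i ∘ₗ LinearMap.applyₗ (y i)).compMultilinearMap (ad br)
    let F₂ : (Fin (s + 1) → annihilation p R) →
        MultilinearMap ℂ (fun _ : Fin (s + 1) => annihilation p R) (M →ₗ[ℂ] M) := fun x =>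
      (LinearMap.llcomp ℂ M M M (ρ x)).compMultilinearMap ρ -
        (LinearMap.lcomp ℂ M (ρ x)).compMultilinearMap ρ -
        ∑ i, ρ.compLinearMap (Function.update (fun _ => LinearMap.id) i (ad br x))
    have h₁ : ∀ x y, F₁ y x = ρ x ∘ₗ ρ y - ρ y ∘ₗ ρ x -
        ∑ i, ρ (Function.update y i (br (app x (y i)))) := by
      intro x y
      simp only [F₁, sub_apply, sum_apply, LinearMap.compMultilinearMap_apply, LinearMap.comp_apply,
        MultilinearMap.toLinearMap_apply, LinearMap.applyₗ_apply_apply, ad_apply]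
      rfl
    have h₂ : ∀ x y, F₂ x y = ρ x ∘ₗ ρ y - ρ y ∘ₗ ρ x -
        ∑ i, ρ (Function.update y i (br (app x (y i)))) := by
      intro x y
      simp only [F₂, sub_apply, sum_apply, LinearMap.compMultilinearMap_apply,
        MultilinearMap.compLinearMap_apply]
      refine congrArg₂ (· - ·) rfl (Finset.sum_congr rfl fun q _ => congrArg ρ (funext fun i => ?_))
      by_cases hi : i = q
      · subst hi; simp [ad_apply]
      · simp [hi]
    rw [← sub_eq_zero, ← h₁]
    have key : F₁ y = 0 := by
      refine ann_multilinear_ext fun m a => ?_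
      rw [h₁, ← h₂]
      have key : F₂ (fun i => ann (m i) (a i)) = 0 := by
        refine ann_multilinear_ext fun l b => ?_
        rw [h₂, zero_apply, sub_eq_zero]
        exact annAction_commutator_ann V m l a b
      rw [key]; rfl
    rw [key]; rfl
  · let g : (Fin s → annihilation p R) → annihilation p R →ₗ[ℂ]
        MultilinearMap ℂ (fun _ : Fin (s + 1) => annihilation p R) (M →ₗ[ℂ] M) := fun y =>
      { toFun := fun z => (LinearMap.lcomp ℂ M (ρ (pre z y))).compMultilinearMap ρ
        map_add' := fun z z' => by
          ext1 w
          simp only [pre, LinearMap.compMultilinearMap_apply, MultilinearMap.cons_add, add_apply,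
            LinearMap.lcomp_apply', LinearMap.comp_add]
        map_smul' := fun c z => by
          ext1 w
          simp only [pre, LinearMap.compMultilinearMap_apply, MultilinearMap.cons_smul, smul_apply,
            LinearMap.lcomp_apply', LinearMap.comp_smul, RingHom.id_apply] }
    let F₁ : (Fin s → annihilation p R) →
        MultilinearMap ℂ (fun _ : Fin (s + 2) => annihilation p R) (M →ₗ[ℂ] M) := fun y =>
      (ρ.toLinearMap (pre 0 y) 0).compMultilinearMap br -
        ∑ i : Fin (s + 2), (-1 : ℂ) ^ (s + 1 + (i : ℕ)) • LinearMap.uncurryMid i (g y)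
    let F₂ : (Fin (s + 2) → annihilation p R) →
        MultilinearMap ℂ (fun _ : Fin s => annihilation p R) (M →ₗ[ℂ] M) := fun x =>
      ρ.curryLeft (br x) - ∑ i : Fin (s + 2), (-1 : ℂ) ^ (s + 1 + (i : ℕ)) •
        (LinearMap.llcomp ℂ M M M (ρ (x ∘ i.succAbove))).compMultilinearMap (ρ.curryLeft (x i))
    have h₁ : ∀ x y, F₁ y x = ρ (pre (br x) y) - ∑ i : Fin (s + 2), (-1 : ℂ) ^ (s + 1 + (i : ℕ)) •
        (ρ (x ∘ i.succAbove) ∘ₗ ρ (pre (x i) y)) := by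
      intro x y
      simp only [F₁, sub_apply, sum_apply, smul_apply, LinearMap.compMultilinearMap_apply,
        MultilinearMap.toLinearMap_apply, Fin.update_cons_zero]
      rfl
    have h₂ : ∀ x y, F₂ x y = ρ (pre (br x) y) - ∑ i : Fin (s + 2), (-1 : ℂ) ^ (s + 1 + (i : ℕ)) •
        (ρ (x ∘ i.succAbove) ∘ₗ ρ (pre (x i) y)) := by
      intro x y
      simp only [F₂, sub_apply, sum_apply, smul_apply, LinearMap.compMultilinearMap_apply]
      rfl
    rw [← sub_eq_zero, ← h₁]
    have key : F₁ y = 0 := by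
      refine ann_multilinear_ext fun m a => ?_
      rw [h₁, ← h₂]
      have key : F₂ (fun i => ann (m i) (a i)) = 0 := by
        refine ann_multilinear_ext fun l b => ?_
        rw [h₂, zero_apply, sub_eq_zero]
        exact annAction_filippov_ann V m l a b
      rw [key]; rfl
    rw [key]; rfl

end Representation

/-! ### Basic cochains and local cochains -/

section Basic

variable {s k : ℕ} {R : Type u} [AddCommGroup R] [Module ℂ R] [Module ℂ[X] R]
  [IsScalarTower ℂ ℂ[X] R]
variable {M : Type v} [AddCommGroup M] [Module ℂ M] [Module ℂ[X] M] [IsScalarTower ℂ ℂ[X] M]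

theorem flat_injective {α : Type*} {r : ℕ} :
    Function.Injective fun m : (Fin k → Fin r → α) × α => flat m.1 m.2 := by
  rintro ⟨m, m'⟩ ⟨l, l'⟩ h
  refine Prod.ext (funext fun i => funext fun j => congrFun h (some (i, j))) (congrFun h none)

/-- Finiteness of a set of exponents may be checked on the joint tuples. -/
theorem finite_flat_iff {α : Type*} {r : ℕ} {P : (Option (Fin k × Fin r) → α) → Prop} :
    {m : (Fin k → Fin r → α) × α | P (flat m.1 m.2)}.Finite ↔ {n | P n}.Finite := by
  refine ⟨fun h => (h.image fun m => flat m.1 m.2).subset fun n hn => ?_,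
    fun h => h.preimage flat_injective.injOn⟩
  refine ⟨(fun i j => n (some (i, j)), n none), ?_, flat_unflat n⟩
  simpa only [Set.mem_ofPred_eq, flat_unflat] using hn

theorem lowerAt_flat_some {r : ℕ} (m : Fin k → Fin r → ℕ) (m' : ℕ) (i : Fin k) (j : Fin r) :
    flat (setEntry m i j (m i j - 1)) m' = lowerAt (flat m m') (some (i, j)) :=
  flat_setEntry _ _ _ _ _

theorem lowerAt_flat_none {r : ℕ} (m : Fin k → Fin r → ℕ) (m' : ℕ) :
    flat m (m' - 1) = lowerAt (flat m m') none :=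
  flat_last _ _ _

/-- Basic cochains in terms of the joint tuples of exponents and of arguments. -/
theorem mem_basicCochain_iff {γ : CoeffFamily s R M k} : γ ∈ basicCochain s R M k ↔
    ∃ G : (Option (Fin k × Fin (s + 1)) → ℕ) →
        MultilinearMap ℂ (fun _ : Option (Fin k × Fin (s + 1)) => R) M,
      (∀ m m' a a', γ m m' a a' = G (flat m m') (flat a a')) ∧
      (∀ z, {n | G n z ≠ 0}.Finite) ∧
      (∀ n z q, G n (Function.update z q (del R (z q))) = -(n q : ℂ) • G (lowerAt n q) z) ∧
      ∀ σ ∈ rowSwaps k (s + 1), ∀ n z, G (n ∘ σ) (z ∘ σ) = -G n z := by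
  constructor
  · rintro ⟨h1, h2, h3, h4, h5, h6, h7⟩
    choose G hG using fun n : Option (Fin k × Fin (s + 1)) → ℕ => exists_multilinear
      (γ := γ (fun i j => n (some (i, j))) (n none)) (h1 _ _) (h2 _ _)
    have hG' : ∀ m m' a a', γ m m' a a' = G (flat m m') (flat a a') :=
      fun m m' a a' => hG (flat m m') a a'
    refine ⟨G, hG', fun z => ?_, fun n z q => ?_, ?_⟩
    · rw [← finite_flat_iff]
      rw [← flat_unflat z]
      simp only [← hG']
      exact h3 _ _
    · rw [← flat_unflat z, ← flat_unflat n]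
      rcases q with _ | ⟨i, j⟩
      · rw [← flat_last, ← lowerAt_flat_none, ← hG', ← hG']
        exact h5 _ _ _ _
      · rw [← flat_setEntry, ← lowerAt_flat_some, ← hG', ← hG']
        exact h4 _ _ _ _ _ _
    · rintro σ (⟨i, j, j', hj, rfl⟩ | ⟨i, j, hi, rfl⟩) n z
      · rw [← flat_unflat z, ← flat_unflat n, ← flat_swapEntries, ← flat_swapEntries, ← hG', ← hG']
        exact h6 _ _ _ _ i j j' hj
      · rw [← flat_unflat z, ← flat_unflat n, ← flat_exchange, ← flat_exchange, ← hG', ← hG']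
        exact h7 _ _ _ _ i j hi
  · rintro ⟨G, hG, hf, hd, hs⟩
    refine ⟨fun m m' a a' i j => ?_, fun m m' a => ?_, fun a a' => ?_, ?_, ?_, ?_, ?_⟩
    · simp only [hG, flat_setEntry]
      exact ((G _).toLinearMap _ _).isLinear
    · have : γ m m' a = fun y => G (flat m m') (Function.update (flat a 0) none y) := by
        funext y
        rw [hG, ← flat_last]
      rw [this]
      exact ((G _).toLinearMap _ _).isLinear
    · simp only [hG]
      exact finite_flat_iff.2 (hf (flat a a'))
    · intro m m' a a' i j
      rw [hG, hG, flat_setEntry, lowerAt_flat_some]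
      exact hd (flat m m') (flat a a') (some (i, j))
    · intro m m' a a'
      rw [hG, hG, flat_last a a', lowerAt_flat_none]
      exact hd (flat m m') (flat a a') none
    · intro m m' a a' i j j' hj
      rw [hG, hG, flat_swapEntries, flat_swapEntries, hs _ (Or.inl ⟨i, j, j', hj, rfl⟩)]
    · intro m m' a a' i j hi
      rw [hG, hG, flat_exchange, flat_exchange, hs _ (Or.inr ⟨i, j, hi, rfl⟩)]

variable {p : ℕ}

theorem flat_ann (m : Fin k → Fin (s + 1) → Fin p → ℕ) (m' : Fin p → ℕ)
    (a : Fin k → Fin (s + 1) → R) (a' : R) :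
    flat (fun i j => ann (m i j) (a i j)) (ann m' a') =
      fun q => ann (flat m m' q) (flat a a' q) := by
  funext q
  cases q <;> rfl

theorem flat_sum (m : Fin k → Fin (s + 1) → Fin p → ℕ) (m' : Fin p → ℕ) :
    flat (fun i j => ∑ c, m i j c) (∑ c, m' c) = fun q => ∑ c, flat m m' q c := by
  funext q
  cases q <;> rfl

/-- Cochains of `(Lie_p R)_-` are determined by their values on the elements `a_m`. -/
theorem nLieCochain_ext {γ δ : Family s (annihilation p R) M k}
    (hγ : γ ∈ nLieCochain s (annihilation p R) M k) (hδ : δ ∈ nLieCochain s (annihilation p R) M k)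
    (h : ∀ (m : Fin k → Fin (s + 1) → Fin p → ℕ) (m' : Fin p → ℕ) (a : Fin k → Fin (s + 1) → R)
      (a' : R), γ (fun i j => ann (m i j) (a i j)) (ann m' a') =
        δ (fun i j => ann (m i j) (a i j)) (ann m' a')) : γ = δ := by
  obtain ⟨G, hG, -⟩ := mem_nLieCochain_iff.1 hγ
  obtain ⟨H, hH, -⟩ := mem_nLieCochain_iff.1 hδ
  have : G = H := by
    refine ann_multilinear_ext fun n z => ?_
    have h1 := h (fun i j => n (some (i, j))) (n none) (fun i j => z (some (i, j))) (z none)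
    rw [hG, hH, flat_ann] at h1
    simpa only [flat_unflat] using h1
  funext x x'
  rw [hG, hH, this]

theorem sum_lowerAt (m : Fin p → ℕ) (c : Fin p) (h : m c ≠ 0) :
    ∑ c', lowerAt m c c' = ∑ c', m c' - 1 := by
  rw [lowerAt, Finset.sum_update_of_mem (Finset.mem_univ c), Finset.sdiff_singleton_eq_erase]
  have := Finset.add_sum_erase Finset.univ m (Finset.mem_univ c)
  omega

/-- A family of multilinear maps on `R` that has the conformal antilinearity lifts to
`(Lie_p R)_-`. -/
theorem exists_ann_lift {ι : Type*} [Fintype ι] [DecidableEq ι]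
    (G : (ι → ℕ) → MultilinearMap ℂ (fun _ : ι => R) M)
    (hG : ∀ n z q, G n (Function.update z q (del R (z q))) = -(n q : ℂ) • G (lowerAt n q) z) :
    ∃ H : MultilinearMap ℂ (fun _ : ι => annihilation p R) M, ∀ (m : ι → Fin p → ℕ) (a : ι → R),
      H (fun q => ann (m q) (a q)) = G (fun q => ∑ c, m q c) a := by
  obtain ⟨e⟩ : Nonempty (ι ≃ Fin (Fintype.card ι)) := ⟨Fintype.equivFin ι⟩
  have hc : Compatible fun m : Fin (Fintype.card ι) → Fin p → ℕ =>
      (G fun q => ∑ c, m (e q) c).domDomCongr e := by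
    intro m a i
    have h1 := hG (fun q => ∑ c, m (e q) c) (a ∘ e) (e.symm i)
    have h2 : ∀ b, (fun q => Function.update a i b (e q)) =
        Function.update (a ∘ e) (e.symm i) b := by
      intro b
      exact Function.update_comp_equiv a e i b
    simp only [MultilinearMap.domDomCongr_apply, h2]
    simp only [Function.comp_apply, Equiv.apply_symm_apply] at h1
    rw [h1, Nat.cast_sum, ← Finset.sum_neg_distrib, Finset.sum_smul, ← Finset.sum_add_distrib]
    refine Finset.sum_eq_zero fun c _ => ?_
    rcases Nat.eq_zero_or_pos (m i c) with h | h
    · simp [h]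
    · have h3 : (fun q => ∑ c', Function.update m i (lowerAt (m i) c) (e q) c') =
          lowerAt (fun q => ∑ c', m (e q) c') (e.symm i) := by
        have := sum_update m i (lowerAt (m i) c)
        rw [sum_lowerAt _ _ h.ne'] at this
        have h4 := congrArg (fun f => f ∘ e) this
        simp only [Function.update_comp_equiv] at h4
        refine Eq.trans h4 ?_
        simp [lowerAt, Function.comp_def]
      rw [h3, neg_smul]
      exact neg_add_cancel _
  refine ⟨(annLift _ hc).domDomCongr e.symm, fun m a => ?_⟩
  have h1 := annLift_ann _ hc (m ∘ e.symm) (a ∘ e.symm)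
  rw [MultilinearMap.domDomCongr_apply]
  refine h1.trans ?_
  simp [MultilinearMap.domDomCongr_apply]

/-- All exponents are at most `N`. -/
def ExpBounded (N : ℕ) (m : Fin k → Fin (s + 1) → Fin p → ℕ) (m' : Fin p → ℕ) : Prop :=
  (∀ i j c, m i j c ≤ N) ∧ ∀ c, m' c ≤ N

theorem ExpBounded.mono {N N' : ℕ} (h : N ≤ N') {m : Fin k → Fin (s + 1) → Fin p → ℕ}
    {m' : Fin p → ℕ} (hm : ExpBounded N m m') : ExpBounded N' m m' :=
  ⟨fun i j c => (hm.1 i j c).trans h, fun c => (hm.2 c).trans h⟩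

/-- A function of exponents that vanishes outside a bounded region. -/
def BoundedSupport (f : (Fin k → Fin (s + 1) → Fin p → ℕ) → (Fin p → ℕ) → M) : Prop :=
  ∃ N, ∀ m m', f m m' ≠ 0 → ExpBounded N m m'

theorem finite_iff_boundedSupport (f : (Fin k → Fin (s + 1) → Fin p → ℕ) → (Fin p → ℕ) → M) :
    {m : (Fin k → Fin (s + 1) → Fin p → ℕ) × (Fin p → ℕ) | f m.1 m.2 ≠ 0}.Finite ↔
      BoundedSupport f := by
  constructor
  · intro h
    obtain ⟨B, hB⟩ := h.bddAbove
    refine ⟨(∑ i, ∑ j, ∑ c, B.1 i j c) + ∑ c, B.2 c, fun m m' hm => ?_⟩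
    have h1 := hB (show (m, m') ∈ _ from hm)
    refine ⟨fun i j c => ?_, fun c => ?_⟩
    · have h2 : m i j c ≤ B.1 i j c := h1.1 i j c
      have h3 := Finset.single_le_sum_of_canonicallyOrdered (f := fun c => B.1 i j c)
        (Finset.mem_univ c)
      have h4 := Finset.single_le_sum_of_canonicallyOrdered (f := fun j => ∑ c, B.1 i j c)
        (Finset.mem_univ j)
      have h5 := Finset.single_le_sum_of_canonicallyOrdered (f := fun i => ∑ j, ∑ c, B.1 i j c)
        (Finset.mem_univ i)
      omega
    · have h2 : m' c ≤ B.2 c := h1.2 c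
      have h3 := Finset.single_le_sum_of_canonicallyOrdered (f := fun c => B.2 c)
        (Finset.mem_univ c)
      omega
  · rintro ⟨N, hN⟩
    refine ((Set.finite_Iic (fun (_ : Fin k) (_ : Fin (s + 1)) (_ : Fin p) => N)).prod
      (Set.finite_Iic fun _ : Fin p => N)).subset fun m hm => ?_
    exact ⟨(hN _ _ hm).1, (hN _ _ hm).2⟩

theorem BoundedSupport.sum {α : Type*} (S : Finset α)
    {f : α → (Fin k → Fin (s + 1) → Fin p → ℕ) → (Fin p → ℕ) → M}
    (h : ∀ x ∈ S, BoundedSupport (f x)) : BoundedSupport fun m m' => ∑ x ∈ S, f x m m' := by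
  choose! N hN using h
  refine ⟨S.sup N, fun m m' hm => ?_⟩
  obtain ⟨x, hx, h0⟩ := Finset.exists_ne_zero_of_sum_ne_zero hm
  exact (hN x hx m m' h0).mono (Finset.le_sup hx)

theorem BoundedSupport.map {f : (Fin k → Fin (s + 1) → Fin p → ℕ) → (Fin p → ℕ) → M}
    (h : BoundedSupport f) (F : M →ₗ[ℂ] M) : BoundedSupport fun m m' => F (f m m') := by
  obtain ⟨N, hN⟩ := h
  exact ⟨N, fun m m' hm => hN m m' fun h0 => hm (by simp only [h0, map_zero])⟩

theorem BoundedSupport.smul {f : (Fin k → Fin (s + 1) → Fin p → ℕ) → (Fin p → ℕ) → M}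
    (h : BoundedSupport f) (c : ℂ) : BoundedSupport fun m m' => c • f m m' :=
  h.map (c • LinearMap.id)

theorem BoundedSupport.add {f g : (Fin k → Fin (s + 1) → Fin p → ℕ) → (Fin p → ℕ) → M}
    (hf : BoundedSupport f) (hg : BoundedSupport g) :
    BoundedSupport fun m m' => f m m' + g m m' := by
  obtain ⟨N, hN⟩ := hf
  obtain ⟨N', hN'⟩ := hg
  refine ⟨max N N', fun m m' hm => ?_⟩
  by_cases h0 : f m m' = 0
  · exact (hN' m m' fun h1 => hm (by simp only [h0, h1, add_zero])).mono (le_max_right _ _)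
  · exact (hN m m' h0).mono (le_max_left _ _)

theorem BoundedSupport.sub {f g : (Fin k → Fin (s + 1) → Fin p → ℕ) → (Fin p → ℕ) → M}
    (hf : BoundedSupport f) (hg : BoundedSupport g) :
    BoundedSupport fun m m' => f m m' - g m m' := by
  simpa only [neg_smul, one_smul, ← sub_eq_add_neg] using hf.add (hg.smul (-1))

theorem mem_localCochain_iff {γ : Family s (annihilation p R) M k} :
    γ ∈ localCochain p R s M k ↔ γ ∈ nLieCochain s (annihilation p R) M k ∧
      ∀ (a : Fin k → Fin (s + 1) → R) (a' : R),
        BoundedSupport fun (m : Fin k → Fin (s + 1) → Fin p → ℕ) (m' : Fin p → ℕ) =>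
          γ (fun i j => ann (m i j) (a i j)) (ann m' a') := by
  refine and_congr Iff.rfl (forall_congr' fun a => forall_congr' fun a' => ?_)
  exact finite_iff_boundedSupport fun m m' => γ (fun i j => ann (m i j) (a i j)) (ann m' a')

variable (p) in
/-- Every basic cochain is induced by a local cochain of `(Lie_p R)_-`. -/
theorem exists_lift {γ : CoeffFamily s R M k} (hγ : γ ∈ basicCochain s R M k) :
    ∃ δ ∈ localCochain p R s M k, ∀ (m : Fin k → Fin (s + 1) → Fin p → ℕ) (m' : Fin p → ℕ)
      (a : Fin k → Fin (s + 1) → R) (a' : R), δ (fun i j => ann (m i j) (a i j)) (ann m' a') =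
        γ (fun i j => ∑ c, m i j c) (∑ c, m' c) a a' := by
  obtain ⟨G, hG, hf, hd, hs⟩ := mem_basicCochain_iff.1 hγ
  obtain ⟨H, hH⟩ := exists_ann_lift (p := p) G hd
  have hval : ∀ (m : Fin k → Fin (s + 1) → Fin p → ℕ) (m' : Fin p → ℕ)
      (a : Fin k → Fin (s + 1) → R) (a' : R),
      H (flat (fun i j => ann (m i j) (a i j)) (ann m' a')) =
        γ (fun i j => ∑ c, m i j c) (∑ c, m' c) a a' := by
    intro m m' a a'
    rw [flat_ann, hH, hG, flat_sum]
  refine ⟨fun x x' => H (flat x x'), mem_localCochain_iff.2 ⟨mem_nLieCochain_iff.2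
    ⟨H, fun x x' => rfl, fun σ hσ => ?_⟩, fun a a' => ?_⟩, hval⟩
  · have : H.domDomCongr σ = -H := by
      refine ann_multilinear_ext fun m a => ?_
      have h1 := hH (m ∘ σ) (a ∘ σ)
      rw [neg_apply, hH, ← hs σ hσ]
      exact h1
    exact fun z => congrArg (fun F => F z) this
  · have h1 := (finite_iff_boundedSupport (p := 1) fun m m' =>
      γ (fun i j => m i j 0) (m' 0) a a').1 (by
        have h2 := (hf (flat a a'))
        rw [← finite_flat_iff] at h2
        refine (h2.image fun m => ((fun i j _ => m.1 i j, fun _ => m.2) :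
          (Fin k → Fin (s + 1) → Fin 1 → ℕ) × (Fin 1 → ℕ))).subset fun m hm => ?_
        refine ⟨(fun i j => m.1 i j 0, m.2 0), ?_, ?_⟩
        · simp only [Set.mem_ofPred_eq, ← hG]
          exact hm
        · refine Prod.ext (funext fun i => funext fun j => funext fun c => ?_)
            (funext fun c => ?_) <;> rw [Subsingleton.elim c 0])
    obtain ⟨N, hN⟩ := h1
    refine ⟨N, fun m m' hm => ?_⟩
    simp only [hval] at hm
    have h2 := hN (fun i j _ => ∑ c, m i j c) (fun _ => ∑ c, m' c) hm
    refine ⟨fun i j c => le_trans ?_ (h2.1 i j 0), fun c => le_trans ?_ (h2.2 0)⟩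
    · exact Finset.single_le_sum_of_canonicallyOrdered (f := fun c => m i j c) (Finset.mem_univ c)
    · exact Finset.single_le_sum_of_canonicallyOrdered (f := fun c => m' c) (Finset.mem_univ c)

/-- A local cochain of `(Lie_1 R)_-` gives a basic cochain. -/
theorem restrict_mem {δ : Family s (annihilation 1 R) M k} (hδ : δ ∈ localCochain 1 R s M k) :
    (fun m m' a a' => δ (fun i j => ann (fun _ => m i j) (a i j)) (ann (fun _ => m') a')) ∈
      basicCochain s R M k := by
  obtain ⟨hδ, hloc⟩ := mem_localCochain_iff.1 hδ
  obtain ⟨H, hH, hs⟩ := mem_nLieCochain_iff.1 hδ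
  refine mem_basicCochain_iff.2 ⟨fun n => H.compLinearMap fun q => ann fun _ => n q, ?_, ?_, ?_, ?_⟩
  · intro m m' a a'
    rw [hH, flat_ann, MultilinearMap.compLinearMap_apply]
    congr 1
    funext q
    cases q <;> rfl
  · intro z
    obtain ⟨N, hN⟩ := hloc (fun i j => z (some (i, j))) (z none)
    refine (Set.finite_Iic fun _ => N).subset fun n hn q => ?_
    have h1 := hN (fun i j _ => n (some (i, j))) (fun _ => n none) (by
      simp only [hH, flat_ann]
      have e : flat (fun i j (_ : Fin 1) => n (some (i, j))) (fun _ => n none) = fun q _ => n q :=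
        flat_unflat fun q _ => n q
      rw [flat_unflat, e]
      exact hn)
    rcases q with _ | ⟨i, j⟩
    · exact h1.2 0
    · exact h1.1 i j 0
  · intro n z q
    have e : ∀ (l : Option (Fin k × Fin (s + 1)) → ℕ) b, H.compLinearMap (fun q => ann fun _ => l q) (Function.update z q b) =
        H (Function.update (fun q' => ann (fun _ => l q') (z q')) q (ann (fun _ => l q) b)) := by
      intro l b
      rw [MultilinearMap.compLinearMap_apply]
      congr 1
      funext q'
      by_cases hq : q' = q
      · subst hq; simp
      · simp [hq]
    have e2 : (fun _ : Fin 1 => n q - 1) = lowerAt (fun _ : Fin 1 => n q) 0 := by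
      funext c
      rw [Subsingleton.elim c 0]
      simp [lowerAt]
    rw [e, ann_del]
    simp only [Finset.univ_unique, Fin.default_eq_zero, Finset.sum_singleton]
    rw [MultilinearMap.map_update_neg, MultilinearMap.map_update_smul, neg_smul, ← e2,
      MultilinearMap.compLinearMap_apply]
    congr 3
    funext q'
    by_cases hq : q' = q
    · subst hq; simp [lowerAt]
    · simp [lowerAt, hq]
  · intro σ hσ n z
    simp only [MultilinearMap.compLinearMap_apply]
    rw [← hs σ hσ]
    rfl

end Basic

/-! ### Differentials of lifted cochains -/

section Differential

variable {p s k : ℕ} {R : Type u} [AddCommGroup R] [Module ℂ R] [Module ℂ[X] R]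
  [IsScalarTower ℂ ℂ[X] R] {A : NLieConformalAlgebra s R}
variable {M : Type v} [AddCommGroup M] [Module ℂ M] [Module ℂ[X] M] [IsScalarTower ℂ ℂ[X] M]
variable (V : ConformalRep A M)

theorem setEntry_comp_succAbove {α : Type*} {r : ℕ} (x : Fin (k + 1) → Fin r → α) (i : Fin (k + 1))
    (j : Fin k) (l : Fin r) (y : α) :
    (fun c => setEntry x (i.succAbove j) l y (i.succAbove c)) =
      setEntry (fun c => x (i.succAbove c)) j l y :=
  Function.update_comp_eq_of_injective x (Fin.succAbove_right_injective (p := i)) j _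

theorem setEntry_ann (m : Fin k → Fin (s + 1) → Fin p → ℕ) (a : Fin k → Fin (s + 1) → R)
    (i : Fin k) (j : Fin (s + 1)) (e : Fin p → ℕ) (b : R) :
    setEntry (fun i j => ann (m i j) (a i j)) i j (ann e b) =
      fun i' j' => ann (setEntry m i j e i' j') (setEntry a i j b i' j') := by
  funext i' j'
  by_cases hi : i' = i
  · subst hi
    by_cases hj : j' = j
    · subst hj; simp [setEntry]
    · simp [setEntry, hj]
  · simp [setEntry, hi]

theorem setEntry_sum (m : Fin k → Fin (s + 1) → Fin p → ℕ) (i : Fin k) (j : Fin (s + 1))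
    (e : Fin p → ℕ) :
    (fun i' j' => ∑ c, setEntry m i j e i' j' c) =
      setEntry (fun i j => ∑ c, m i j c) i j (∑ c, e c) := by
  funext i' j'
  by_cases hi : i' = i
  · subst hi
    by_cases hj : j' = j
    · subst hj; simp [setEntry]
    · simp [setEntry, hj]
  · simp [setEntry, hi]

theorem app_ann (m : Fin s → Fin p → ℕ) (m' : Fin p → ℕ) (a : Fin s → R) (a' : R) :
    app (fun i => ann (m i) (a i)) (ann m' a') = fun i => ann (app m m' i) (app a a' i) := by
  funext i
  induction i using Fin.lastCases <;> simp [app]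

theorem app_sum (m : Fin s → Fin p → ℕ) (m' : Fin p → ℕ) :
    (fun i => ∑ c, app m m' i c) = app (fun i => ∑ c, m i c) (∑ c, m' c) := by
  funext i
  induction i using Fin.lastCases <;> simp [app]

/-- On the elements `a_m` the differential of a lifted cochain is given by the basic differential
in the total exponents. -/
theorem nLieD_ann {δ : Family s (annihilation p R) M k} {γ : CoeffFamily s R M k}
    (hδ : δ ∈ nLieCochain s (annihilation p R) M k)
    (h : ∀ (m : Fin k → Fin (s + 1) → Fin p → ℕ) (m' : Fin p → ℕ)
      (a : Fin k → Fin (s + 1) → R) (a' : R), δ (fun i j => ann (m i j) (a i j)) (ann m' a') =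
        γ (fun i j => ∑ c, m i j c) (∑ c, m' c) a a')
    (m : Fin (k + 1) → Fin (s + 1) → Fin p → ℕ) (m' : Fin p → ℕ)
    (a : Fin (k + 1) → Fin (s + 1) → R) (a' : R) :
    nLieD (annBracket p A) (annAction p V) k δ (fun i j => ann (m i j) (a i j)) (ann m' a') =
      basicD V k γ (fun i j => ∑ c, m i j c) (∑ c, m' c) a a' := by
  have hact : ∀ (n : Fin (s + 1) → Fin p → ℕ) (b : Fin (s + 1) → R),
      annAction p V (fun i => ann (n i) (b i)) = V.act (fun i => ∑ c, n i c) b :=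
    fun n b => annAction_ann p V n b
  refine congrArg₂ (HAdd.hAdd : M → M → M) (congrArg₂ (HAdd.hAdd : M → M → M)
    (congrArg₂ (HAdd.hAdd : M → M → M) ?_ ?_) ?_) ?_
  · refine Finset.sum_congr rfl fun i _ => Finset.sum_congr rfl fun j hj => ?_
    obtain ⟨j, rfl⟩ := Fin.exists_succAbove_eq (Finset.mem_Ioi.1 hj).ne'
    refine congrArg (fun z => (-1 : ℂ) ^ ((i : ℕ) + 1) • z) (Finset.sum_congr rfl fun l _ => ?_)
    simp only [setEntry_comp_succAbove]
    refine map_annBracket_app A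
      ((hδ.1 (fun c l => ann (m (i.succAbove c) l) (a (i.succAbove c) l)) (ann m' a') j l).mk' _)
      (fun e b => γ (setEntry (fun c l => ∑ d, m (i.succAbove c) l d) j l e) (∑ d, m' d)
        (setEntry (fun c => a (i.succAbove c)) j l b) a') (fun e b => ?_) _ _ _ _
    rw [IsLinearMap.mk'_apply, setEntry_ann (fun c l => m (i.succAbove c) l), h, setEntry_sum]
  · refine Finset.sum_congr rfl fun i _ => congrArg (fun z => (-1 : ℂ) ^ ((i : ℕ) + 1) • z) ?_
    refine map_annBracket_app A
      ((hδ.2.1 (fun c l => ann (m (i.succAbove c) l) (a (i.succAbove c) l))).mk' _)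
      (fun e b => γ (fun c l => ∑ d, m (i.succAbove c) l d) e (fun c => a (i.succAbove c)) b)
      (fun e b => ?_) _ _ _ _
    exact h (fun c => m (i.succAbove c)) e (fun c => a (i.succAbove c)) b
  · refine Finset.sum_congr rfl fun i _ => ?_
    rw [hact, h (fun c => m (i.succAbove c)) m' (fun c => a (i.succAbove c)) a']
  · refine Finset.sum_congr rfl fun j _ => ?_
    have h1 := app_ann (m (Fin.last k) ∘ j.succAbove) m' (a (Fin.last k) ∘ j.succAbove) a'
    have h2 := app_sum (m (Fin.last k) ∘ j.succAbove) m'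
    have h3 := hact (app (m (Fin.last k) ∘ j.succAbove) m')
      (app (a (Fin.last k) ∘ j.succAbove) a')
    rw [← h1, h2] at h3
    refine congrArg (fun z => (-1 : ℂ) ^ (s + k + 1 + (j : ℕ)) • z) ?_
    exact (congrArg₂ (fun (F : M →ₗ[ℂ] M) w => F w) h3
      (h (fun c => m c.castSucc) (m (Fin.last k) j) (fun c => a c.castSucc) (a (Fin.last k) j)))

theorem annCochainDel_ann (δ : Family s (annihilation p R) M k)
    (m : Fin k → Fin (s + 1) → Fin p → ℕ) (m' : Fin p → ℕ)
    (a : Fin k → Fin (s + 1) → R) (a' : R) :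
    annCochainDel p R s M k δ (fun i j => ann (m i j) (a i j)) (ann m' a') =
      del M (δ (fun i j => ann (m i j) (a i j)) (ann m' a')) -
        ∑ i, ∑ j, δ (fun i' j' => ann (m i' j') (setEntry a i j (del R (a i j)) i' j'))
          (ann m' a') - δ (fun i j => ann (m i j) (a i j)) (ann m' (del R a')) := by
  have h1 : ∀ i j, setEntry (fun i j => ann (m i j) (a i j)) i j (ann (m i j) (del R (a i j))) =
      fun i' j' => ann (m i' j') (setEntry a i j (del R (a i j)) i' j') := by
    intro i j
    have : setEntry m i j (m i j) = m := by simp [setEntry]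
    rw [setEntry_ann, this]
  simp only [annCochainDel, LinearMap.coe_mk, AddHom.coe_mk, annDel_ann, h1]

/-- On the elements `a_m` the `∂`-action on a lifted cochain is given by the `∂`-action on basic
cochains in the total exponents. -/
theorem annCochainDel_eq_basicDel {δ : Family s (annihilation p R) M k} {γ : CoeffFamily s R M k}
    (hγ : γ ∈ basicCochain s R M k)
    (h : ∀ (m : Fin k → Fin (s + 1) → Fin p → ℕ) (m' : Fin p → ℕ)
      (a : Fin k → Fin (s + 1) → R) (a' : R), δ (fun i j => ann (m i j) (a i j)) (ann m' a') =
        γ (fun i j => ∑ c, m i j c) (∑ c, m' c) a a')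
    (m : Fin k → Fin (s + 1) → Fin p → ℕ) (m' : Fin p → ℕ)
    (a : Fin k → Fin (s + 1) → R) (a' : R) :
    annCochainDel p R s M k δ (fun i j => ann (m i j) (a i j)) (ann m' a') =
      basicDel s R M k γ (fun i j => ∑ c, m i j c) (∑ c, m' c) a a' := by
  obtain ⟨-, -, -, h4, h5, -, -⟩ := hγ
  rw [annCochainDel_ann]
  simp only [basicDel, LinearMap.coe_mk, AddHom.coe_mk, h, h4, h5,
    neg_smul, Finset.sum_neg_distrib, sub_neg_eq_add]

theorem annCochainDel_mem {δ : Family s (annihilation p R) M k}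
    (hδ : δ ∈ nLieCochain s (annihilation p R) M k) :
    annCochainDel p R s M k δ ∈ nLieCochain s (annihilation p R) M k :=
  lieFamily_mem (annDel p R) (del M) hδ

theorem annCochainDel_mem_local {δ : Family s (annihilation p R) M k}
    (hδ : δ ∈ localCochain p R s M k) :
    annCochainDel p R s M k δ ∈ localCochain p R s M k := by
  obtain ⟨hδ, hloc⟩ := mem_localCochain_iff.1 hδ
  refine mem_localCochain_iff.2 ⟨annCochainDel_mem hδ, fun a a' => ?_⟩
  simp only [annCochainDel_ann]
  exact (((hloc a a').map (del M)).sub (BoundedSupport.sum _ fun i _ =>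
    BoundedSupport.sum _ fun j _ => hloc _ _)).sub (hloc _ _)

/-- In `[a¹_{m¹}, …, aⁿ⁻¹_{mⁿ⁻¹}, b_{m'}]`, expanded as a combination of elements `c_e`, the
non-zero summands with `e ≤ N` force `m¹, …, mⁿ⁻¹, m' ≤ N'`; the elements `c` that occur form a
finite set independent of the exponents. -/
theorem annBracket_expand (a : Fin (s + 1) → R) (b : R) :
    ∃ (K : Finset (Fin (s + 1) → ℕ)), ∀ (m : Fin (s + 1) → Fin p → ℕ) (m' : Fin p → ℕ),
      ∃ (S : Finset (Fin (s + 1) × Fin p → ℕ)) (c : (Fin (s + 1) × Fin p → ℕ) → ℂ)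
        (e : (Fin (s + 1) × Fin p → ℕ) → Fin p → ℕ),
        annBracket p A (app (fun i => ann (m i) (a i)) (ann m' b)) =
          ∑ t ∈ S, c t • ann (e t) (A.prod (fun i => ∑ d, t (i, d)) (app a b)) ∧
        ∀ t ∈ S, (fun i => ∑ d, t (i, d)) ∈ K ∧ (∀ d, m' d ≤ e t d) ∧
          ∀ i d, m i d ≤ e t d + ∑ d, t (i, d) := by
  classical
  refine ⟨(A.polynomial (app a b)).toFinset, fun m m' => ?_⟩
  refine ⟨(Finset.Iic fun x : Fin (s + 1) × Fin p => m x.1 x.2).filter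
      fun t => A.prod (fun i => ∑ d, t (i, d)) (app a b) ≠ 0,
    fun t => binom (fun x : Fin (s + 1) × Fin p => m x.1 x.2) t,
    fun t d => m' d + ∑ i, (m i d - t (i, d)), ?_, fun t ht => ⟨?_, fun d => ?_, fun i d => ?_⟩⟩
  · rw [app_ann, annBracket_ann]
    simp only [app, Fin.snoc_castSucc, Fin.snoc_last]
    refine (Finset.sum_subset (Finset.filter_subset _ _) fun t ht ht' => ?_).symm
    have : A.prod (fun i => ∑ d, t (i, d)) (app a b) = 0 := by
      by_contra h0
      exact ht' (Finset.mem_filter.2 ⟨ht, h0⟩)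
    rw [this, map_zero, smul_zero]
  · simpa using (Finset.mem_filter.1 ht).2
  · exact Nat.le_add_right _ _
  · have h1 := Finset.single_le_sum_of_canonicallyOrdered (f := fun i => m i d - t (i, d))
      (Finset.mem_univ i)
    have h2 := Finset.single_le_sum_of_canonicallyOrdered (f := fun d => t (i, d))
      (Finset.mem_univ d)
    simp only
    omega

/-- The differential preserves locality: by the bracket formula, each of its terms takes a nonzero
value only at exponents bounded in terms of those of the finitely many nonzero values of `δ`. -/
theorem nLieD_mem_local {δ : Family s (annihilation p R) M k}
    (hδ : δ ∈ localCochain p R s M k) :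
    nLieD (annBracket p A) (annAction p V) k δ ∈ localCochain p R s M (k + 1) := by
  obtain ⟨hδ, hloc⟩ := mem_localCochain_iff.1 hδ
  refine mem_localCochain_iff.2 ⟨(nLieCochain_isComplex (annBracket_isNLieBracket A)
    (annAction_isNLieRep V) k δ hδ).1, fun a a' => ?_⟩
  -- bounds for the action on the finitely many values of a local cochain
  have hact : ∀ (b : Fin (s + 1) → R) (f : (Fin k → Fin (s + 1) → Fin p → ℕ) → (Fin p → ℕ) → M),
      BoundedSupport f → ∃ N, ∀ l l' (n : Fin (s + 1) → Fin p → ℕ),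
        annAction p V (fun i => ann (n i) (b i)) (f l l') ≠ 0 →
          ExpBounded N l l' ∧ ∀ i c, n i c ≤ N := by
    intro b f hf
    have hfin := (finite_iff_boundedSupport f).2 hf
    obtain ⟨N, hN⟩ := hf
    have h2 := Set.Finite.bddAbove (Set.Finite.biUnion hfin
      fun l _ => V.polynomial b (f l.1 l.2))
    obtain ⟨B, hB⟩ := h2
    refine ⟨max N (∑ i, B i), fun l l' n hn => ?_⟩
    have h0 : f l l' ≠ 0 := fun h0 => hn (by rw [h0, map_zero])
    refine ⟨(hN l l' h0).mono (le_max_left _ _), fun i c => le_trans ?_ (le_max_right _ _)⟩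
    rw [annAction_ann] at hn
    have h3 := hB (Set.mem_biUnion (x := (l, l')) h0 hn) i
    have h4 := Finset.single_le_sum_of_canonicallyOrdered (f := fun c => n i c) (Finset.mem_univ c)
    have h5 := Finset.single_le_sum_of_canonicallyOrdered (f := fun i => B i) (Finset.mem_univ i)
    exact (h4.trans h3).trans h5
  refine BoundedSupport.add (BoundedSupport.add (BoundedSupport.add ?_ ?_) ?_) ?_
  · refine BoundedSupport.sum _ fun i _ => BoundedSupport.sum _ fun j hj => BoundedSupport.smul
      (BoundedSupport.sum _ fun l _ => ?_) _
    obtain ⟨j, rfl⟩ := Fin.exists_succAbove_eq (Finset.mem_Ioi.1 hj).ne'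
    simp only [setEntry_comp_succAbove]
    obtain ⟨K, hK⟩ := annBracket_expand (p := p) (A := A) (a i) (a (i.succAbove j) l)
    choose N hN using fun κ => hloc (setEntry (fun c => a (i.succAbove c)) j l
      (A.prod κ (app (a i) (a (i.succAbove j) l)))) a'
    refine ⟨K.sup N + K.sup fun κ => ∑ i, κ i, fun m m' hm => ?_⟩
    obtain ⟨S, c, e, h1, h2⟩ := hK (m i) (m (i.succAbove j) l)
    let Λ := (hδ.1 (fun c l => ann (m (i.succAbove c) l) (a (i.succAbove c) l)) (ann m' a') j l).mk' _
    have hm1 : Λ (annBracket p A (app (fun l => ann (m i l) (a i l))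
      (ann (m (i.succAbove j) l) (a (i.succAbove j) l)))) ≠ 0 := hm
    rw [h1, map_sum] at hm1
    obtain ⟨t, ht, h0⟩ := Finset.exists_ne_zero_of_sum_ne_zero hm1
    rw [map_smul] at h0
    have h0 := right_ne_zero_of_smul h0
    simp only [Λ, IsLinearMap.mk'_apply, setEntry_ann (fun c l => m (i.succAbove c) l)] at h0
    have h3 := hN _ _ _ h0
    obtain ⟨hκ, h4, h5⟩ := h2 t ht
    have h6 := h3.mono (Finset.le_sup (f := N) hκ)
    have h7 := Finset.le_sup (f := fun κ : Fin (s + 1) → ℕ => ∑ i, κ i) hκ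
    have he : ∀ d, e t d ≤ K.sup N := fun d => by
      have := h6.1 j l d
      simpa [setEntry] using this
    refine ⟨fun i' j' d => ?_, fun d => (h6.2 d).trans (Nat.le_add_right _ _)⟩
    rcases Fin.eq_self_or_eq_succAbove i i' with rfl | ⟨i', rfl⟩
    · have h8 := Finset.single_le_sum_of_canonicallyOrdered
        (f := fun q => ∑ d, t (q, d)) (Finset.mem_univ j')
      exact (h5 j' d).trans (add_le_add (he d) (h8.trans h7))
    · refine le_trans ?_ (Nat.le_add_right _ _)
      by_cases hq : i' = j ∧ j' = l
      · obtain ⟨rfl, rfl⟩ := hq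
        exact (h4 d).trans (he d)
      · have h9 := h6.1 i' j' d
        rwa [show setEntry (fun c l => m (i.succAbove c) l) j l (e t) i' j' =
          m (i.succAbove i') j' by
            by_cases hi : i' = j
            · subst hi
              have : j' ≠ l := fun h => hq ⟨rfl, h⟩
              simp [setEntry, this]
            · simp [setEntry, hi]] at h9
  · refine BoundedSupport.sum _ fun i _ => BoundedSupport.smul ?_ _
    obtain ⟨K, hK⟩ := annBracket_expand (p := p) (A := A) (a i) a'
    choose N hN using fun κ => hloc (fun c => a (i.succAbove c)) (A.prod κ (app (a i) a'))
    refine ⟨K.sup N + K.sup fun κ => ∑ i, κ i, fun m m' hm => ?_⟩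
    obtain ⟨S, c, e, h1, h2⟩ := hK (m i) m'
    let Λ := (hδ.2.1 (fun c l => ann (m (i.succAbove c) l) (a (i.succAbove c) l))).mk' _
    have hm1 : Λ (annBracket p A (app (fun l => ann (m i l) (a i l)) (ann m' a'))) ≠ 0 := hm
    rw [h1, map_sum] at hm1
    obtain ⟨t, ht, h0⟩ := Finset.exists_ne_zero_of_sum_ne_zero hm1
    rw [map_smul] at h0
    have h0 := right_ne_zero_of_smul h0
    have h3 := hN _ (fun c => m (i.succAbove c)) _ h0
    obtain ⟨hκ, h4, h5⟩ := h2 t ht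
    have h6 := h3.mono (Finset.le_sup (f := N) hκ)
    have h7 := Finset.le_sup (f := fun κ : Fin (s + 1) → ℕ => ∑ i, κ i) hκ
    refine ⟨fun i' j' d => ?_, fun d => ((h4 d).trans (h6.2 d)).trans (Nat.le_add_right _ _)⟩
    rcases Fin.eq_self_or_eq_succAbove i i' with rfl | ⟨i', rfl⟩
    · have h8 := Finset.single_le_sum_of_canonicallyOrdered
        (f := fun q => ∑ d, t (q, d)) (Finset.mem_univ j')
      exact (h5 j' d).trans (add_le_add (h6.2 d) (h8.trans h7))
    · exact (h6.1 i' j' d).trans (Nat.le_add_right _ _)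
  · refine BoundedSupport.sum _ fun i _ => BoundedSupport.smul ?_ _
    obtain ⟨N, hN⟩ := hact (a i) _ (hloc (fun c => a (i.succAbove c)) a')
    refine ⟨N, fun m m' hm => ?_⟩
    obtain ⟨h1, h2⟩ := hN (fun c => m (i.succAbove c)) m' (m i) hm
    refine ⟨fun i' j' d => ?_, h1.2⟩
    rcases Fin.eq_self_or_eq_succAbove i i' with rfl | ⟨i', rfl⟩
    · exact h2 j' d
    · exact h1.1 i' j' d
  · refine BoundedSupport.sum _ fun j _ => BoundedSupport.smul ?_ _
    obtain ⟨N, hN⟩ := hact (app (a (Fin.last k) ∘ j.succAbove) a') _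
      (hloc (fun c => a c.castSucc) (a (Fin.last k) j))
    refine ⟨N, fun m m' hm => ?_⟩
    have h3 := app_ann (m (Fin.last k) ∘ j.succAbove) m' (a (Fin.last k) ∘ j.succAbove) a'
    obtain ⟨h1, h2⟩ := hN (fun c => m c.castSucc) (m (Fin.last k) j)
      (app (m (Fin.last k) ∘ j.succAbove) m') (by rw [← h3]; exact hm)
    refine ⟨fun i' j' d => ?_, fun d => by simpa [app] using h2 (Fin.last s) d⟩
    induction i' using Fin.lastCases with
    | last =>
      rcases Fin.eq_self_or_eq_succAbove j j' with rfl | ⟨j', rfl⟩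
      · exact h1.2 d
      · simpa [app] using h2 j'.castSucc d
    | cast i' => exact h1.1 i' j' d

end Differential

/-! ### The comparison morphism -/

section Complex

universe w

variable {W W' : ℕ → Type w} [∀ k, AddCommGroup (W k)] [∀ k, Module ℂ (W k)]
  [∀ k, AddCommGroup (W' k)] [∀ k, Module ℂ (W' k)]
  {C : ∀ k, Submodule ℂ (W k)} {D : ∀ k, W k →ₗ[ℂ] W (k + 1)}
  {C' : ∀ k, Submodule ℂ (W' k)} {D' : ∀ k, W' k →ₗ[ℂ] W' (k + 1)}

/-- The morphism of complexes given by linear maps that commute with the differentials. -/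
def IsComplex.hom (h : IsComplex C D) (h' : IsComplex C' D') (f : ∀ k, C k →ₗ[ℂ] C' k)
    (hf : ∀ k (γ : C k), D' k (f k γ) = f (k + 1) ⟨D k γ, (h k γ γ.2).1⟩) :
    h.complex ⟶ h'.complex :=
  CochainComplex.ofHom (X := h.complex) (Y := h'.complex) (fun k => ModuleCat.ofHom (f k))
    (fun k => by
      simp only [IsComplex.complex, CochainComplex.of_d]
      exact ModuleCat.hom_ext (LinearMap.ext fun γ => Subtype.ext (hf k γ)))

theorem IsComplex.val_mem (h : IsComplex C D) {k : ℕ} (γ : h.complex.X k) : h.val γ ∈ C k :=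
  (show C k from γ).2

end Complex

section Lift

variable {s : ℕ} {R : Type u} [AddCommGroup R] [Module ℂ R] [Module ℂ[X] R]
  [IsScalarTower ℂ ℂ[X] R] {A : NLieConformalAlgebra s R}
variable {M : Type v} [AddCommGroup M] [Module ℂ M] [Module ℂ[X] M] [IsScalarTower ℂ ℂ[X] M]
variable (V : ConformalRep A M)

theorem basicD_mem {k : ℕ} {γ : CoeffFamily s R M k} (hγ : γ ∈ basicCochain s R M k) :
    basicD V k γ ∈ basicCochain s R M (k + 1) := by
  obtain ⟨δ, hδ, h⟩ := exists_lift 1 hγ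
  have h1 := restrict_mem (nLieD_mem_local V hδ)
  convert h1 using 1
  funext m m' a a'
  rw [nLieD_ann V hδ.1 h (fun i j _ => m i j) (fun _ => m')]
  simp

theorem basicDel_mem {k : ℕ} {γ : CoeffFamily s R M k} (hγ : γ ∈ basicCochain s R M k) :
    basicDel s R M k γ ∈ basicCochain s R M k := by
  obtain ⟨δ, hδ, h⟩ := exists_lift 1 hγ
  have h1 := restrict_mem (annCochainDel_mem_local hδ)
  convert h1 using 1
  funext m m' a a'
  rw [annCochainDel_eq_basicDel hγ h (fun i j _ => m i j) (fun _ => m')]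
  simp

theorem basicCochain_isComplex : IsComplex (basicCochain s R M) (basicD V) := by
  intro k γ hγ
  refine ⟨basicD_mem V hγ, ?_⟩
  obtain ⟨δ, hδ, h⟩ := exists_lift 1 hγ
  have h1 := nLieCochain_isComplex (annBracket_isNLieBracket (p := 1) A) (annAction_isNLieRep V) k δ hδ.1
  have h2 := nLieD_ann V h1.1 (nLieD_ann V hδ.1 h)
  funext m m' a a'
  have h3 := h2 (fun i j _ => m i j) (fun _ => m') a a'
  rw [h1.2] at h3
  simpa using h3.symm

theorem localCochain_isComplex (p : ℕ) : IsComplex (localCochain p R s M)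
    (nLieD (annBracket p A) (annAction p V)) := fun k γ hγ =>
  ⟨nLieD_mem_local V hγ, (nLieCochain_isComplex (annBracket_isNLieBracket A)
    (annAction_isNLieRep V) k γ hγ.1).2⟩

variable {V}

variable (s R M) in
/-- The map from basic cochains to local cochains of `(Lie_p R)_-`; see `lift_ann`. -/
def lift (p k : ℕ) : basicCochain s R M k →ₗ[ℂ] localCochain p R s M k where
  toFun γ := ⟨(exists_lift p γ.2).choose, (exists_lift p γ.2).choose_spec.1⟩
  map_add' γ δ := by
    refine Subtype.ext (nLieCochain_ext (exists_lift p (γ + δ).2).choose_spec.1.1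
      (add_mem (exists_lift p γ.2).choose_spec.1.1 (exists_lift p δ.2).choose_spec.1.1) ?_)
    intro m m' a a'
    exact ((exists_lift p (γ + δ).2).choose_spec.2 m m' a a').trans
      (congrArg₂ (HAdd.hAdd : M → M → M) ((exists_lift p γ.2).choose_spec.2 m m' a a')
        ((exists_lift p δ.2).choose_spec.2 m m' a a')).symm
  map_smul' c γ := by
    refine Subtype.ext (nLieCochain_ext (exists_lift p (c • γ).2).choose_spec.1.1
      (Submodule.smul_mem _ c (exists_lift p γ.2).choose_spec.1.1) ?_)
    intro m m' a a'
    exact ((exists_lift p (c • γ).2).choose_spec.2 m m' a a').trans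
      (congrArg (fun w : M => c • w) ((exists_lift p γ.2).choose_spec.2 m m' a a')).symm

theorem lift_ann (p : ℕ) {k : ℕ} (γ : basicCochain s R M k)
    (m : Fin k → Fin (s + 1) → Fin p → ℕ) (m' : Fin p → ℕ) (a : Fin k → Fin (s + 1) → R) (a' : R) :
    (lift s R M p k γ : Family s (annihilation p R) M k) (fun i j => ann (m i j) (a i j))
      (ann m' a') = (γ : CoeffFamily s R M k) (fun i j => ∑ c, m i j c) (∑ c, m' c) a a' :=
  (exists_lift p γ.2).choose_spec.2 m m' a a'

theorem lift_injective {p : ℕ} (hp : 1 ≤ p) (k : ℕ) : Function.Injective (lift s R M p k) := by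
  intro γ δ h
  refine Subtype.ext ?_
  funext m m' a a'
  have h1 := lift_ann p γ (fun i j => Pi.single ⟨0, hp⟩ (m i j)) (Pi.single ⟨0, hp⟩ m') a a'
  have h2 := lift_ann p δ (fun i j => Pi.single ⟨0, hp⟩ (m i j)) (Pi.single ⟨0, hp⟩ m') a a'
  rw [h, h2] at h1
  simpa using h1.symm

theorem lift_surjective (k : ℕ) : Function.Surjective (lift s R M 1 k) := by
  intro δ
  refine ⟨⟨_, restrict_mem δ.2⟩, Subtype.ext ?_⟩
  refine nLieCochain_ext (lift s R M 1 k _).2.1 δ.2.1 fun m m' a a' => ?_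
  rw [lift_ann]
  have e : ∀ n : Fin 1 → ℕ, (fun _ : Fin 1 => ∑ c, n c) = n := by
    intro n
    funext c
    rw [Subsingleton.elim c 0]
    simp
  simp only [e]

theorem nLieD_lift (V : ConformalRep A M) (p : ℕ) {k : ℕ} (γ : basicCochain s R M k) :
    nLieD (annBracket p A) (annAction p V) k (lift s R M p k γ) =
      lift s R M p (k + 1) ⟨basicD V k γ, basicD_mem V γ.2⟩ := by
  refine nLieCochain_ext (nLieD_mem_local V (lift s R M p k γ).2).1 (lift s R M p (k + 1) _).2.1 ?_
  intro m m' a a'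
  rw [nLieD_ann V (lift s R M p k γ).2.1 (lift_ann p γ), lift_ann]

theorem annCochainDel_lift (p : ℕ) {k : ℕ} (γ : basicCochain s R M k) :
    annCochainDel p R s M k (lift s R M p k γ) =
      lift s R M p k ⟨basicDel s R M k γ, basicDel_mem γ.2⟩ := by
  refine nLieCochain_ext (annCochainDel_mem_local (lift s R M p k γ).2).1
    (lift s R M p k _).2.1 ?_
  intro m m' a a'
  rw [annCochainDel_eq_basicDel γ.2 (lift_ann p γ), lift_ann]

end Lift

/-! ### Local and continuous cochains -/

section Torsion

variable {p : ℕ} {R : Type u} [AddCommGroup R] [Module ℂ R] [Module ℂ[X] R]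
  [IsScalarTower ℂ ℂ[X] R]

/-- If `∂ - z` sends `a` to an element whose images in `(Lie_p R)_-` vanish, then those of `a`
vanish. -/
theorem ann_eq_zero_of_linear (hp : 1 ≤ p) (z : ℂ) (a : R)
    (h : ∀ m : Fin p → ℕ, ann m ((X - C z : ℂ[X]) • a) = 0) (m : Fin p → ℕ) : ann m a = 0 := by
  have h1 : ∀ m : Fin p → ℕ, ∑ c, (m c : ℂ) • ann (lowerAt m c) a + z • ann m a = 0 := by
    intro m
    have h2 := h m
    have h3 : (X - C z : ℂ[X]) • a = del R a - z • a := by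
      rw [sub_smul, ← Polynomial.algebraMap_eq, algebraMap_smul]
      rfl
    rw [h3, map_sub, ann_del, map_smul, ← neg_add', neg_eq_zero] at h2
    exact h2
  by_cases hz : z = 0
  · -- Here the relation expresses `a_m` by terms with smaller total degree in the variables other
    -- than the first.
    subst hz
    let c₀ : Fin p := ⟨0, hp⟩
    suffices H : ∀ (N : ℕ) (m : Fin p → ℕ), ∑ c ∈ Finset.univ.erase c₀, m c = N → ann m a = 0 from
      H _ m rfl
    intro N
    induction N using Nat.strong_induction_on with
    | _ N ih =>
      intro m hm
      have h2 := h1 (Function.update m c₀ (m c₀ + 1))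
      rw [zero_smul, add_zero, ← Finset.add_sum_erase _ _ (Finset.mem_univ c₀),
        Finset.sum_eq_zero, add_zero] at h2
      · have e : lowerAt (Function.update m c₀ (m c₀ + 1)) c₀ = m := by simp [lowerAt]
        rw [e, Function.update_self] at h2
        exact (smul_eq_zero.1 h2).resolve_left (Nat.cast_ne_zero.2 (Nat.succ_ne_zero _))
      · intro c hc
        have hne := Finset.ne_of_mem_erase hc
        rw [Function.update_of_ne hne]
        rcases Nat.eq_zero_or_pos (m c) with h0 | h0
        · simp [h0]
        · rw [ih (N - 1) ?_ _ ?_, smul_zero]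
          · have := Finset.single_le_sum_of_canonicallyOrdered (f := m) hc
            omega
          · rw [← Finset.add_sum_erase _ _ hc] at hm ⊢
            rw [lowerAt, Function.update_self, Function.update_of_ne hne,
              Finset.sum_congr rfl (g := fun c => m c)]
            · omega
            · intro c' hc'
              rw [Function.update_of_ne (Finset.ne_of_mem_erase hc'),
                Function.update_of_ne (Finset.ne_of_mem_erase (Finset.mem_of_mem_erase hc'))]
  · suffices H : ∀ (N : ℕ) (m : Fin p → ℕ), ∑ c, m c = N → ann m a = 0 from H _ m rfl
    intro N
    induction N using Nat.strong_induction_on with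
    | _ N ih =>
      intro m hm
      have h2 := h1 m
      rw [Finset.sum_eq_zero, zero_add] at h2
      · exact (smul_eq_zero.1 h2).resolve_left hz
      · intro c _
        rcases Nat.eq_zero_or_pos (m c) with h0 | h0
        · simp [h0]
        · have h3 := sum_lowerAt m c h0.ne'
          have h4 := Finset.single_le_sum_of_canonicallyOrdered (f := m) (Finset.mem_univ c)
          rw [ih (N - 1) (by omega) _ (by omega), smul_zero]

/-- Torsion elements of `R` have image zero in `(Lie_p R)_-`. -/
theorem ann_torsion (hp : 1 ≤ p) {a : R} (ha : a ∈ Submodule.torsion ℂ[X] R) (m : Fin p → ℕ) :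
    ann m a = 0 := by
  obtain ⟨P, hP⟩ := (Submodule.mem_torsion_iff a).1 ha
  have hP0 : (P : ℂ[X]) ≠ 0 := nonZeroDivisors.coe_ne_zero P
  suffices H : ∀ (n : ℕ) (P : ℂ[X]), P ≠ 0 → P.natDegree = n → ∀ a : R,
      (∀ m : Fin p → ℕ, ann m (P • a) = 0) → ∀ m : Fin p → ℕ, ann m a = 0 from
    H _ P hP0 rfl a (fun m => by
      rw [show (P : ℂ[X]) • a = 0 from hP, map_zero]) m
  intro n
  induction n with
  | zero =>
    intro P hP hn a h m
    obtain ⟨c, rfl⟩ := Polynomial.natDegree_eq_zero.1 hn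
    have h1 := h m
    rw [← Polynomial.algebraMap_eq, algebraMap_smul, map_smul] at h1
    refine (smul_eq_zero.1 h1).resolve_left fun hc => hP ?_
    rw [hc, map_zero]
  | succ n ih =>
    intro P hP hn a h m
    obtain ⟨z, hz⟩ := IsAlgClosed.exists_root P fun h0 => by
      rw [Polynomial.degree_eq_natDegree hP, hn] at h0
      exact absurd h0 (by exact_mod_cast Nat.succ_ne_zero n)
    obtain ⟨Q, rfl⟩ := Polynomial.dvd_iff_isRoot.2 hz
    have hQ : Q ≠ 0 := right_ne_zero_of_mul hP
    refine ih Q hQ ?_ a (fun m => ann_eq_zero_of_linear hp z _ (fun m => ?_) m) m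
    · rw [Polynomial.natDegree_mul (left_ne_zero_of_mul hP) hQ, Polynomial.natDegree_X_sub_C] at hn
      omega
    · rw [smul_smul]
      exact h m

end Torsion

section Filtration

variable {p d : ℕ} {R : Type u} [AddCommGroup R] [Module ℂ R] [Module ℂ[X] R]
  [IsScalarTower ℂ ℂ[X] R] (v : Fin d → R)

theorem annFiltration_anti {N N' : ℕ} (h : N ≤ N') :
    annFiltration p v N' ≤ annFiltration p v N := by
  refine Submodule.span_mono ?_
  rintro y ⟨i, m, hm, rfl⟩
  exact ⟨i, m, h.trans hm, rfl⟩

/-- If `R` is generated by the `vⁱ` and torsion elements, then `a_m` lies in the filtration step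
`|m| - e`, where `e` depends only on `a`. -/
theorem exists_ann_mem_filtration (hp : 1 ≤ p)
    (hv : Submodule.span ℂ[X] (Set.range v) ⊔ Submodule.torsion ℂ[X] R = ⊤) (a : R) :
    ∃ e, ∀ m : Fin p → ℕ, ann m a ∈ annFiltration p v (∑ c, m c - e) := by
  have hadd : ∀ a b : R, (∃ e, ∀ m : Fin p → ℕ, ann m a ∈ annFiltration p v (∑ c, m c - e)) →
      (∃ e, ∀ m : Fin p → ℕ, ann m b ∈ annFiltration p v (∑ c, m c - e)) →
      ∃ e, ∀ m : Fin p → ℕ, ann m (a + b) ∈ annFiltration p v (∑ c, m c - e) := by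
    rintro a b ⟨e, he⟩ ⟨e', he'⟩
    refine ⟨max e e', fun m => ?_⟩
    rw [map_add]
    exact add_mem (annFiltration_anti v (by omega) (he m)) (annFiltration_anti v (by omega) (he' m))
  have hscal : ∀ (z : ℂ) (a : R),
      (∃ e, ∀ m : Fin p → ℕ, ann m a ∈ annFiltration p v (∑ c, m c - e)) →
      ∃ e, ∀ m : Fin p → ℕ, ann m (z • a) ∈ annFiltration p v (∑ c, m c - e) := by
    rintro z a ⟨e, he⟩
    refine ⟨e, fun m => ?_⟩
    rw [map_smul]
    exact Submodule.smul_mem _ z (he m)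
  have hdel : ∀ a : R, (∃ e, ∀ m : Fin p → ℕ, ann m a ∈ annFiltration p v (∑ c, m c - e)) →
      ∃ e, ∀ m : Fin p → ℕ, ann m (del R a) ∈ annFiltration p v (∑ c, m c - e) := by
    rintro a ⟨e, he⟩
    refine ⟨e + 1, fun m => ?_⟩
    rw [ann_del]
    refine neg_mem (Submodule.sum_mem _ fun c _ => ?_)
    rcases Nat.eq_zero_or_pos (m c) with h0 | h0
    · simp [h0]
    · have h1 := he (lowerAt m c)
      rw [sum_lowerAt m c h0.ne', Nat.sub_sub, add_comm 1 e] at h1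
      exact Submodule.smul_mem _ _ h1
  have hsmul : ∀ (P : ℂ[X]) (a : R),
      (∃ e, ∀ m : Fin p → ℕ, ann m a ∈ annFiltration p v (∑ c, m c - e)) →
      ∃ e, ∀ m : Fin p → ℕ, ann m (P • a) ∈ annFiltration p v (∑ c, m c - e) := by
    intro P a ha
    induction P using Polynomial.induction_on' with
    | add P Q hP hQ => rw [add_smul]; exact hadd _ _ hP hQ
    | monomial n z =>
      induction n with
      | zero =>
        rw [Polynomial.monomial_zero_left, ← Polynomial.algebraMap_eq, algebraMap_smul]
        exact hscal z a ha
      | succ n ih =>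
        rw [← Polynomial.X_mul_monomial, mul_smul]
        exact hdel _ ih
  have ha : a ∈ Submodule.span ℂ[X] (Set.range v) ⊔ Submodule.torsion ℂ[X] R := hv ▸ trivial
  obtain ⟨b, hb, t, ht, rfl⟩ := Submodule.mem_sup.1 ha
  refine hadd _ _ ?_ ⟨0, fun m => by rw [ann_torsion hp ht]; exact zero_mem _⟩
  induction hb using Submodule.span_induction with
  | mem x hx =>
    obtain ⟨i, rfl⟩ := hx
    exact ⟨0, fun m => Submodule.subset_span ⟨i, m, Nat.sub_le _ _, rfl⟩⟩
  | zero => exact ⟨0, fun m => by rw [map_zero]; exact zero_mem _⟩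
  | add x y _ _ hx hy => exact hadd x y (hx (hv ▸ trivial)) (hy (hv ▸ trivial))
  | smul P x _ hx => exact hsmul P x (hx (hv ▸ trivial))

theorem annFiltration_zero (hp : 1 ≤ p)
    (hv : Submodule.span ℂ[X] (Set.range v) ⊔ Submodule.torsion ℂ[X] R = ⊤) :
    annFiltration p v 0 = ⊤ := by
  refine eq_top_iff.2 fun x _ => ?_
  obtain ⟨w, rfl⟩ := toAnn_surjective p R x
  induction w using Finsupp.induction_linear with
  | zero => rw [map_zero]; exact zero_mem _
  | add w w' hw hw' => rw [map_add]; exact add_mem (hw trivial) (hw' trivial)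
  | single m a =>
    obtain ⟨e, he⟩ := exists_ann_mem_filtration v hp hv a
    simpa [toAnn] using annFiltration_anti v (Nat.zero_le _) (he m)

end Filtration

section Multilinear

variable {ι : Type*} [Fintype ι] [DecidableEq ι] {L : Type*} [AddCommGroup L] [Module ℂ L]
  {M : Type*} [AddCommGroup M] [Module ℂ M]

/-- A multilinear map that vanishes on a product of spanning sets vanishes. -/
theorem multilinear_eq_zero_of_span (G : MultilinearMap ℂ (fun _ : ι => L) M) (S : ι → Set L)
    (h : ∀ z, (∀ q, z q ∈ S q) → G z = 0) (z : ι → L) (hz : ∀ q, z q ∈ Submodule.span ℂ (S q)) :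
    G z = 0 := by
  suffices H : ∀ (T : Finset ι) (z : ι → L), (∀ q ∈ T, z q ∈ Submodule.span ℂ (S q)) →
      (∀ q ∉ T, z q ∈ S q) → G z = 0 from
    H Finset.univ z (fun q _ => hz q) fun q hq => absurd (Finset.mem_univ q) hq
  intro T
  induction T using Finset.induction_on with
  | empty => exact fun z _ h' => h z fun q => h' q (Finset.notMem_empty q)
  | insert q T hq ih =>
    intro z h1 h2
    have h3 : Submodule.span ℂ (S q) ≤ LinearMap.ker (G.toLinearMap z q) := by
      refine Submodule.span_le.2 fun y hy => ih (Function.update z q y) (fun q' hq' => ?_) ?_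
      · have hne : q' ≠ q := fun h0 => hq (h0 ▸ hq')
        rw [Function.update_of_ne hne]
        exact h1 q' (Finset.mem_insert_of_mem hq')
      · intro q' hq'
        by_cases hne : q' = q
        · subst hne; rwa [Function.update_self]
        · rw [Function.update_of_ne hne]
          exact h2 q' (by simp [hne, hq'])
    have h4 := h3 (h1 q (Finset.mem_insert_self q T))
    simpa using h4

end Multilinear

section Continuity

open Filter Topology

variable {p d s k : ℕ} {R : Type u} [AddCommGroup R] [Module ℂ R] [Module ℂ[X] R]
  [IsScalarTower ℂ ℂ[X] R] (v : Fin d → R)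
variable {M : Type v} [AddCommGroup M] [Module ℂ M] [Module ℂ[X] M] [IsScalarTower ℂ ℂ[X] M]

theorem isOpen_coset (x : annihilation p R) (N : ℕ) :
    IsOpen[annTopology p v] {y | y - x ∈ annFiltration p v N} := by
  intro y hy
  refine ⟨N, fun z hz => ?_⟩
  rw [Set.mem_ofPred_eq, add_sub_right_comm]
  exact add_mem hy hz

/-- A local cochain vanishes as soon as one of its arguments lies in a suitable filtration step. -/
theorem local_vanishes (hp : 1 ≤ p)
    (hv : Submodule.span ℂ[X] (Set.range v) ⊔ Submodule.torsion ℂ[X] R = ⊤)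
    {γ : Family s (annihilation p R) M k} (hγ : γ ∈ localCochain p R s M k)
    {G : MultilinearMap ℂ (fun _ : Option (Fin k × Fin (s + 1)) => annihilation p R) M}
    (hG : ∀ x x', γ x x' = G (flat x x')) :
    ∃ N, ∀ z q, z q ∈ annFiltration p v N → G z = 0 := by
  obtain ⟨hγ, hloc⟩ := mem_localCochain_iff.1 hγ
  choose N hN using fun i : Option (Fin k × Fin (s + 1)) → Fin d =>
    hloc (fun q j => v (i (some (q, j)))) (v (i none))
  refine ⟨p * Finset.univ.sup N + 1, fun z q hz => ?_⟩
  refine multilinear_eq_zero_of_span G (fun q' => {x | ∃ (i : Fin d) (m : Fin p → ℕ),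
    (if q' = q then p * Finset.univ.sup N + 1 else 0) ≤ ∑ c, m c ∧ ann m (v i) = x}) ?_ z ?_
  · intro w hw
    choose i m hm hw using hw
    obtain rfl : (fun q => ann (m q) (v (i q))) = w := funext hw
    by_contra h0
    have h1 := hN i (fun q j => m (some (q, j))) (m none) (by
      simp only [hG]
      convert h0 using 2
      funext q'
      cases q' <;> rfl)
    have h2 := h1.mono (Finset.le_sup (Finset.mem_univ i))
    have h3 : ∀ c, m q c ≤ Finset.univ.sup N := by
      intro c
      rcases q with _ | ⟨q, j⟩
      · exact h2.2 c
      · exact h2.1 q j c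
    have h4 := hm q
    rw [if_pos rfl] at h4
    have h5 := Finset.sum_le_card_nsmul Finset.univ (fun c => m q c) _ fun c _ => h3 c
    rw [Finset.card_univ, Fintype.card_fin, smul_eq_mul] at h5
    omega
  · intro q'
    by_cases hq : q' = q
    · subst hq
      simpa [annFiltration] using hz
    · simp only [if_neg hq]
      have := annFiltration_zero v hp hv
      rw [annFiltration] at this
      rw [this]
      trivial

theorem isContinuousFamily_of_local (hp : 1 ≤ p)
    (hv : Submodule.span ℂ[X] (Set.range v) ⊔ Submodule.torsion ℂ[X] R = ⊤)
    {γ : Family s (annihilation p R) M k} (hγ : γ ∈ localCochain p R s M k) :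
    IsContinuousFamily (annTopology p v) γ := by
  obtain ⟨G, hG, -⟩ := mem_nLieCochain_iff.1 hγ.1
  obtain ⟨N, hN⟩ := local_vanishes v hp hv hγ hG
  let := annTopology p v
  let : TopologicalSpace M := ⊥
  have : DiscreteTopology M := ⟨rfl⟩
  show Continuous fun x : (Fin k → Fin (s + 1) → annihilation p R) × annihilation p R => γ x.1 x.2
  refine continuous_iff_continuousAt.2 fun x => ?_
  refine ContinuousAt.congr continuousAt_const (f := fun _ => γ x.1 x.2) ?_
  have h1 : ∀ᶠ y in 𝓝 x, (∀ i j, y.1 i j - x.1 i j ∈ annFiltration p v N) ∧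
      y.2 - x.2 ∈ annFiltration p v N := by
    refine Filter.Eventually.and (eventually_all.2 fun i => eventually_all.2 fun j => ?_) ?_
    · have h2 : Continuous fun y : (Fin k → Fin (s + 1) → annihilation p R) × annihilation p R =>
          y.1 i j := by fun_prop
      exact h2.continuousAt.eventually ((isOpen_coset v (x.1 i j) N).mem_nhds
        (by simp))
    · exact continuous_snd.continuousAt.eventually ((isOpen_coset v x.2 N).mem_nhds (by simp))
  filter_upwards [h1] with y hy
  rw [hG, hG]
  obtain ⟨e⟩ : Nonempty (Option (Fin k × Fin (s + 1)) ≃ Fin _) := ⟨Fintype.equivFin _⟩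
  have h2 := multilinear_congr (G.domDomCongr e) (annFiltration p v N) (fun z i w hw => ?_)
    (flat x.1 x.2 ∘ e.symm) (flat y.1 y.2 ∘ e.symm) fun i => ?_
  · simpa [MultilinearMap.domDomCongr_apply] using h2
  · refine hN _ (e.symm i) ?_
    simpa using hw
  · rw [← neg_sub]
    refine neg_mem ?_
    simp only [Function.comp_apply]
    rcases e.symm i with _ | ⟨i, j⟩
    · exact hy.2
    · exact hy.1 i j

/-- Compactness of the space of exponents with a point at infinity, at which a cochain is zero,
turns continuity into finiteness. -/
theorem local_of_isContinuousFamily (hp : 1 ≤ p)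
    (hv : Submodule.span ℂ[X] (Set.range v) ⊔ Submodule.torsion ℂ[X] R = ⊤)
    {γ : Family s (annihilation p R) M k} (hγ : γ ∈ nLieCochain s (annihilation p R) M k)
    (hc : IsContinuousFamily (annTopology p v) γ) : γ ∈ localCochain p R s M k := by
  refine ⟨hγ, fun a a' => ?_⟩
  obtain ⟨G, hG, -⟩ := mem_nLieCochain_iff.1 hγ
  let := annTopology p v
  let : TopologicalSpace M := ⊥
  have : DiscreteTopology M := ⟨rfl⟩
  have hc : Continuous fun x : (Fin k → Fin (s + 1) → annihilation p R) × annihilation p R =>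
    γ x.1 x.2 := hc
  let h : R → OnePoint (Fin p → ℕ) → annihilation p R := fun b n => n.elim 0 fun m => ann m b
  have hh : ∀ b, Continuous (h b) := by
    intro b
    rw [OnePoint.continuous_iff_from_discrete]
    obtain ⟨e, he⟩ := exists_ann_mem_filtration v hp hv b
    refine tendsto_nhds.2 fun U hU h0 => ?_
    obtain ⟨N, hN⟩ := hU 0 h0
    refine ((Set.finite_Iic fun _ : Fin p => N + e).subset fun m hm => ?_ :
      {m : Fin p → ℕ | ¬ ann m b ∈ U}.Finite)
    by_contra hlt
    obtain ⟨c, hc⟩ := not_forall.1 hlt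
    have h1 := Finset.single_le_sum_of_canonicallyOrdered (f := m) (Finset.mem_univ c)
    have h2 := hN _ (annFiltration_anti v (show N ≤ ∑ c, m c - e by
      simp only [not_le] at hc; omega) (he m))
    rw [zero_add] at h2
    exact hm h2
  let Φ : (Fin k → Fin (s + 1) → OnePoint (Fin p → ℕ)) × OnePoint (Fin p → ℕ) → M := fun n =>
    γ (fun i j => h (a i j) (n.1 i j)) (h a' n.2)
  have hΦ : Continuous Φ := hc.comp ((continuous_pi fun i => continuous_pi fun j =>
    (hh (a i j)).comp (by fun_prop)).prodMk ((hh a').comp continuous_snd))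
  let ε : (Fin k → Fin (s + 1) → Fin p → ℕ) × (Fin p → ℕ) →
      (Fin k → Fin (s + 1) → OnePoint (Fin p → ℕ)) × OnePoint (Fin p → ℕ) := fun m =>
    (fun i j => m.1 i j, m.2)
  have hε : IsInducing ε := by
    have h1 : IsInducing ((↑) : (Fin p → ℕ) → OnePoint (Fin p → ℕ)) :=
      OnePoint.isOpenEmbedding_coe.isInducing
    exact (IsInducing.piMap fun _ => IsInducing.piMap fun _ => h1).prodMap h1
  have hK : IsCompact (Φ ⁻¹' {0}ᶜ) := ((isClosed_discrete _).preimage hΦ).isCompact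
  have hr : Φ ⁻¹' {0}ᶜ ⊆ Set.range ε := by
    intro n hn
    have hz : ∀ q, flat (fun i j => h (a i j) (n.1 i j)) (h a' n.2) q ≠ 0 := by
      intro q hq
      refine hn ?_
      show γ _ _ = 0
      rw [hG]
      exact G.map_coord_zero q hq
    have hne : ∀ b (x : OnePoint (Fin p → ℕ)), h b x ≠ 0 → ∃ m : Fin p → ℕ, (m : OnePoint _) = x := by
      intro b x hx
      exact OnePoint.ne_infty_iff_exists.1 fun h0 => hx (by rw [h0]; rfl)
    choose m hm using fun i j => hne _ (n.1 i j) (hz (some (i, j)))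
    obtain ⟨m', hm'⟩ := hne _ n.2 (hz none)
    exact ⟨(m, m'), Prod.ext (funext fun i => funext fun j => hm i j) hm'⟩
  exact isCompact_iff_finite.1 (hε.isCompact_preimage' hK hr)

end Continuity

end NLieConf

end

open NLieConf

theorem mainTheorem2 {s : ℕ} {R : Type u} {M : Type v}
    [AddCommGroup R] [Module ℂ R] [Module ℂ[X] R] [IsScalarTower ℂ ℂ[X] R]
    [AddCommGroup M] [Module ℂ M] [Module ℂ[X] M] [IsScalarTower ℂ ℂ[X] M]
    (A : NLieConf.NLieConformalAlgebra s R) (V : NLieConf.ConformalRep A M)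
    (p : ℕ) (hp : 1 ≤ p) :
    NLieConf.IsNLieBracket (NLieConf.annBracket p A) ∧
    NLieConf.IsNLieRep (NLieConf.annBracket p A) (NLieConf.annAction p V) ∧
    (∀ k, ∀ γ ∈ NLieConf.basicCochain s R M k,
      NLieConf.basicDel s R M k γ ∈ NLieConf.basicCochain s R M k) ∧
    (∀ k, ∀ γ ∈ NLieConf.nLieCochain s (NLieConf.annihilation p R) M k,
      NLieConf.annCochainDel p R s M k γ ∈
        NLieConf.nLieCochain s (NLieConf.annihilation p R) M k) ∧
    (∀ (d : ℕ) (v : Fin d → R), LinearIndependent ℂ[X] v →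
      IsCompl (Submodule.span ℂ[X] (Set.range v)) (Submodule.torsion ℂ[X] R) →
      ∀ k, ∀ γ ∈ NLieConf.nLieCochain s (NLieConf.annihilation p R) M k,
        γ ∈ NLieConf.localCochain p R s M k ↔
          NLieConf.IsContinuousFamily (NLieConf.annTopology p v) γ) ∧
    ∃ (hB : NLieConf.IsComplex (NLieConf.basicCochain s R M) (NLieConf.basicD V))
      (hL : NLieConf.IsComplex (NLieConf.nLieCochain s (NLieConf.annihilation p R) M)
        (NLieConf.nLieD (NLieConf.annBracket p A) (NLieConf.annAction p V)))
      (hloc : NLieConf.IsComplex (NLieConf.localCochain p R s M)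
        (NLieConf.nLieD (NLieConf.annBracket p A) (NLieConf.annAction p V)))
      (φ : hB.complex ⟶ hL.complex) (ψ : hB.complex ⟶ hloc.complex),
      (∀ (k : ℕ) (γ : hB.complex.X k) (m : Fin k → Fin (s + 1) → Fin p → ℕ) (m' : Fin p → ℕ)
        (a : Fin k → Fin (s + 1) → R) (a' : R),
        hL.val (φ.f k γ) (fun i j => NLieConf.ann (m i j) (a i j)) (NLieConf.ann m' a') =
          hB.val γ (fun i j => ∑ c, m i j c) (∑ c, m' c) a a') ∧
      Mono φ ∧ (∀ k, Function.Injective (φ.f k)) ∧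
      (∀ (k : ℕ) (γ δ : hB.complex.X k), hB.val δ = NLieConf.basicDel s R M k (hB.val γ) →
        hL.val (φ.f k δ) = NLieConf.annCochainDel p R s M k (hL.val (φ.f k γ))) ∧
      ψ ≫ hloc.incl hL (NLieConf.localCochain_le p R) = φ ∧
      (p = 1 → IsIso ψ ∧ ∀ k, IsIso (HomologicalComplex.homologyMap ψ k)) := by
  have hB := basicCochain_isComplex V
  have hL := nLieCochain_isComplex (annBracket_isNLieBracket (p := p) A) (annAction_isNLieRep V)
  have hloc := localCochain_isComplex V p
  have hf := fun k (γ : basicCochain s R M k) => nLieD_lift V p γ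
  let ψ : hB.complex ⟶ hloc.complex := hB.hom hloc (lift s R M p) hf
  let φ : hB.complex ⟶ hL.complex :=
    hB.hom hL (fun k => Submodule.inclusion (localCochain_le p R k) ∘ₗ lift s R M p k) hf
  have hinj : ∀ k, Function.Injective (φ.f k) := fun k =>
    (Submodule.inclusion_injective (localCochain_le p R k)).comp (lift_injective hp k)
  refine ⟨annBracket_isNLieBracket A, annAction_isNLieRep V, fun k γ => basicDel_mem,
    fun k γ => annCochainDel_mem, fun d v _ hv k γ hγ =>
      ⟨isContinuousFamily_of_local v hp hv.sup_eq_top,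
        local_of_isContinuousFamily v hp hv.sup_eq_top hγ⟩,
    hB, hL, hloc, φ, ψ, fun k γ => ?_, ?_, hinj, fun k γ δ h => ?_,
    ?_, ?_⟩
  · exact lift_ann p (show basicCochain s R M k from γ)
  · have : ∀ k, Mono (φ.f k) := fun k => (ModuleCat.mono_iff_injective _).2 (hinj k)
    exact HomologicalComplex.mono_of_mono_f φ this
  · have h1 : (show basicCochain s R M k from δ) =
      ⟨basicDel s R M k (hB.val γ), basicDel_mem (hB.val_mem γ)⟩ := Subtype.ext h
    have h2 := annCochainDel_lift p (show basicCochain s R M k from γ)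
    refine Eq.trans ?_ h2.symm
    exact congrArg (fun z => (lift s R M p k z).1) h1
  · rfl
  · rintro rfl
    have : ∀ k, IsIso (ψ.f k) := fun k =>
      (ConcreteCategory.isIso_iff_bijective _).2 ⟨lift_injective hp k, lift_surjective k⟩
    have : IsIso ψ := HomologicalComplex.Hom.isIso_of_components ψ
    exact ⟨this, fun k => inferInstance⟩
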